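/- Setting. Let $X,Y$ be metric spaces with bounded geometry (for every $r>0$ the balls of radius $r$ have uniformly bounded cardinality), $H$ a real Hilbert space, $p:X\to Y$ and $f:Y\to H$ maps such that $p$ is uniformly expansive, the family $\{p^{-1}(B_Y(y,R))\}_{y\in Y}$ has equi-property A for every $R>0$, and $f$ is a coarse embedding; assume that $V=\mathrm{span}\,f(Y)$ is dense in $H$. Here a family $\{X_i\}_{i\in I}$ of subspaces has equi-property A if for all $R,\varepsilon>0$ there are $S>0$ and maps $\xi^{(i)}:X_i\to\ell^2(X_i)$ with $\xi^{(i)}_x(y)\in[0,1]$, $\|\xi^{(i)}_x\|=1$, $\sup\{\|\xi^{(i)}_x-\xi^{(i)}_y\| : i\in I,\ x,y\in X_i,\ d(x,y)\le R\}<\varepsilon$ and $\mathrm{supp}\,\xi^{(i)}_x\subseteq B(x,S)$. Let $W_n(y)=\mathrm{span}\{f(y'):d_Y(y,y')\le n^2\}$, so that $V=\bigcup_n W_n(y)$. For a finite-dimensional $W\subseteq V$ let $\mathcal A(W)=C_0(\mathbb R)\widehat\otimes C_0(W,\mathrm{Cliff}(W))$ (graded tensor product), whose elements are viewed as functions $\mathbb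 R\times W\to\mathrm{Cliff}(W)$, and let $\mathcal A(V)=\varinjlim\mathcal A(W)$ be the Higson–Kasparov–Trout algebra, with the canonical maps $\beta_W:\mathcal A(W)\to\mathcal A(V)$. Give $\mathbb R_+\times H$ the topology in which $(t_j,v_j)\to(t,v)$ iff $t_j^2+\|v_j\|^2\to t^2+\|v\|^2$ and $v_j\to v$ weakly; $C_0(\mathbb R_+\times H)$ acts on $\mathcal A(V)$ by multiplication. The support of $a\in\mathcal A(V)$ is the complement of the set of points $q$ for which there is $g\in C_0(\mathbb R_+\times H)$ with $g(q)\ne0$ and $ga=0$. For $O\subseteq\mathbb R_+\times H$ put $\mathcal A_O=\{a\in\mathcal A(V):\mathrm{supp}(a)\subseteq O\}$. Let $r>0$, let $\{O_i\}_{i\in I}$ be pairwise disjoint open subsets of $\mathbb R_+\times H$ and $x_i\in X$ points with $O_i\subseteq\{(t,h):t^2+\|h-f(p(x_i))\|^2<r^2\}$, and let $\{X_i\}_{i\in I}$ be subspaces of $X$ with equi-property A and $x_i\in X_i$. Let $\mathbb C_u[X_i]$ be the $*$-algebra of bounded complex $X_i\times X_i$ matrices of finite propagation. Let $\mathbb A_u[X_i,i\in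 I]$ be the set of all families $T=(T_i)_i\in\prod_i\mathbb C_u[X_i]\odot\mathcal A_{O_i}$ (algebraic tensor product, seen as $X_i\times X_i$ matrices with entries in $\mathcal A_{O_i}$) such that 1. there is $S>0$ with $T_i(x,y)=0$ whenever $d(x,y)\ge S$, for all $i$; 2. there is $M>0$ with $\|T_i(x,y)\|<M$ for all $i,x,y$; 3. there are $N\in\mathbb N$ and $T_{1,i}\in\mathbb C_u[X_i]\odot\mathcal A(W_N(p(x_i)))$ with $\beta_{W_N(p(x_i))}(T_{1,i}(x,y))=T_i(x,y)$ for all $i,x,y$; 4. there is $c>0$ such that for all $i$ and all $Z=(s,h)\in\mathbb R_+\times W_N(p(x_i))$ with $s^2+\|h\|^2\le1$ the entrywise directional derivative $D_Z(T_{1,i})$ exists in $\mathbb C_u[X_i]\odot\mathcal A(W_N(p(x_i)))$ and its entries have norm at most $c$. Statement. $\mathbb A_u[X_i,i\in I]$ is a $*$-algebra under the matrix operations. Both the maximal norm $\|T\|_{\max}=\sup_\pi\|\pi(T)\|$, over all $*$-representations $\pi$ of $\mathbb A_u[X_i,i\in I]$ on Hilbert spaces, and the reduced norm, the operator norm of $T$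 acting by matrix multiplication on the Hilbert module $\bigoplus_i\ell^2(X_i)\widehat\otimes\mathcal A_{O_i}$, are finite and have C$^*$-algebra completions $A^*_{u,\max}(X_i,i\in I)$ and $A^*_u(X_i,i\in I)$. The canonical quotient map (the identity on $\mathbb A_u[X_i,i\in I]$) $$\lambda:A^*_{u,\max}(X_i,i\in I)\to A^*_u(X_i,i\in I)$$ is an isomorphism of C$^*$-algebras. -/

import Mathlib

open scoped ENNReal NNReal ZeroAtInfty

universe u v w

namespace TwistedRoe

noncomputable section


section Coarse

/-- Bounded geometry: balls of a given radius have uniformly bounded cardinality. -/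
class BoundedGeometry (X : Type*) [MetricSpace X] : Prop where
  bound : ∀ r : ℝ, 0 < r → ∃ N : ℕ, ∀ x : X, (Metric.closedBall x r).encard ≤ N

/-- Equi-property A for a family of subspaces of a metric space. -/
def EquiPropertyA {X : Type*} [MetricSpace X] {I : Type*} (Xs : I → Set X) : Prop :=
  ∀ R : ℝ, 0 < R → ∀ ε : ℝ, 0 < ε → ∃ S : ℝ, 0 < S ∧
    ∃ ξ : ∀ i, Xs i → lp (fun _ : Xs i => ℝ) 2,
      (∀ i x y, ξ i x y ∈ Set.Icc (0 : ℝ) 1) ∧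
      (∀ i x, ‖ξ i x‖ = 1) ∧
      (∃ δ : ℝ, δ < ε ∧ ∀ i (x y : Xs i), dist x y ≤ R → ‖ξ i x - ξ i y‖ ≤ δ) ∧
      ∀ i (x y : Xs i), ξ i x y ≠ 0 → dist y x < S

/-- Coarse embeddings. -/
def IsCoarseEmbedding {Y H : Type*} [PseudoMetricSpace Y] [PseudoMetricSpace H]
    (f : Y → H) : Prop :=
  ∃ ρ₁ ρ₂ : ℝ≥0 → ℝ≥0, Monotone ρ₁ ∧ Monotone ρ₂ ∧
    Filter.Tendsto ρ₁ Filter.atTop Filter.atTop ∧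
    ∀ x y, ρ₁ (nndist x y) ≤ nndist (f x) (f y) ∧ nndist (f x) (f y) ≤ ρ₂ (nndist x y)

/-- `p : X → Y` and `f : Y → H` exhibit `X` as an A-by-CE coarse fibration. -/
structure IsAbyCEFibration {X Y H : Type*} [MetricSpace X] [MetricSpace Y]
    [PseudoMetricSpace H] (p : X → Y) (f : Y → H) : Prop where
  expansive : ∀ r : ℝ, 0 < r → ∃ s : ℝ, 0 < s ∧
    ∀ x x' : X, dist x x' < r → dist (p x) (p x') < s
  fibres : ∀ R : ℝ, 0 < R → EquiPropertyA fun y : Y => p ⁻¹' Metric.ball y R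
  coarse : IsCoarseEmbedding f

end Coarse

section BoundedFunctions

/-- The C*-algebra of bounded functions `S → A`, with pointwise operations and the supremum
norm. -/
def BddFun (S A : Type u) [NonUnitalCStarAlgebra A] : Type u := lp (fun _ : S => A) ∞

namespace BddFun

variable {S A : Type u} [NonUnitalCStarAlgebra A]

instance : NonUnitalCStarAlgebra (BddFun S A) :=
  inferInstanceAs (NonUnitalCStarAlgebra (lp (fun _ : S => A) ∞))

/-- The values of a bounded function. -/
def toFun (f : BddFun S A) : S → A := f.1

instance : CoeFun (BddFun S A) fun _ => S → A := ⟨toFun⟩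

/-- A bounded function as an element of `BddFun`. -/
def mk (f : S → A) (C : ℝ) (h : ∀ s, ‖f s‖ ≤ C) : BddFun S A :=
  ⟨f, memℓp_infty ⟨C, by
    rintro _ ⟨s, rfl⟩
    exact h s⟩⟩

theorem norm_mk_le (f : S → A) (C : ℝ) (h : ∀ s, ‖f s‖ ≤ C) (hC : 0 ≤ C) : ‖mk f C h‖ ≤ C :=
  lp.norm_le_of_forall_le (E := fun _ : S => A) (f := mk f C h) hC h

end BddFun

end BoundedFunctions

section Clifford

variable (H : Type u) [NormedAddCommGroup H] [InnerProductSpace ℝ H]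

/-- A Hilbert space large enough to carry every cyclic representation of the Clifford algebra
of `ℝ ⊕ H`, with infinite multiplicity. -/
abbrev RepSpace : Type u := lp (fun _ : ℕ × H => ℂ) 2

instance : Nontrivial (RepSpace H) := by
  classical
  refine ⟨lp.single 2 (0, 0) (1 : ℂ), 0, fun hc => ?_⟩
  have := congrArg (fun f : RepSpace H => f (0, 0)) hc
  simp at this

/-- The bounded operators on `RepSpace H`. -/
def RepOp : Type u := RepSpace H →L[ℂ] RepSpace H

instance : CStarAlgebra (RepOp H) := inferInstanceAs (CStarAlgebra (RepSpace H →L[ℂ] RepSpace H))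

instance : Nontrivial (RepOp H) := inferInstanceAs (Nontrivial (RepSpace H →L[ℂ] RepSpace H))

/-- A `*`-representation of the complex Clifford algebra of the Euclidean space `ℝ ⊕ H`
(with vectors self-adjoint and `z² = ‖z‖²`). By the universal property of the Clifford algebra it
is the same as its restriction to vectors, a real linear map with these two properties. -/
structure CliffordRep where
  map : ℝ × H →ₗ[ℝ] RepOp H
  selfAdjoint : ∀ z, star (map z) = map z
  sq : ∀ z, map z * map z = ((z.1 ^ 2 + ‖z.2‖ ^ 2 : ℝ) : ℂ) • (1 : RepOp H)

theorem CliffordRep.norm_le {H : Type u} [NormedAddCommGroup H] [InnerProductSpace ℝ H]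
    (c : CliffordRep H) (z : ℝ × H) : ‖c.map z‖ ≤ √(z.1 ^ 2 + ‖z.2‖ ^ 2) := by
  apply Real.le_sqrt_of_sq_le
  have h : ‖star (c.map z) * c.map z‖ = ‖c.map z‖ * ‖c.map z‖ := CStarRing.norm_star_mul_self
  rw [c.selfAdjoint, c.sq, norm_smul, norm_one, mul_one, Complex.norm_real,
    Real.norm_of_nonneg (by positivity)] at h
  nlinarith

/-- The C*-algebra containing the universal Clifford C*-algebra of `ℝ ⊕ H` (the product of all
representations; its norm on Clifford elements is the Clifford C*-norm). -/
abbrev Cliff : Type u := BddFun (CliffordRep H) (RepOp H)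

variable {H}

/-- A vector of `ℝ ⊕ H`, seen in the Clifford algebra. -/
def cliffordVec (z : ℝ × H) : Cliff H :=
  BddFun.mk (fun c : CliffordRep H => c.map z) _ fun c => c.norm_le z

theorem norm_cliffordVec_le (z : ℝ × H) : ‖cliffordVec z‖ ≤ √(z.1 ^ 2 + ‖z.2‖ ^ 2) :=
  BddFun.norm_mk_le _ _ _ (Real.sqrt_nonneg _)

variable (H) in
/-- The unit of the Clifford algebra. -/
def cliffordOne : Cliff H :=
  BddFun.mk (fun _ : CliffordRep H => (1 : RepOp H)) 1 fun _ => norm_one.le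

/-- The complex Clifford algebra `Cliff(W)` of a subspace `W` of `H`, generated by the unit and the
vectors of `W`. -/
def cliffordSub (W : Submodule ℝ H) : NonUnitalSubalgebra ℂ (Cliff H) :=
  NonUnitalAlgebra.adjoin ℂ
    (insert (cliffordOne H) ((fun w : H => cliffordVec ((0 : ℝ), w)) '' (W : Set H)))

end Clifford

section HKT

/-- The space `ℝ₊ × H`, with the topology in which `(tᵢ, vᵢ) → (t, v)` iff
`tᵢ² + ‖vᵢ‖² → t² + ‖v‖²` and `vᵢ → v` weakly. -/
def HKTSpace (H : Type u) : Type u := ℝ≥0 × H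

variable {H : Type u} [NormedAddCommGroup H] [InnerProductSpace ℝ H]

instance : TopologicalSpace (HKTSpace H) :=
  TopologicalSpace.induced
    (fun q : HKTSpace H => ((q.1 : ℝ) ^ 2 + ‖q.2‖ ^ 2, fun u : H => inner ℝ q.2 u)) inferInstance

/-- The ball `B(v, r) = {(t, w) | t² + ‖w - v‖² < r²}` in `ℝ₊ × H`. -/
def hktBall (v : H) (r : ℝ) : Set (HKTSpace H) :=
  {q | (q.1 : ℝ) ^ 2 + ‖q.2 - v‖ ^ 2 < r ^ 2}

variable (H) in
/-- The C*-algebra of all bounded functions `ℝ₊ × H → Cliff(ℝ ⊕ H)` with pointwise operations and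
the supremum norm. -/
abbrev HKTFun : Type u := BddFun (HKTSpace H) (Cliff H)

/-- The space `𝒮 ⊗̂ 𝒞(W) = C₀(ℝ × W, Cliff(W))` underlying `𝒜(W)`, for a finite-dimensional
subspace `W` of `H`. Its (graded) multiplication, involution and norm are those for which the
injective map `beta W` below is an isometric `*`-homomorphism. -/
def hktLocal (W : Submodule ℝ H) : Submodule ℂ C₀(ℝ × W, Cliff H) where
  carrier := {F | ∀ q, F q ∈ cliffordSub W}
  zero_mem' := fun _ => (cliffordSub W).zero_mem
  add_mem' := fun hF hG q => (cliffordSub W).add_mem (hF q) (hG q)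
  smul_mem' := fun c _ hF q => (cliffordSub W).smul_mem' c (hF q)

/-- Even part in the variable of `𝒮 = C₀(ℝ)`. -/
def evenPart {W : Submodule ℝ H} (F : C₀(ℝ × W, Cliff H)) (t : ℝ) (w : W) : Cliff H :=
  (2⁻¹ : ℂ) • (F (t, w) + F (-t, w))

/-- Odd part in the variable of `𝒮 = C₀(ℝ)`. -/
def oddPart {W : Submodule ℝ H} (F : C₀(ℝ × W, Cliff H)) (t : ℝ) (w : W) : Cliff H :=
  (2⁻¹ : ℂ) • (F (t, w) - F (-t, w))

theorem norm_apply_le {W : Submodule ℝ H} (F : C₀(ℝ × W, Cliff H)) (q : ℝ × W) :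
    ‖F q‖ ≤ ‖F‖ :=
  F.toBCF.norm_coe_le_norm q

theorem norm_evenPart_le {W : Submodule ℝ H} (F : C₀(ℝ × W, Cliff H)) (t : ℝ) (w : W) :
    ‖evenPart F t w‖ ≤ ‖F‖ := by
  have h := norm_add_le (F (t, w)) (F (-t, w))
  have h1 := norm_apply_le F (t, w)
  have h2 := norm_apply_le F (-t, w)
  have h3 : ‖(2⁻¹ : ℂ)‖ = 2⁻¹ := by simp
  rw [evenPart, norm_smul, h3]
  linarith

theorem norm_oddPart_le {W : Submodule ℝ H} (F : C₀(ℝ × W, Cliff H)) (t : ℝ) (w : W) :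
    ‖oddPart F t w‖ ≤ ‖F‖ := by
  have h := norm_sub_le (F (t, w)) (F (-t, w))
  have h1 := norm_apply_le F (t, w)
  have h2 := norm_apply_le F (-t, w)
  have h3 : ‖(2⁻¹ : ℂ)‖ = 2⁻¹ := by simp
  rw [oddPart, norm_smul, h3]
  linarith

/-- The value at `(t, v) ∈ ℝ₊ × H` of the image of `F` in the direct limit. With
`z = t ⊕ (v - P_W v)`, a self-adjoint Clifford element with `z² = ρ²`, `ρ = ‖z‖`, the functional
calculus of the (unbounded) multiplier `X ⊗̂ 1 + 1 ⊗̂ C` at `(t, v)` is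
`g(z) = g_even(ρ) + (z / ρ) g_odd(ρ)`. So for `F = g ⊗̂ h` this is `g(z) h(P_W v)`, that is
`g(X ⊗̂ 1 + 1 ⊗̂ C) (1 ⊗̂ h̃)`. -/
def betaFun (W : Submodule ℝ H) [W.HasOrthogonalProjection] (F : C₀(ℝ × W, Cliff H))
    (q : HKTSpace H) : Cliff H :=
  let w : W := W.orthogonalProjectionOnto q.2
  let z : ℝ × H := ((q.1 : ℝ), q.2 - w)
  let ρ : ℝ := √(z.1 ^ 2 + ‖z.2‖ ^ 2)
  evenPart F ρ w + (ρ⁻¹ : ℂ) • (cliffordVec z * oddPart F ρ w)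

theorem norm_betaFun_le (W : Submodule ℝ H) [W.HasOrthogonalProjection]
    (F : C₀(ℝ × W, Cliff H)) (q : HKTSpace H) : ‖betaFun W F q‖ ≤ ‖F‖ + ‖F‖ := by
  refine (norm_add_le _ _).trans (add_le_add (norm_evenPart_le F _ _) ?_)
  have h := norm_oddPart_le F
    (√((q.1 : ℝ) ^ 2 + ‖q.2 - W.orthogonalProjectionOnto q.2‖ ^ 2))
    (W.orthogonalProjectionOnto q.2)
  have h' := norm_cliffordVec_le ((q.1 : ℝ), q.2 - W.orthogonalProjectionOnto q.2)
  dsimp only at h'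
  dsimp only
  set ρ : ℝ := √((q.1 : ℝ) ^ 2 + ‖q.2 - W.orthogonalProjectionOnto q.2‖ ^ 2)
  have hρ : 0 ≤ ρ := Real.sqrt_nonneg _
  rw [norm_smul, norm_inv, Complex.norm_real, Real.norm_of_nonneg hρ]
  calc _ ≤ ρ⁻¹ * (ρ * ‖F‖) := by
        gcongr
        exact (norm_mul_le _ _).trans (by gcongr)
    _ = (ρ⁻¹ * ρ) * ‖F‖ := by ring
    _ ≤ 1 * ‖F‖ := by
        gcongr
        exact inv_mul_le_one
    _ = ‖F‖ := one_mul _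

/-- The map `β_W` from `𝒜(W)` to the direct limit `𝒜(V)`. -/
def beta (W : Submodule ℝ H) [W.HasOrthogonalProjection] (F : C₀(ℝ × W, Cliff H)) : HKTFun H :=
  BddFun.mk (betaFun W F) _ (norm_betaFun_le W F)

/-- The C*-algebra `𝒜(V)`, the C*-direct limit of the algebras `𝒜(W)`: the C*-algebra generated by
their images in the bounded functions on `ℝ₊ × H`. The linear subspaces are cofinal among all
finite-dimensional affine subspaces of `V`. -/
def hktAlgebra (V : Submodule ℝ H) : NonUnitalStarSubalgebra ℂ (HKTFun H) :=
  (NonUnitalStarAlgebra.adjoin ℂ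
    {a : HKTFun H | ∃ (W : Submodule ℝ H) (_ : FiniteDimensional ℝ W), W ≤ V ∧
      ∃ F ∈ hktLocal W, beta W F = a}).topologicalClosure

/-- The support of `a`: the complement of the set of points `q` at which some
`g ∈ C₀(ℝ₊ × H)` with `g a = 0` does not vanish. -/
def hktSupport (a : HKTFun H) : Set (HKTSpace H) :=
  {q | ∃ g : C₀(HKTSpace H, ℂ), g q ≠ 0 ∧ ∀ q', g q' • a q' = 0}ᶜ

/-- The algebra `𝒜_O` of all elements of `𝒜(V)` with support in `O`. -/
def hktIdeal (V : Submodule ℝ H) (O : Set (HKTSpace H)) : Set (HKTFun H) :=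
  {a | a ∈ hktAlgebra V ∧ hktSupport a ⊆ O}

/-- `{O i}` is a family of pairwise disjoint open subsets of `ℝ₊ × H`, with `O i` contained in the
ball of radius `r` around `c i`. -/
structure IsSeparate {I : Type*} (r : ℝ) (c : I → H) (O : I → Set (HKTSpace H)) : Prop where
  isOpen : ∀ i, IsOpen (O i)
  subset : ∀ i, O i ⊆ hktBall (c i) r
  disjoint : ∀ i j, i ≠ j → Disjoint (O i) (O j)

end HKT

section Matrices

/-- The `Z`-by-`Z` matrices with entries in `A` whose rows and columns are finite. -/
def rcSubmodule (Z A : Type u) [NonUnitalCStarAlgebra A] : Submodule ℂ (Z → Z → A) where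
  carrier := {T | (∀ x, {y | T x y ≠ 0}.Finite) ∧ ∀ y, {x | T x y ≠ 0}.Finite}
  zero_mem' := by simp
  add_mem' := by
    rintro S T ⟨h1, h2⟩ ⟨h3, h4⟩
    refine ⟨fun x => ((h1 x).union (h3 x)).subset ?_, fun y => ((h2 y).union (h4 y)).subset ?_⟩ <;>
    · intro w hw
      by_contra hc
      simp only [Set.mem_union, Set.mem_ofPred_eq, not_or, not_not] at hc hw
      exact hw (by simp [hc.1, hc.2])
  smul_mem' := by
    rintro c T ⟨h1, h2⟩
    refine ⟨fun x => (h1 x).subset ?_, fun y => (h2 y).subset ?_⟩ <;>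
    · intro w hw hc
      exact hw (by simp [hc])

/-- The `*`-algebra of the `Z`-by-`Z` matrices with entries in `A` whose rows and columns are
finite, with the usual matrix operations. -/
def RCMat (Z A : Type u) [NonUnitalCStarAlgebra A] : Type u := rcSubmodule Z A

namespace RCMat

variable {Z : Type u} {A : Type u} [NonUnitalCStarAlgebra A]

instance : AddCommGroup (RCMat Z A) := inferInstanceAs (AddCommGroup (rcSubmodule Z A))

instance : Module ℂ (RCMat Z A) := inferInstanceAs (Module ℂ (rcSubmodule Z A))

/-- The matrix entries. -/
def entry (T : RCMat Z A) : Z → Z → A := T.1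

theorem finite_row (T : RCMat Z A) (x : Z) : {y | T.entry x y ≠ 0}.Finite := T.2.1 x

theorem finite_col (T : RCMat Z A) (y : Z) : {x | T.entry x y ≠ 0}.Finite := T.2.2 y

@[ext] theorem ext' {S T : RCMat Z A} (h : ∀ x y, S.entry x y = T.entry x y) : S = T :=
  Subtype.ext (funext fun x => funext fun y => h x y)

instance : Mul (RCMat Z A) where
  mul S T := ⟨fun x y => ∑ᶠ z, S.entry x z * T.entry z y, by
    constructor
    · intro x
      refine ((S.finite_row x).biUnion fun z _ => T.finite_row z).subset fun y hy => ?_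
      obtain ⟨z, hz⟩ : ∃ z, S.entry x z * T.entry z y ≠ 0 := by
        by_contra! hc
        exact hy (by simp [hc])
      exact Set.mem_biUnion (x := z) (fun h => hz (by simp [h])) (fun h => hz (by simp [h]))
    · intro y
      refine ((T.finite_col y).biUnion fun z _ => S.finite_col z).subset fun x hx => ?_
      obtain ⟨z, hz⟩ : ∃ z, S.entry x z * T.entry z y ≠ 0 := by
        by_contra! hc
        exact hx (by simp [hc])
      exact Set.mem_biUnion (x := z) (fun h => hz (by simp [h])) (fun h => hz (by simp [h]))⟩

theorem mul_apply (S T : RCMat Z A) (x y : Z) :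
    (S * T).entry x y = ∑ᶠ z, S.entry x z * T.entry z y := rfl

theorem zero_apply (x y : Z) : (0 : RCMat Z A).entry x y = 0 := rfl

theorem add_apply (S T : RCMat Z A) (x y : Z) : (S + T).entry x y = S.entry x y + T.entry x y := rfl

theorem mul_eq_sum (S T : RCMat Z A) (x y : Z) (s : Finset Z)
    (hs : ∀ z, S.entry x z ≠ 0 → z ∈ s) :
    (S * T).entry x y = ∑ z ∈ s, S.entry x z * T.entry z y := by
  rw [mul_apply]
  exact finsum_eq_sum_of_support_subset _ fun z hz => hs z fun h => hz (by simp [h])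

theorem mul_eq_sum' (S T : RCMat Z A) (x y : Z) (s : Finset Z)
    (hs : ∀ z, T.entry z y ≠ 0 → z ∈ s) :
    (S * T).entry x y = ∑ z ∈ s, S.entry x z * T.entry z y := by
  rw [mul_apply]
  exact finsum_eq_sum_of_support_subset _ fun z hz => hs z fun h => hz (by simp [h])

instance : NonUnitalRing (RCMat Z A) where
  left_distrib R S T := by
    ext x y
    have h : ∀ z, R.entry x z ≠ 0 → z ∈ (R.finite_row x).toFinset := fun z hz => by simpa using hz
    simp only [add_apply, mul_eq_sum R _ x y _ h, mul_add, Finset.sum_add_distrib]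
  right_distrib R S T := by
    ext x y
    have h : ∀ z, T.entry z y ≠ 0 → z ∈ (T.finite_col y).toFinset := fun z hz => by simpa using hz
    simp only [add_apply, mul_eq_sum' _ T x y _ h, add_mul, Finset.sum_add_distrib]
  zero_mul T := by
    ext x y
    rw [mul_apply]
    simp [zero_apply]
  mul_zero T := by
    ext x y
    rw [mul_apply]
    simp [zero_apply]
  mul_assoc R S T := by
    ext x y
    have h : ∀ z, R.entry x z ≠ 0 → z ∈ (R.finite_row x).toFinset := fun z hz => by simpa using hz
    have h' : ∀ z, T.entry z y ≠ 0 → z ∈ (T.finite_col y).toFinset := fun z hz => by simpa using hz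
    rw [mul_eq_sum R _ x y _ h, mul_eq_sum' _ T x y _ h']
    simp only [mul_eq_sum R _ x _ _ h, mul_eq_sum' _ T _ y _ h', Finset.sum_mul, Finset.mul_sum,
      mul_assoc]
    exact Finset.sum_comm

instance : StarRing (RCMat Z A) where
  star T := ⟨fun x y => star (T.entry y x),
    fun x => (T.finite_col x).subset fun y hy h => hy (by simp [h]),
    fun y => (T.finite_row y).subset fun x hx h => hx (by simp [h])⟩
  star_involutive T := by
    ext x y
    exact star_star _
  star_mul S T := by
    ext x y
    change star ((S * T).entry y x) = ∑ᶠ z, star (T.entry z x) * star (S.entry y z)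
    have h : ∀ z, S.entry y z ≠ 0 → z ∈ (S.finite_row y).toFinset := fun z hz => by simpa using hz
    rw [mul_eq_sum S T y x _ h, star_sum,
      finsum_eq_sum_of_support_subset (s := (S.finite_row y).toFinset)]
    · simp only [star_mul]
    · exact fun z hz => h z fun h => hz (by simp [h])
  star_add S T := by
    ext x y
    exact star_add _ _

theorem smul_apply (c : ℂ) (T : RCMat Z A) (x y : Z) : (c • T).entry x y = c • T.entry x y := rfl

instance : StarModule ℂ (RCMat Z A) where
  star_smul c T := by
    ext x y
    exact star_smul c (T.entry y x)

instance : IsScalarTower ℂ (RCMat Z A) (RCMat Z A) where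
  smul_assoc c S T := by
    ext x y
    have h : ∀ z, S.entry x z ≠ 0 → z ∈ (S.finite_row x).toFinset := fun z hz => by simpa using hz
    have h2 : ∀ z, (c • S).entry x z ≠ 0 → z ∈ (S.finite_row x).toFinset :=
      fun z hz => h z fun h => hz (by simp [smul_apply, h])
    rw [smul_eq_mul, smul_eq_mul, smul_apply, mul_eq_sum _ T x y _ h2, mul_eq_sum S T x y _ h]
    simp only [smul_apply, Finset.smul_sum, smul_mul_assoc]

instance : SMulCommClass ℂ (RCMat Z A) (RCMat Z A) where
  smul_comm c S T := by
    ext x y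
    have h : ∀ z, S.entry x z ≠ 0 → z ∈ (S.finite_row x).toFinset := fun z hz => by simpa using hz
    rw [smul_eq_mul, smul_eq_mul, mul_eq_sum S (c • T) x y _ h, smul_apply,
      mul_eq_sum S T x y _ h]
    simp only [smul_apply, Finset.smul_sum, mul_smul_comm]

end RCMat

/-- The algebraic uniform Roe algebra `ℂ_u[Z]`, as a set of matrices. -/
def uniformRoe (Z : Type*) [MetricSpace Z] : Set (Z → Z → ℂ) :=
  {t | (∃ s : ℝ, 0 < s ∧ ∀ x y, s ≤ dist x y → t x y = 0) ∧ ∃ M : ℝ, ∀ x y, ‖t x y‖ ≤ M}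

/-- The algebraic tensor product `ℂ_u[Z] ⊙ E`, for a set `E` of vectors (in the application a
linear subspace), as a set of matrices: the finite sums of elementary tensors. -/
def roeTensor (Z : Type*) [MetricSpace Z] {M : Type*} [AddCommMonoid M] [Module ℂ M] (E : Set M) :
    Set (Z → Z → M) :=
  {T | ∃ (n : ℕ) (t : Fin n → Z → Z → ℂ) (a : Fin n → M),
    (∀ m, t m ∈ uniformRoe Z) ∧ (∀ m, a m ∈ E) ∧ ∀ x y, T x y = ∑ m, t m x y • a m}

end Matrices

section TwistedAlgebra

variable {X Y H I : Type u} [MetricSpace X] [MetricSpace Y] [BoundedGeometry Y]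
  [NormedAddCommGroup H] [InnerProductSpace ℝ H]

/-- `W_n(y)`, the span of the `f y'` with `d(y, y') ≤ n²`. -/
def fibreSpan (f : Y → H) (n : ℕ) (y : Y) : Submodule ℝ H :=
  Submodule.span ℝ (f '' {y' | dist y y' ≤ (n : ℝ) ^ 2})

instance (f : Y → H) (n : ℕ) (y : Y) : FiniteDimensional ℝ (fibreSpan f n y) := by
  obtain ⟨N, hN⟩ := BoundedGeometry.bound (X := Y) ((n : ℝ) ^ 2 + 1) (by positivity)
  have h : (Metric.closedBall y ((n : ℝ) ^ 2 + 1)).Finite :=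
    Set.finite_of_encard_le_coe (hN y)
  refine FiniteDimensional.span_of_finite ℝ ((h.subset fun y' hy' => ?_).image f)
  have h' : dist y y' ≤ (n : ℝ) ^ 2 := hy'
  rw [Metric.mem_closedBall, dist_comm]
  linarith

/-- The subspace `V = ⋃ₙ W_n(y)` of `H`. -/
def totalSpan (f : Y → H) : Submodule ℝ H := Submodule.span ℝ (Set.range f)

/-- The families `T = (T_i)` in `∏ ℂ_u[X_i] ⊙ 𝒜_{O_i}` that make up `𝔸_u[X_i, i ∈ I]`. -/
structure IsTwisted (f : Y → H) (p : X → Y) (O : I → Set (HKTSpace H)) (x₀ : I → X)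
    (Xs : I → Set X) (T : ∀ i, RCMat (Xs i) (HKTFun H)) : Prop where
  mem_tensor : ∀ i, (T i).entry ∈ roeTensor (Xs i) (hktIdeal (totalSpan f) (O i))
  propagation : ∃ S : ℝ, 0 < S ∧ ∀ i x y, (T i).entry x y ≠ 0 → dist x y < S
  bounded : ∃ M : ℝ, 0 < M ∧ ∀ i x y, ‖(T i).entry x y‖ < M
  smooth : ∃ (N : ℕ) (T₁ : ∀ i, Xs i → Xs i → C₀(ℝ × fibreSpan f N (p (x₀ i)), Cliff H)),
    (∀ i, T₁ i ∈ roeTensor (Xs i)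
        (hktLocal (fibreSpan f N (p (x₀ i))) : Set C₀(ℝ × fibreSpan f N (p (x₀ i)), Cliff H))) ∧
    (∀ i x y, beta (fibreSpan f N (p (x₀ i))) (T₁ i x y) = (T i).entry x y) ∧
    ∃ c : ℝ, 0 < c ∧ ∀ (i : I) (s : ℝ) (h : fibreSpan f N (p (x₀ i))),
      0 ≤ s → s ^ 2 + ‖h‖ ^ 2 ≤ 1 →
      ∃ D ∈ roeTensor (Xs i)
        (hktLocal (fibreSpan f N (p (x₀ i))) : Set C₀(ℝ × fibreSpan f N (p (x₀ i)), Cliff H)),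
        (∀ x y q, HasLineDerivAt ℝ (T₁ i x y) (D x y q) q (s, h)) ∧
        ∀ x y, ‖beta (fibreSpan f N (p (x₀ i))) (D x y)‖ ≤ c

/-- The `*`-algebra `𝔸_u[X_i, i ∈ I]`. (The families in question are closed under the operations,
which is part of the theorem, so taking the generated `*`-subalgebra adds no elements.) -/
def twistedSubalgebra (f : Y → H) (p : X → Y) (O : I → Set (HKTSpace H)) (x₀ : I → X)
    (Xs : I → Set X) : NonUnitalStarSubalgebra ℂ (∀ i, RCMat (Xs i) (HKTFun H)) :=
  NonUnitalStarAlgebra.adjoin ℂ {T | IsTwisted f p O x₀ Xs T}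

/-- The `*`-algebra `𝔸_u[X_i, i ∈ I]` as a type. -/
def TwistedAlgebra (f : Y → H) (p : X → Y) (O : I → Set (HKTSpace H)) (x₀ : I → X)
    (Xs : I → Set X) : Type u := twistedSubalgebra f p O x₀ Xs

namespace TwistedAlgebra

variable {f : Y → H} {p : X → Y} {O : I → Set (HKTSpace H)} {x₀ : I → X} {Xs : I → Set X}

instance : NonUnitalRing (TwistedAlgebra f p O x₀ Xs) :=
  inferInstanceAs (NonUnitalRing (twistedSubalgebra f p O x₀ Xs))

instance : StarRing (TwistedAlgebra f p O x₀ Xs) :=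
  inferInstanceAs (StarRing (twistedSubalgebra f p O x₀ Xs))

instance : Module ℂ (TwistedAlgebra f p O x₀ Xs) :=
  inferInstanceAs (Module ℂ (twistedSubalgebra f p O x₀ Xs))

instance : IsScalarTower ℂ (TwistedAlgebra f p O x₀ Xs) (TwistedAlgebra f p O x₀ Xs) :=
  inferInstanceAs (IsScalarTower ℂ (twistedSubalgebra f p O x₀ Xs)
    (twistedSubalgebra f p O x₀ Xs))

instance : SMulCommClass ℂ (TwistedAlgebra f p O x₀ Xs) (TwistedAlgebra f p O x₀ Xs) :=
  inferInstanceAs (SMulCommClass ℂ (twistedSubalgebra f p O x₀ Xs)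
    (twistedSubalgebra f p O x₀ Xs))

instance : StarModule ℂ (TwistedAlgebra f p O x₀ Xs) :=
  inferInstanceAs (StarModule ℂ (twistedSubalgebra f p O x₀ Xs))

/-- The family of matrices underlying an element. -/
def val (T : TwistedAlgebra f p O x₀ Xs) : ∀ i, RCMat (Xs i) (HKTFun H) := T.1

end TwistedAlgebra

variable {Xs : I → Set X}

/-- `ξ` belongs to the Hilbert module `⨁ᵢ ℓ²(X_i) ⊗̂ 𝒜_{O_i}`: its coordinates lie in the
C*-algebras `closure 𝒜_{O_i}`, and `∑ ξ* ξ` converges in norm. -/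
structure IsModuleVector (V : Submodule ℝ H) (O : I → Set (HKTSpace H))
    (ξ : (Σ i, Xs i) → HKTFun H) : Prop where
  mem : ∀ z, ξ z ∈ closure (hktIdeal V (O z.1))
  summable : Summable fun z => star (ξ z) * ξ z

/-- The norm `‖∑ ξ* ξ‖^{1/2}` of the Hilbert module. -/
def moduleNorm (ξ : (Σ i, Xs i) → HKTFun H) : ℝ≥0∞ :=
  ‖∑' z, star (ξ z) * ξ z‖ₑ ^ (2⁻¹ : ℝ)

/-- The action of matrices on the Hilbert module. -/
def matAct (T : ∀ i, RCMat (Xs i) (HKTFun H)) (ξ : (Σ i, Xs i) → HKTFun H) :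
    (Σ i, Xs i) → HKTFun H :=
  fun z => ∑ᶠ y : Xs z.1, (T z.1).entry z.2 y * ξ ⟨z.1, y⟩

/-- The reduced norm: the operator norm on the Hilbert module. -/
def redNorm (V : Submodule ℝ H) (O : I → Set (HKTSpace H))
    (T : ∀ i, RCMat (Xs i) (HKTFun H)) : ℝ≥0∞ :=
  ⨆ (ξ : (Σ i, Xs i) → HKTFun H) (_ : IsModuleVector V O ξ) (_ : moduleNorm ξ ≤ 1),
    moduleNorm (matAct T ξ)

end TwistedAlgebra

section Completions

/-- The maximal norm of an element of a `*`-algebra: the supremum of the norms of its images under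
all `*`-representations on Hilbert spaces. -/
def maxNorm {A : Type u} [NonUnitalRing A] [StarRing A] [Module ℂ A] (a : A) : ℝ≥0∞ :=
  ⨆ (K : Type u) (_ : NormedAddCommGroup K) (_ : InnerProductSpace ℂ K) (_ : CompleteSpace K)
    (π : A →⋆ₙₐ[ℂ] (K →L[ℂ] K)), ‖π a‖ₑ

/-- `ι : A → B` exhibits the C*-algebra `B` as the completion of the `*`-algebra `A` for the
(semi)norm `ν`. -/
structure IsCStarCompletion {A : Type*} [NonUnitalRing A] [StarRing A] [Module ℂ A]
    (ν : A → ℝ≥0∞) {B : Type*} [NonUnitalCStarAlgebra B] (ι : A →⋆ₙₐ[ℂ] B) : Prop where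
  norm_eq : ∀ a, ‖ι a‖ₑ = ν a
  dense : DenseRange ι

end Completions

end

end TwistedRoe

namespace TwistedRoe
noncomputable section

set_option linter.unusedSectionVars false

/-! ### Pointwise operations on bounded functions -/

namespace BddFun
variable {S A : Type u} [NonUnitalCStarAlgebra A]

/-! Evaluating matrix entries at a point of `ℝ₊ × H` and in a Clifford representation turns the
twisted algebra into operators on an `ℓ²`-space. These representations control the reduced norm
(`redNorm_le`), so it is at most the maximal norm. The content is the converse. In every
`*`-representation `π`, the norm of `π T` is at most the supremum of the norms of the finite
compressions of `T` (`norm_rep_le_of_matNorm`), and the reduced norm dominates these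
(`matNorm_compress_le_of_redNorm`).

The twisted algebra is not complete, so `π` has no automatic continuity. The substitute is stability
under quasi-inverses. An element `β_W(F)` is encoded by the function `F_even + e F_odd` on `ℝ × W`,
with values in the Clifford algebra of `ℝ ⊕ W`, on which the graded product is pointwise
(`ext₀_symm`). There `C¹`-bounds survive products and resolvents (`exists_quasiInverse`) and, up to
a factor `6`, enlarging `W` (`IsSmooth.lift`). `Gauge` records exactly this, and the rest is about
matrices over a gauge.

For a self-adjoint diagonal matrix with finitely many values for each `i`, the entrywise
quasi-inverses are in the algebra. So its spectrum under `π` lies in the disc whose radius is the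
supremum of the entry norms. Approximation extends the bound to all diagonal matrices
(`norm_rep_diagMat_le`). A matrix of propagation `r` is a sum of a fixed number of matrices with at
most one nonzero entry per row and column, whence `‖π T‖ ≤ C_r sup ‖T(x, y)‖`
(`exists_norm_rep_le`). In particular the maximal norm is finite. For block matrices with blocks of
bounded diameter the constant `C_r` disappears on taking powers of `Q* Q`
(`norm_rep_le_of_isBlock`).

Property A provides kernels `⟨ξ_x, ξ_y⟩ = ∑ⱼ Dⱼ(x) Dⱼ(y) χⱼ(x, y)` with block kernels `χⱼ` and `∑ⱼ
Dⱼ² = 1` (`hasKernels_of_equiPropertyA`). By Cauchy–Schwarz, Schur multiplication of `T` by such a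
kernel is bounded by the compressions of `T` (`norm_rep_sumKer_le`). The result differs from `T` by
a matrix of fixed propagation with small entries, which is small under `π`. Once the two norms
agree, the completions are identified through the closure of the graph (`exists_starAlgEquiv`). -/

@[ext] theorem ext {f g : BddFun S A} (h : ∀ s, f s = g s) : f = g :=
  lp.ext (funext h)

@[simp] theorem mk_apply (f : S → A) (C : ℝ) (h : ∀ s, ‖f s‖ ≤ C) (s : S) : mk f C h s = f s := rfl
@[simp] theorem zero_apply (s : S) : (0 : BddFun S A) s = 0 := rfl
@[simp] theorem add_apply (f g : BddFun S A) (s : S) : (f + g) s = f s + g s := rfl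
@[simp] theorem sub_apply (f g : BddFun S A) (s : S) : (f - g) s = f s - g s := rfl
@[simp] theorem neg_apply (f : BddFun S A) (s : S) : (-f) s = -f s := rfl
@[simp] theorem mul_apply (f g : BddFun S A) (s : S) : (f * g) s = f s * g s := rfl
@[simp] theorem smul_apply (c : ℂ) (f : BddFun S A) (s : S) : (c • f) s = c • f s := rfl
@[simp] theorem star_apply (f : BddFun S A) (s : S) : (star f) s = star (f s) := rfl

theorem norm_apply_le (f : BddFun S A) (s : S) : ‖f s‖ ≤ ‖f‖ :=
  lp.norm_apply_le_norm (E := fun _ : S => A) (by simp) f s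

theorem norm_le {f : BddFun S A} {C : ℝ} (hC : 0 ≤ C) (h : ∀ s, ‖f s‖ ≤ C) : ‖f‖ ≤ C :=
  lp.norm_le_of_forall_le (E := fun _ : S => A) (f := f) hC h

end BddFun

/-! ### The unital structure of the ambient Clifford algebra -/

section
variable (H : Type u) [NormedAddCommGroup H] [InnerProductSpace ℝ H]

instance : NormedRing (Cliff H) :=
  { (inferInstance : NonUnitalNormedRing (Cliff H)) with
    one := cliffordOne H
    one_mul := fun a => BddFun.ext fun s => one_mul (a s)
    mul_one := fun a => BddFun.ext fun s => mul_one (a s) }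

instance : NormedAlgebra ℂ (Cliff H) :=
  { Algebra.ofModule (fun c a b => smul_mul_assoc c a b) (fun c a b => mul_smul_comm c a b) with
    norm_smul_le := fun c a => norm_smul_le c a }

instance : CStarAlgebra (Cliff H) where

end

/-! ### Clifford algebras of subspaces and the action of isometries -/

section Clifford

variable {H : Type u} [NormedAddCommGroup H] [InnerProductSpace ℝ H]

@[simp] theorem cliffordVec_apply (z : ℝ × H) (c : CliffordRep H) :
    cliffordVec z c = c.map z := rfl

theorem cliffordVec_add (x y : ℝ × H) :
    cliffordVec (x + y) = cliffordVec x + cliffordVec y := by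
  ext c
  simp

theorem cliffordVec_smul (r : ℝ) (x : ℝ × H) :
    cliffordVec (r • x) = (r : ℂ) • cliffordVec x := by
  ext c
  exact (c.map.map_smul r x).trans (RCLike.real_smul_eq_coe_smul (K := ℂ) r (c.map x))

theorem cliffordVec_mul_self (z : ℝ × H) :
    cliffordVec z * cliffordVec z = ((z.1 ^ 2 + ‖z.2‖ ^ 2 : ℝ) : ℂ) • (1 : Cliff H) := by
  ext c
  exact c.sq z

theorem star_cliffordVec (z : ℝ × H) : star (cliffordVec z) = cliffordVec z := by
  ext c
  exact c.selfAdjoint z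

/-- Polarisation of `z² = ‖z‖²`: for orthogonal vectors the squared lengths add, so the cross terms
cancel. -/
theorem cliffordVec_anticomm {x y : ℝ × H} (h : x.1 * y.1 + inner ℝ x.2 y.2 = 0) :
    cliffordVec x * cliffordVec y = -(cliffordVec y * cliffordVec x) := by
  have h1 := cliffordVec_mul_self (x + y)
  have h2 := cliffordVec_mul_self x
  have h3 := cliffordVec_mul_self y
  have h4 : (x + y).1 ^ 2 + ‖(x + y).2‖ ^ 2 = (x.1 ^ 2 + ‖x.2‖ ^ 2) + (y.1 ^ 2 + ‖y.2‖ ^ 2) := by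
    rw [Prod.snd_add, Prod.fst_add, norm_add_sq_real]
    linear_combination 2 * h
  rw [h4, Complex.ofReal_add, add_smul, ← h2, ← h3, cliffordVec_add] at h1
  rw [← sub_eq_zero] at h1 ⊢
  rw [← h1]
  noncomm_ring

/-- A linear isometry of the Euclidean space `ℝ ⊕ H` into itself. -/
structure QIso (H : Type u) [NormedAddCommGroup H] [InnerProductSpace ℝ H] where
  map : ℝ × H →ₗ[ℝ] ℝ × H
  isom : ∀ z, (map z).1 ^ 2 + ‖(map z).2‖ ^ 2 = z.1 ^ 2 + ‖z.2‖ ^ 2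

/-- Precomposition of a Clifford representation with an isometry. -/
def CliffordRep.comp (c : CliffordRep H) (J : QIso H) : CliffordRep H where
  map := c.map ∘ₗ J.map
  selfAdjoint z := c.selfAdjoint _
  sq z := by
    rw [← J.isom z]
    exact c.sq _

/-- The action of an isometry of `ℝ ⊕ H` on the Clifford algebra. -/
def QIso.pullFun (J : QIso H) (a : Cliff H) : Cliff H :=
  BddFun.mk (fun c => a (c.comp J)) ‖a‖ fun c => a.norm_apply_le (c.comp J)

/-- The `*`-endomorphism of the Clifford algebra induced by an isometry of `ℝ ⊕ H`. -/
def QIso.pull (J : QIso H) : Cliff H →⋆ₐ[ℂ] Cliff H where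
  toFun := J.pullFun
  map_one' := rfl
  map_mul' _ _ := rfl
  map_zero' := rfl
  map_add' _ _ := rfl
  commutes' _ := rfl
  map_star' _ := rfl

@[simp] theorem QIso.pull_apply (J : QIso H) (a : Cliff H) (c : CliffordRep H) :
    J.pull a c = a (c.comp J) := rfl

theorem QIso.norm_pull_le (J : QIso H) (a : Cliff H) : ‖J.pull a‖ ≤ ‖a‖ :=
  BddFun.norm_le (norm_nonneg a) fun c => a.norm_apply_le (c.comp J)

theorem QIso.pull_vec (J : QIso H) (z : ℝ × H) : J.pull (cliffordVec z) = cliffordVec (J.map z) :=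
  rfl

theorem QIso.pull_pull {J : QIso H} (hJ : ∀ z, J.map (J.map z) = z) (a : Cliff H) :
    J.pull (J.pull a) = a := by
  ext c
  simp only [pull_apply]
  congr 1
  cases c
  simp only [CliffordRep.comp, CliffordRep.mk.injEq]
  refine LinearMap.ext fun z => ?_
  simp [hJ]

theorem QIso.norm_pull {J : QIso H} (hJ : ∀ z, J.map (J.map z) = z) (a : Cliff H) :
    ‖J.pull a‖ = ‖a‖ :=
  le_antisymm (J.norm_pull_le a) (by
    conv_lhs => rw [← J.pull_pull hJ a]
    exact J.norm_pull_le _)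

/-- The grading isometry `z ↦ -z`. -/
def gradIso (H : Type u) [NormedAddCommGroup H] [InnerProductSpace ℝ H] : QIso H where
  map := -LinearMap.id
  isom z := by simp

/-- The isometry `(t, h) ↦ (-t, h)`. -/
def flipIso (H : Type u) [NormedAddCommGroup H] [InnerProductSpace ℝ H] : QIso H where
  map := LinearMap.prodMap (-LinearMap.id) LinearMap.id
  isom z := by simp

theorem mem_cliffordSub_one (W : Submodule ℝ H) : (1 : Cliff H) ∈ cliffordSub W :=
  NonUnitalAlgebra.subset_adjoin ℂ (Set.mem_insert _ _)

theorem mem_cliffordSub_vec {W : Submodule ℝ H} {w : H} (hw : w ∈ W) :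
    cliffordVec ((0 : ℝ), w) ∈ cliffordSub W :=
  NonUnitalAlgebra.subset_adjoin ℂ (Set.mem_insert_of_mem _ ⟨w, hw, rfl⟩)

theorem cliffordSub_induction {W : Submodule ℝ H} {P : Cliff H → Prop} (h1 : P 1)
    (hv : ∀ w ∈ W, P (cliffordVec ((0 : ℝ), w)))
    (hadd : ∀ a ∈ cliffordSub W, ∀ b ∈ cliffordSub W, P a → P b → P (a + b))
    (hmul : ∀ a ∈ cliffordSub W, ∀ b ∈ cliffordSub W, P a → P b → P (a * b))
    (hsmul : ∀ (c : ℂ), ∀ a ∈ cliffordSub W, P a → P (c • a)) {a : Cliff H}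
    (ha : a ∈ cliffordSub W) : P a := by
  induction ha using NonUnitalAlgebra.adjoin_induction with
  | mem x hx =>
    rcases hx with rfl | ⟨w, hw, rfl⟩
    · exact h1
    · exact hv w hw
  | add a b ha hb ha' hb' => exact hadd a ha b hb ha' hb'
  | zero => simpa using hsmul 0 1 (mem_cliffordSub_one W) h1
  | mul a b ha hb ha' hb' => exact hmul a ha b hb ha' hb'
  | smul c a ha ha' => exact hsmul c a ha ha'

theorem cliffordSub_mono {W W' : Submodule ℝ H} (h : W ≤ W') : cliffordSub W ≤ cliffordSub W' :=
  NonUnitalAlgebra.adjoin_mono (Set.insert_subset_insert (Set.image_mono h))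

theorem star_mem_cliffordSub {W : Submodule ℝ H} {a : Cliff H} (ha : a ∈ cliffordSub W) :
    star a ∈ cliffordSub W := by
  refine cliffordSub_induction (P := fun a => star a ∈ cliffordSub W) ?_ ?_ ?_ ?_ ?_ ha
  · simpa using mem_cliffordSub_one W
  · intro w hw
    simpa [star_cliffordVec] using mem_cliffordSub_vec hw
  · intro a _ b _ ha hb
    simpa using add_mem ha hb
  · intro a _ b _ ha hb
    simpa using mul_mem hb ha
  · intro c a _ ha
    rw [star_smul]
    exact SMulMemClass.smul_mem _ ha

theorem pull_eq_self {W : Submodule ℝ H} {J : QIso H}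
    (hJ : ∀ w ∈ W, J.map ((0 : ℝ), w) = ((0 : ℝ), w)) {a : Cliff H} (ha : a ∈ cliffordSub W) :
    J.pull a = a := by
  refine cliffordSub_induction (P := fun a => J.pull a = a) (map_one _) ?_ ?_ ?_ ?_ ha
  · intro w hw
    rw [J.pull_vec, hJ w hw]
  · intro a _ b _ ha hb
    rw [map_add, ha, hb]
  · intro a _ b _ ha hb
    rw [map_mul, ha, hb]
  · intro c a _ ha
    rw [map_smul, ha]

theorem flip_eq_self {W : Submodule ℝ H} {a : Cliff H} (ha : a ∈ cliffordSub W) :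
    (flipIso H).pull a = a :=
  pull_eq_self (fun w _ => by simp [flipIso]) ha

theorem grad_mem {W : Submodule ℝ H} {a : Cliff H} (ha : a ∈ cliffordSub W) :
    (gradIso H).pull a ∈ cliffordSub W := by
  refine cliffordSub_induction (P := fun a => (gradIso H).pull a ∈ cliffordSub W)
    (by simpa using mem_cliffordSub_one W) ?_ ?_ ?_ ?_ ha
  · intro w hw
    rw [QIso.pull_vec]
    simpa [gradIso] using mem_cliffordSub_vec (neg_mem hw)
  · intro a _ b _ ha hb
    simpa using add_mem ha hb
  · intro a _ b _ ha hb
    simpa using mul_mem ha hb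
  · intro c a _ ha
    rw [map_smul]
    exact SMulMemClass.smul_mem _ ha

/-- A vector orthogonal to `W` anticommutes with the vectors of `W`, so it passes through a product
of them at the cost of the grading. This is what makes the elements `a₀ + z a₁` a subalgebra in
`cliffExt`. -/
theorem mul_vec_eq {W : Submodule ℝ H} {z : ℝ × H} (hz : ∀ w ∈ W, inner ℝ z.2 w = 0)
    {a : Cliff H} (ha : a ∈ cliffordSub W) :
    a * cliffordVec z = cliffordVec z * (gradIso H).pull a := by
  refine cliffordSub_induction
    (P := fun a => a * cliffordVec z = cliffordVec z * (gradIso H).pull a) (by simp) ?_ ?_ ?_ ?_ ha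
  · intro w hw
    have : cliffordVec ((gradIso H).map (0, w)) = -cliffordVec ((0 : ℝ), w) := by
      ext c
      rw [BddFun.neg_apply, cliffordVec_apply, cliffordVec_apply, ← map_neg]
      simp [gradIso]
    rw [QIso.pull_vec, this, mul_neg, cliffordVec_anticomm]
    simp only [zero_mul, zero_add]
    rw [real_inner_comm, hz w hw]
  · intro a _ b _ ha hb
    rw [add_mul, ha, hb, map_add, mul_add]
  · intro a _ b _ ha hb
    rw [mul_assoc, hb, ← mul_assoc, ha, map_mul, mul_assoc]
  · intro c a _ ha
    rw [map_smul, smul_mul_assoc, ha, mul_smul_comm]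

/-- The algebra generated by the Clifford algebra of `W` and a vector `z` orthogonal to `W`. -/
def cliffExt (W : Submodule ℝ H) (z : ℝ × H) (hz : ∀ w ∈ W, inner ℝ z.2 w = 0) :
    StarSubalgebra ℂ (Cliff H) where
  carrier := {a | ∃ a₀ ∈ cliffordSub W, ∃ a₁ ∈ cliffordSub W, a = a₀ + cliffordVec z * a₁}
  mul_mem' := by
    rintro _ _ ⟨a₀, h0, a₁, h1, rfl⟩ ⟨b₀, k0, b₁, k1, rfl⟩
    refine ⟨a₀ * b₀ + ((z.1 ^ 2 + ‖z.2‖ ^ 2 : ℝ) : ℂ) • ((gradIso H).pull a₁ * b₁),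
      add_mem (mul_mem h0 k0) (SMulMemClass.smul_mem _ (mul_mem (grad_mem h1) k1)),
      (gradIso H).pull a₀ * b₁ + a₁ * b₀, add_mem (mul_mem (grad_mem h0) k1) (mul_mem h1 k0), ?_⟩
    have e1 : a₀ * (cliffordVec z * b₁) = cliffordVec z * ((gradIso H).pull a₀ * b₁) := by
      rw [← mul_assoc, mul_vec_eq hz h0, mul_assoc]
    have e2 : cliffordVec z * a₁ * (cliffordVec z * b₁)
        = ((z.1 ^ 2 + ‖z.2‖ ^ 2 : ℝ) : ℂ) • ((gradIso H).pull a₁ * b₁) := by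
      rw [mul_assoc, ← mul_assoc a₁, mul_vec_eq hz h1, mul_assoc, ← mul_assoc,
        cliffordVec_mul_self, smul_mul_assoc, one_mul]
    rw [add_mul, mul_add, mul_add, e1, e2, mul_add, mul_assoc]
    abel
  add_mem' := by
    rintro _ _ ⟨a₀, h0, a₁, h1, rfl⟩ ⟨b₀, k0, b₁, k1, rfl⟩
    refine ⟨a₀ + b₀, add_mem h0 k0, a₁ + b₁, add_mem h1 k1, ?_⟩
    rw [mul_add]
    abel
  algebraMap_mem' := fun c => ⟨c • 1, SMulMemClass.smul_mem _ (mem_cliffordSub_one W), 0,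
    zero_mem _, by rw [mul_zero, add_zero, Algebra.algebraMap_eq_smul_one]⟩
  star_mem' := by
    rintro _ ⟨a₀, h0, a₁, h1, rfl⟩
    refine ⟨star a₀, star_mem_cliffordSub h0, (gradIso H).pull (star a₁),
      grad_mem (star_mem_cliffordSub h1), ?_⟩
    rw [star_add, star_mul, star_cliffordVec, mul_vec_eq hz (star_mem_cliffordSub h1)]

theorem mem_cliffExt {W : Submodule ℝ H} {z : ℝ × H} {hz : ∀ w ∈ W, inner ℝ z.2 w = 0}
    {a : Cliff H} : a ∈ cliffExt W z hz ↔
      ∃ a₀ ∈ cliffordSub W, ∃ a₁ ∈ cliffordSub W, a = a₀ + cliffordVec z * a₁ := Iff.rfl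

theorem finiteDimensional_cliffExt (W : Submodule ℝ H) (z : ℝ × H)
    (hz : ∀ w ∈ W, inner ℝ z.2 w = 0)
    (hW : (cliffordSub W).toSubmodule.FG) :
    (Subalgebra.toSubmodule (cliffExt W z hz).toSubalgebra).FG := by
  have : Subalgebra.toSubmodule (cliffExt W z hz).toSubalgebra =
      (cliffordSub W).toSubmodule ⊔
        (cliffordSub W).toSubmodule.map (LinearMap.mulLeft ℂ (cliffordVec z)) := by
    ext a
    simp only [Submodule.mem_sup, Submodule.mem_map]
    refine (mem_cliffExt (hz := hz)).trans ?_
    constructor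
    · rintro ⟨a₀, h0, a₁, h1, rfl⟩
      exact ⟨a₀, h0, _, ⟨a₁, h1, rfl⟩, rfl⟩
    · rintro ⟨a₀, h0, _, ⟨a₁, h1, rfl⟩, rfl⟩
      exact ⟨a₀, h0, a₁, h1, rfl⟩
  rw [this]
  exact hW.sup (hW.map _)

/-- An orthonormal basis is adjoined one vector at a time, and a new vector `b` replaces the algebra
`C` by `C + b C`. Finite dimension is what later keeps inverses (`inverse_mem_of_finite`) and
derivatives (`isClosed_cliffordSub`) inside the Clifford subalgebras. -/
theorem cliffordSub_fg (W : Submodule ℝ H) [FiniteDimensional ℝ W] :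
    (cliffordSub W).toSubmodule.FG := by
  classical
  let b := stdOrthonormalBasis ℝ W
  have key : ∀ s : Finset (Fin (Module.finrank ℝ W)),
      (cliffordSub (Submodule.span ℝ ((fun j => (b j : H)) '' (s : Set (Fin _))))).toSubmodule.FG := by
    intro s
    induction s using Finset.induction_on with
    | empty =>
      refine Submodule.FG.of_le (T := Submodule.span ℂ {(1 : Cliff H)}) ⟨{1}, by simp⟩ ?_
      intro a ha
      refine cliffordSub_induction (P := fun a => a ∈ Submodule.span ℂ {(1 : Cliff H)})
        ?_ ?_ ?_ ?_ ?_ ha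
      · exact Submodule.mem_span_singleton_self _
      · intro w hw
        have : w = 0 := by simpa using hw
        subst this
        have : cliffordVec ((0 : ℝ), (0 : H)) = 0 := by
          ext c
          exact c.map.map_zero
        rw [this]
        exact zero_mem _
      · exact fun a _ b _ => add_mem
      · intro a _ b _ ha hb
        rw [Submodule.mem_span_singleton] at ha hb ⊢
        obtain ⟨x, rfl⟩ := ha
        obtain ⟨y, rfl⟩ := hb
        exact ⟨x * y, by rw [smul_mul_smul_comm, one_mul]⟩
      · exact fun c a _ ha => Submodule.smul_mem _ c ha
    | insert j s hj ih =>
      set W' := Submodule.span ℝ ((fun j => (b j : H)) '' (s : Set (Fin _)))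
      have hz : ∀ w ∈ W', inner ℝ ((0 : ℝ), (b j : H)).2 w = 0 := by
        intro w hw
        induction hw using Submodule.span_induction with
        | mem x hx =>
          obtain ⟨k, hk, rfl⟩ := hx
          have := b.orthonormal.2 (i := j) (j := k) (by rintro rfl; exact hj hk)
          simpa using this
        | zero => simp
        | add x y _ _ hx hy => rw [inner_add_right, hx, hy, add_zero]
        | smul c x _ hx => rw [inner_smul_right, hx, mul_zero]
      refine Submodule.FG.of_le (finiteDimensional_cliffExt W' _ hz ih) ?_
      intro a ha
      have hmem : ∀ {a}, a ∈ cliffordSub W' → a ∈ cliffExt W' ((0 : ℝ), (b j : H)) hz :=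
        fun {a} h => mem_cliffExt.mpr ⟨a, h, 0, zero_mem _, by simp⟩
      refine cliffordSub_induction (P := fun a => a ∈ cliffExt W' _ hz) ?_ ?_ ?_ ?_ ?_ ha
      · exact one_mem _
      · intro w hw
        rw [Finset.coe_insert, Set.image_insert_eq, Submodule.mem_span_insert] at hw
        obtain ⟨r, w', hw', rfl⟩ := hw
        refine mem_cliffExt.mpr ⟨cliffordVec (0, w'), mem_cliffordSub_vec hw', (r : ℂ) • 1,
          SMulMemClass.smul_mem _ (mem_cliffordSub_one _), ?_⟩
        rw [mul_smul_comm, mul_one, ← cliffordVec_smul, ← cliffordVec_add]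
        congr 1
        ext <;> simp [add_comm]
      · exact fun a _ b _ => add_mem
      · exact fun a _ b _ => mul_mem
      · exact fun c a _ ha => (cliffExt W' _ hz).toSubalgebra.smul_mem ha c
  have h := key Finset.univ
  have h2 : Submodule.span ℝ ((fun j => (b j : H)) '' ((Finset.univ : Finset (Fin (Module.finrank ℝ W))) : Set (Fin (Module.finrank ℝ W))))
      = W := by
    have := congrArg (Submodule.map W.subtype) b.toBasis.span_eq
    rw [Submodule.map_span, Submodule.map_top, Submodule.range_subtype, ← Set.range_comp] at this
    refine Eq.trans ?_ this
    congr 1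
    ext x
    simp
  rwa [h2] at h

theorem isClosed_cliffordSub (W : Submodule ℝ H) [FiniteDimensional ℝ W] :
    IsClosed (cliffordSub W : Set (Cliff H)) := by
  have := Module.Finite.iff_fg.mpr (cliffordSub_fg W)
  exact (cliffordSub W).toSubmodule.closed_of_finiteDimensional

end Clifford

/-! ### Operations on functions vanishing at infinity, and line derivatives -/

section ZeroAtInfty

variable {E G G' : Type*} [NormedAddCommGroup E] [NormedSpace ℝ E]
  [NormedAddCommGroup G] [NormedSpace ℝ G] [NormedAddCommGroup G'] [NormedSpace ℝ G']

theorem c0_norm_apply_le {E : Type*} [TopologicalSpace E] (F : C₀(E, G)) (x : E) : ‖F x‖ ≤ ‖F‖ :=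
  F.toBCF.norm_coe_le_norm x

theorem c0_norm_le {E : Type*} [TopologicalSpace E] {F : C₀(E, G)} {C : ℝ} (hC : 0 ≤ C)
    (h : ∀ x, ‖F x‖ ≤ C) : ‖F‖ ≤ C :=
  (BoundedContinuousFunction.norm_le (f := F.toBCF) hC).mpr h

/-- Postcomposition with a continuous linear map. -/
def c0Post {E : Type*} [TopologicalSpace E] (L : G →L[ℝ] G') (F : C₀(E, G)) : C₀(E, G') where
  toFun x := L (F x)
  continuous_toFun := L.continuous.comp F.continuous
  zero_at_infty' := by
    have := (L.continuous.tendsto 0).comp F.zero_at_infty'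
    rwa [map_zero] at this

@[simp] theorem c0Post_apply {E : Type*} [TopologicalSpace E] (L : G →L[ℝ] G') (F : C₀(E, G))
    (x : E) : c0Post L F x = L (F x) := rfl

/-- Multiplication by a bounded continuous function. -/
def c0Mul {E A : Type*} [TopologicalSpace E] [NonUnitalNormedRing A] (g : E → A)
    (hg : Continuous g) (C : ℝ) (hC : ∀ x, ‖g x‖ ≤ C) (F : C₀(E, A)) : C₀(E, A) where
  toFun x := g x * F x
  continuous_toFun := hg.mul F.continuous
  zero_at_infty' := by
    have h0 : Filter.Tendsto (fun x => C * ‖F x‖) (Filter.cocompact E) (nhds 0) := by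
      simpa using (F.zero_at_infty'.norm).const_mul C
    exact squeeze_zero_norm (fun x => (norm_mul_le _ _).trans
      (mul_le_mul_of_nonneg_right (hC x) (norm_nonneg _))) h0

/-- The reflection `(t, w) ↦ (-t, w)`. -/
def c0Refl (F : C₀(ℝ × E, G)) : C₀(ℝ × E, G) where
  toFun x := F (-x.1, x.2)
  continuous_toFun := F.continuous.comp (by fun_prop)
  zero_at_infty' := F.zero_at_infty'.comp
    (((Homeomorph.neg ℝ).prodCongr (Homeomorph.refl E)).isClosedEmbedding.tendsto_cocompact)

theorem HasLineDerivAt.post {f : E → G} {f' : G} {x Z : E} (h : HasLineDerivAt ℝ f f' x Z)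
    (L : G →L[ℝ] G') : HasLineDerivAt ℝ (fun x => L (f x)) (L f') x Z :=
  L.hasFDerivAt.comp_hasDerivAt 0 h

theorem HasLineDerivAt.refl {f : ℝ × E → G} {f' : G} {x Z : ℝ × E}
    (h : HasLineDerivAt ℝ f f' (-x.1, x.2) (-Z.1, Z.2)) :
    HasLineDerivAt ℝ (fun x => f (-x.1, x.2)) f' x Z := by
  unfold HasLineDerivAt at *
  convert h using 3
  simp
  ring

/-- The difference quotients stay in the closed subspace, hence so does their limit. -/
theorem HasLineDerivAt.mem_of_isClosed {f : E → G} {f' : G} {x Z : E}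
    (h : HasLineDerivAt ℝ f f' x Z) {S : Submodule ℝ G} (hS : IsClosed (S : Set G))
    (hf : ∀ x, f x ∈ S) : f' ∈ S := by
  have := hasDerivAt_iff_tendsto_slope.mp h
  refine hS.mem_of_tendsto this (Filter.Eventually.of_forall fun t => ?_)
  rw [slope_def_module]
  exact S.smul_mem _ (S.sub_mem (hf _) (hf _))

end ZeroAtInfty

/-! ### Symmetric functions on `ℝ × W` as a pointwise model of the graded product -/

section Smooth

variable {H : Type u} [NormedAddCommGroup H] [InnerProductSpace ℝ H]

/-- The inequality suffices, and it holds even if the index set of Clifford representations is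
empty. -/
theorem norm_cliff_one_le : ‖(1 : Cliff H)‖ ≤ 1 :=
  BddFun.norm_le zero_le_one fun _ => norm_one.le

/-- The vector `(1, 0)` of `ℝ ⊕ H` in the Clifford algebra. -/
def cliffE (H : Type u) [NormedAddCommGroup H] [InnerProductSpace ℝ H] : Cliff H :=
  cliffordVec ((1 : ℝ), (0 : H))

theorem norm_cliffE_le : ‖cliffE H‖ ≤ 1 := by
  refine (norm_cliffordVec_le ((1 : ℝ), (0 : H))).trans ?_
  simp

theorem cliffE_mul_self : cliffE H * cliffE H = 1 := by
  rw [cliffE, cliffordVec_mul_self]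
  simp

theorem cliffE_mul_cancel (a : Cliff H) : cliffE H * (cliffE H * a) = a := by
  rw [← mul_assoc, cliffE_mul_self, one_mul]

theorem flip_cliffE : (flipIso H).pull (cliffE H) = -cliffE H := by
  rw [cliffE, QIso.pull_vec]
  ext c
  rw [BddFun.neg_apply, cliffordVec_apply, cliffordVec_apply, ← map_neg]
  simp [flipIso]

theorem flip_flip (a : Cliff H) : (flipIso H).pull ((flipIso H).pull a) = a :=
  QIso.pull_pull (fun z => by simp [flipIso]) a

theorem norm_flip (a : Cliff H) : ‖(flipIso H).pull a‖ = ‖a‖ :=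
  QIso.norm_pull (fun z => by simp [flipIso]) a

/-- The complex Clifford algebra of `ℝ ⊕ W`. -/
def cliffordSubE (W : Submodule ℝ H) : StarSubalgebra ℂ (Cliff H) :=
  cliffExt W ((1 : ℝ), (0 : H)) (by simp)

theorem mem_cliffordSubE {W : Submodule ℝ H} {a : Cliff H} : a ∈ cliffordSubE W ↔
      ∃ a₀ ∈ cliffordSub W, ∃ a₁ ∈ cliffordSub W, a = a₀ + cliffE H * a₁ := Iff.rfl

/-- The endomorphism of the Clifford algebra induced by an isometry, as a real continuous linear
map. -/
def QIso.pullL (J : QIso H) : Cliff H →L[ℝ] Cliff H :=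
  LinearMap.mkContinuous ((J.pull : Cliff H →ₐ[ℂ] Cliff H).toLinearMap.restrictScalars ℝ) 1
    fun a => by
      rw [one_mul]
      exact J.norm_pull_le a

/-- The component `a₀` of `a = a₀ + e a₁`. -/
def cliffEven (H : Type u) [NormedAddCommGroup H] [InnerProductSpace ℝ H] :
    Cliff H →L[ℝ] Cliff H :=
  (2⁻¹ : ℝ) • (ContinuousLinearMap.id ℝ _ + (flipIso H).pullL)

/-- The component `a₁` of `a = a₀ + e a₁`. -/
def cliffOdd (H : Type u) [NormedAddCommGroup H] [InnerProductSpace ℝ H] :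
    Cliff H →L[ℝ] Cliff H :=
  (2⁻¹ : ℝ) • ((ContinuousLinearMap.mul ℝ (Cliff H) (cliffE H)).comp
    (ContinuousLinearMap.id ℝ _ - (flipIso H).pullL))

theorem cliffEven_apply (a : Cliff H) : cliffEven H a = (2⁻¹ : ℝ) • (a + (flipIso H).pull a) := rfl

theorem cliffOdd_apply (a : Cliff H) :
    cliffOdd H a = (2⁻¹ : ℝ) • (cliffE H * (a - (flipIso H).pull a)) := rfl

theorem norm_cliffEven_le (a : Cliff H) : ‖cliffEven H a‖ ≤ ‖a‖ := by
  have := norm_add_le a ((flipIso H).pull a)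
  rw [norm_flip] at this
  rw [cliffEven_apply, norm_smul, norm_inv, Real.norm_two]
  linarith

theorem norm_cliffOdd_le (a : Cliff H) : ‖cliffOdd H a‖ ≤ ‖a‖ := by
  have := norm_sub_le a ((flipIso H).pull a)
  rw [norm_flip] at this
  have h2 := norm_mul_le (cliffE H) (a - (flipIso H).pull a)
  have h3 := norm_cliffE_le (H := H)
  rw [cliffOdd_apply, norm_smul, norm_inv, Real.norm_two]
  nlinarith [norm_nonneg (a - (flipIso H).pull a)]

theorem cliffEven_add_cliffOdd (a : Cliff H) : cliffEven H a + cliffE H * cliffOdd H a = a := by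
  rw [cliffEven_apply, cliffOdd_apply, mul_smul_comm, cliffE_mul_cancel, ← smul_add]
  rw [show a + (flipIso H).pull a + (a - (flipIso H).pull a) = (2 : ℝ) • a by rw [two_smul]; abel]
  rw [smul_smul]
  norm_num

theorem cliffEven_eq {W : Submodule ℝ H} {a₀ a₁ : Cliff H} (h0 : a₀ ∈ cliffordSub W)
    (h1 : a₁ ∈ cliffordSub W) : cliffEven H (a₀ + cliffE H * a₁) = a₀ := by
  rw [cliffEven_apply, map_add, map_mul, flip_eq_self h0, flip_eq_self h1, flip_cliffE, neg_mul,
    show a₀ + cliffE H * a₁ + (a₀ + -(cliffE H * a₁)) = (2 : ℝ) • a₀ by rw [two_smul]; abel,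
    smul_smul]
  norm_num

theorem cliffOdd_eq {W : Submodule ℝ H} {a₀ a₁ : Cliff H} (h0 : a₀ ∈ cliffordSub W)
    (h1 : a₁ ∈ cliffordSub W) : cliffOdd H (a₀ + cliffE H * a₁) = a₁ := by
  rw [cliffOdd_apply, map_add, map_mul, flip_eq_self h0, flip_eq_self h1, flip_cliffE, neg_mul,
    show a₀ + cliffE H * a₁ - (a₀ + -(cliffE H * a₁)) = cliffE H * ((2 : ℝ) • a₁) by
      rw [two_smul, mul_add]; abel,
    cliffE_mul_cancel, smul_smul]
  norm_num

theorem cliffEven_mem {W : Submodule ℝ H} {a : Cliff H} (ha : a ∈ cliffordSubE W) :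
    cliffEven H a ∈ cliffordSub W := by
  obtain ⟨a₀, h0, a₁, h1, rfl⟩ := mem_cliffordSubE.mp ha
  rwa [cliffEven_eq h0 h1]

theorem cliffOdd_mem {W : Submodule ℝ H} {a : Cliff H} (ha : a ∈ cliffordSubE W) :
    cliffOdd H a ∈ cliffordSub W := by
  obtain ⟨a₀, h0, a₁, h1, rfl⟩ := mem_cliffordSubE.mp ha
  rwa [cliffOdd_eq h0 h1]

theorem cliffEven_flip (a : Cliff H) : cliffEven H ((flipIso H).pull a) = cliffEven H a := by
  rw [cliffEven_apply, cliffEven_apply, flip_flip, add_comm]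

theorem cliffOdd_flip (a : Cliff H) : cliffOdd H ((flipIso H).pull a) = -cliffOdd H a := by
  rw [cliffOdd_apply, cliffOdd_apply, flip_flip, ← smul_neg, ← mul_neg, neg_sub]

/-- The isometry of `ℝ ⊕ H` that maps `(1, 0)` to the unit vector `u` and fixes the vectors
orthogonal to both: a reflection. -/
def reflIso (u : ℝ × H) : QIso H where
  map :=
    -- Reflection in the hyperplane orthogonal to `(1, 0) - u`. If `u = (1, 0)`, division by zero
    -- makes the coefficient vanish and the map is the identity, as it should be.
    { toFun := fun x => x - (2 * (x.1 * (1 - u.1) - inner ℝ u.2 x.2) /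
        ((1 - u.1) ^ 2 + ‖u.2‖ ^ 2)) • ((1 - u.1), -u.2)
      map_add' := fun x y => by
        rw [Prod.fst_add, Prod.snd_add, inner_add_right]
        rw [show 2 * ((x.1 + y.1) * (1 - u.1) - (inner ℝ u.2 x.2 + inner ℝ u.2 y.2)) /
          ((1 - u.1) ^ 2 + ‖u.2‖ ^ 2) = 2 * (x.1 * (1 - u.1) - inner ℝ u.2 x.2) /
          ((1 - u.1) ^ 2 + ‖u.2‖ ^ 2) + 2 * (y.1 * (1 - u.1) - inner ℝ u.2 y.2) /
          ((1 - u.1) ^ 2 + ‖u.2‖ ^ 2) by ring, add_smul]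
        abel
      map_smul' := fun r x => by
        rw [Prod.smul_fst, Prod.smul_snd, inner_smul_right, RingHom.id_apply, smul_sub, smul_smul,
          smul_eq_mul]
        congr 2
        ring }
  isom x := by
    dsimp only [LinearMap.coe_mk, AddHom.coe_mk]
    rw [Prod.fst_sub, Prod.snd_sub, Prod.smul_fst, Prod.smul_snd]
    dsimp only
    rw [smul_neg, sub_neg_eq_add, norm_add_sq_real, norm_smul, inner_smul_right, smul_eq_mul,
      mul_pow, Real.norm_eq_abs, sq_abs, real_inner_comm]
    by_cases hn : (1 - u.1) ^ 2 + ‖u.2‖ ^ 2 = 0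
    · rw [hn]
      simp
    · field_simp
      ring

/-- For a unit vector `u` the normal `(1, 0) - u` has squared length `2 (1 - u.1)`, so the
coefficient of the reflection at `(1, 0)` is `1`. -/
theorem reflIso_e {u : ℝ × H} (hu : u.1 ^ 2 + ‖u.2‖ ^ 2 = 1) :
    (reflIso u).map ((1 : ℝ), (0 : H)) = u := by
  simp only [reflIso, LinearMap.coe_mk, AddHom.coe_mk, inner_zero_right, one_mul, sub_zero]
  have h1 : (1 - u.1) ^ 2 + ‖u.2‖ ^ 2 = 2 * (1 - u.1) := by linear_combination hu
  rw [h1]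
  by_cases hn : 1 - u.1 = 0
  · have h2 : u.1 = 1 := by linarith
    have h3 : ‖u.2‖ = 0 := by nlinarith
    rw [hn]
    ext
    · simp [h2]
    · simpa using (norm_eq_zero.mp h3).symm
  · rw [div_self (mul_ne_zero two_ne_zero hn), one_smul]
    ext <;> simp

theorem reflIso_perp {u : ℝ × H} {w : H} (hw : inner ℝ u.2 w = 0) :
    (reflIso u).map ((0 : ℝ), w) = ((0 : ℝ), w) := by
  simp [reflIso, hw]

/-- The vector `t ⊕ (v - P_W v)`. -/
def perpVec (W : Submodule ℝ H) [W.HasOrthogonalProjection] : ℝ × H →L[ℝ] ℝ × H :=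
  ContinuousLinearMap.prod (ContinuousLinearMap.fst ℝ ℝ H)
    ((ContinuousLinearMap.id ℝ H - W.subtypeL.comp W.orthogonalProjectionOnto).comp
      (ContinuousLinearMap.snd ℝ ℝ H))

theorem perpVec_apply (W : Submodule ℝ H) [W.HasOrthogonalProjection] (x : ℝ × H) :
    perpVec W x = (x.1, x.2 - W.orthogonalProjectionOnto x.2) := rfl

/-- The Euclidean length in `ℝ ⊕ H`. -/
def len (z : ℝ × H) : ℝ := √(z.1 ^ 2 + ‖z.2‖ ^ 2)

theorem len_nonneg (z : ℝ × H) : 0 ≤ len z := Real.sqrt_nonneg _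

theorem len_sq (z : ℝ × H) : len z ^ 2 = z.1 ^ 2 + ‖z.2‖ ^ 2 := Real.sq_sqrt (by positivity)

theorem len_eq_zero {z : ℝ × H} : len z = 0 ↔ z = 0 := by
  constructor
  · intro h
    have h2 := len_sq z
    rw [h] at h2
    have h3 : z.1 = 0 := by nlinarith [sq_nonneg z.1, sq_nonneg ‖z.2‖]
    have h4 : ‖z.2‖ = 0 := by nlinarith [sq_nonneg z.1, sq_nonneg ‖z.2‖]
    ext
    · exact h3
    · exact norm_eq_zero.mp h4
  · rintro rfl
    simp [len]

theorem continuous_len : Continuous (len : ℝ × H → ℝ) := by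
  unfold len
  fun_prop

theorem inner_perpVec {W : Submodule ℝ H} [W.HasOrthogonalProjection] (x : ℝ × H) {w : H}
    (hw : w ∈ W) : inner ℝ (perpVec W x).2 w = 0 := by
  rw [perpVec_apply]
  exact Submodule.inner_left_of_mem_orthogonal hw (W.sub_starProjection_mem_orthogonal x.2)

theorem len_unit {z : ℝ × H} (hz : z ≠ 0) :
    ((len z)⁻¹ • z).1 ^ 2 + ‖((len z)⁻¹ • z).2‖ ^ 2 = 1 := by
  have h : len z ≠ 0 := fun h => hz (len_eq_zero.mp h)
  rw [Prod.smul_fst, Prod.smul_snd, norm_smul, smul_eq_mul, mul_pow, mul_pow, Real.norm_eq_abs,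
    sq_abs, ← mul_add, ← len_sq, inv_pow, inv_mul_cancel₀ (pow_ne_zero 2 h)]

variable {W : Submodule ℝ H} [W.HasOrthogonalProjection]

/-- The isomorphism of Clifford algebras attached to a point of `ℝ₊ × H`. -/
def pointHom (W : Submodule ℝ H) [W.HasOrthogonalProjection] (x : ℝ × H) :
    Cliff H →⋆ₐ[ℂ] Cliff H :=
  (reflIso ((len (perpVec W x))⁻¹ • perpVec W x)).pull

/-- The normal of the reflection lies in the span of `e` and `t ⊕ (v - P_W v)`, hence is orthogonal
to `W`. -/
theorem pointHom_of_mem (x : ℝ × H) {a : Cliff H} (ha : a ∈ cliffordSub W) :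
    pointHom W x a = a := by
  refine pull_eq_self (fun w hw => reflIso_perp ?_) ha
  rw [Prod.smul_snd, inner_smul_left, inner_perpVec x hw, mul_zero]

/-- The hypothesis excludes the degenerate case, where `reflIso 0` sends `e` to `-e`. For symmetric
functions that case is harmless, since their odd part vanishes at `t = 0`. -/
theorem pointHom_e {x : ℝ × H} (hx : perpVec W x ≠ 0) :
    pointHom W x (cliffE H) =
      (((len (perpVec W x))⁻¹ : ℝ) : ℂ) • cliffordVec (perpVec W x) := by
  rw [pointHom, cliffE, QIso.pull_vec, reflIso_e (len_unit hx), cliffordVec_smul]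

/-- The bounded function on `ℝ₊ × H` represented by a function on `ℝ × W` with values in the
Clifford algebra of `ℝ ⊕ W`. -/
def ext₀ (W : Submodule ℝ H) [W.HasOrthogonalProjection] (Ψ : C₀(ℝ × W, Cliff H)) : HKTFun H :=
  BddFun.mk (fun q => pointHom W ((q.1 : ℝ), q.2)
    (Ψ (len (perpVec W ((q.1 : ℝ), q.2)), W.orthogonalProjectionOnto q.2))) ‖Ψ‖
    fun _ => (QIso.norm_pull_le _ _).trans (c0_norm_apply_le Ψ _)

theorem ext₀_apply (Ψ : C₀(ℝ × W, Cliff H)) (q : HKTSpace H) :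
    ext₀ W Ψ q = pointHom W ((q.1 : ℝ), q.2)
    (Ψ (len (perpVec W ((q.1 : ℝ), q.2)), W.orthogonalProjectionOnto q.2)) := rfl

theorem norm_ext₀_le (Ψ : C₀(ℝ × W, Cliff H)) : ‖ext₀ W Ψ‖ ≤ ‖Ψ‖ :=
  BddFun.norm_mk_le _ _ _ (norm_nonneg _)

theorem ext₀_mul (Ψ Ψ' : C₀(ℝ × W, Cliff H)) : ext₀ W (Ψ * Ψ') = ext₀ W Ψ * ext₀ W Ψ' :=
  BddFun.ext fun _ => map_mul _ _ _

theorem ext₀_add (Ψ Ψ' : C₀(ℝ × W, Cliff H)) : ext₀ W (Ψ + Ψ') = ext₀ W Ψ + ext₀ W Ψ' :=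
  BddFun.ext fun _ => map_add _ _ _

theorem ext₀_smul (c : ℂ) (Ψ : C₀(ℝ × W, Cliff H)) : ext₀ W (c • Ψ) = c • ext₀ W Ψ :=
  BddFun.ext fun _ => map_smul (pointHom W _) c _

theorem ext₀_star (Ψ : C₀(ℝ × W, Cliff H)) : ext₀ W (star Ψ) = star (ext₀ W Ψ) :=
  BddFun.ext fun _ => map_star (pointHom W _) _

/-- `Ψ` is a symmetric `C¹`-function with values in the Clifford algebra of `ℝ ⊕ W`, and the
directional derivatives of `Ψ` along vectors of length at most one are bounded by `c`. -/
structure IsSym (W : Submodule ℝ H) (Ψ : C₀(ℝ × W, Cliff H)) : Prop where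
  mem : ∀ q, Ψ q ∈ cliffordSubE W
  flip : ∀ t w, Ψ (-t, w) = (flipIso H).pull (Ψ (t, w))

/-- The directional derivatives along vectors of length at most one exist, vanish at infinity and
are bounded by `c`. -/
def HasC1Bound (Ψ : C₀(ℝ × W, Cliff H)) (c : ℝ) : Prop :=
  ∀ Z : ℝ × W, Z.1 ^ 2 + ‖Z.2‖ ^ 2 ≤ 1 → ∃ D : C₀(ℝ × W, Cliff H),
    (∀ q, HasLineDerivAt ℝ Ψ (D q) q Z) ∧ ‖D‖ ≤ c

theorem perpVec_of_mem (t : ℝ) (w : W) : perpVec W (t, (w : H)) = (t, 0) := by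
  rw [perpVec_apply, W.orthogonalProjectionOnto_mem_subspace_eq_self w, sub_self]

theorem len_real (t : ℝ) : len (t, (0 : H)) = |t| := by
  simp [len, Real.sqrt_sq_eq_abs]

/-- No information is lost under `ext₀`: at the points `(t, w)` with `t ≥ 0` and `w ∈ W` the
perpendicular vector is `(t, 0)`, so `pointHom` leaves the value unchanged. The flip symmetry
recovers negative `t`. -/
theorem IsSym.norm_le {Ψ : C₀(ℝ × W, Cliff H)} (h : IsSym W Ψ) : ‖Ψ‖ ≤ ‖ext₀ W Ψ‖ := by
  have key : ∀ (t : ℝ) (w : W), 0 ≤ t → ‖Ψ (t, w)‖ ≤ ‖ext₀ W Ψ‖ := by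
    intro t w ht
    have h1 := (ext₀ W Ψ).norm_apply_le ((⟨t, ht⟩ : ℝ≥0), (w : H))
    change ‖pointHom W (t, (w : H)) (Ψ (len (perpVec W (t, (w : H))),
      W.orthogonalProjectionOnto (w : H)))‖ ≤ _ at h1
    rw [perpVec_of_mem, len_real, abs_of_nonneg ht,
      W.orthogonalProjectionOnto_mem_subspace_eq_self w] at h1
    have h2 : pointHom W (t, (w : H)) (Ψ (t, w)) = Ψ (t, w) := by
      -- At `t = 0` the reflection degenerates, but there the symmetry makes the value
      -- flip-invariant, so it has no `e`-component.
      by_cases h0 : t = 0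
      · subst h0
        have h3 := h.flip 0 w
        rw [neg_zero] at h3
        have h4 : Ψ (0, w) ∈ cliffordSub W := by
          have : cliffEven H (Ψ (0, w)) = Ψ (0, w) := by
            rw [cliffEven_apply, ← h3, ← two_smul ℝ (Ψ (0, w)), smul_smul]
            norm_num
          rw [← this]
          exact cliffEven_mem (h.mem _)
        exact pointHom_of_mem _ h4
      · obtain ⟨a₀, m0, a₁, m1, e⟩ := mem_cliffordSubE.mp (h.mem (t, w))
        have hne : perpVec W (t, (w : H)) ≠ 0 := by
          rw [perpVec_of_mem]
          exact fun hc => h0 (congrArg Prod.fst hc)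
        rw [e, map_add, map_mul, pointHom_of_mem _ m0, pointHom_of_mem _ m1, pointHom_e hne,
          perpVec_of_mem, len_real, abs_of_nonneg ht, ← cliffordVec_smul]
        simp [cliffE, h0]
    rwa [h2] at h1
  refine c0_norm_le (norm_nonneg _) fun ⟨t, w⟩ => ?_
  rcases le_total 0 t with ht | ht
  · exact key t w ht
  · have := key (-t) w (by linarith)
    rwa [h.flip, norm_flip] at this

theorem IsSym.norm_ext₀ {Ψ : C₀(ℝ × W, Cliff H)} (h : IsSym W Ψ) : ‖ext₀ W Ψ‖ = ‖Ψ‖ :=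
  le_antisymm (norm_ext₀_le Ψ) h.norm_le

theorem IsSym.add {Ψ Ψ' : C₀(ℝ × W, Cliff H)} (h : IsSym W Ψ) (h' : IsSym W Ψ') :
    IsSym W (Ψ + Ψ') where
  mem q := add_mem (h.mem q) (h'.mem q)
  flip t w := by
    simp [h.flip, h'.flip]

theorem IsSym.smul {Ψ : C₀(ℝ × W, Cliff H)} (h : IsSym W Ψ) (c : ℂ) : IsSym W (c • Ψ) where
  mem q := SMulMemClass.smul_mem c (h.mem q)
  flip t w := by
    simp [h.flip]

theorem IsSym.mul {Ψ Ψ' : C₀(ℝ × W, Cliff H)} (h : IsSym W Ψ) (h' : IsSym W Ψ') :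
    IsSym W (Ψ * Ψ') where
  mem q := mul_mem (h.mem q) (h'.mem q)
  flip t w := by
    simp [h.flip, h'.flip]

theorem IsSym.star {Ψ : C₀(ℝ × W, Cliff H)} (h : IsSym W Ψ) : IsSym W (star Ψ) where
  mem q := star_mem (h.mem q)
  flip t w := by
    simp [h.flip, map_star]

theorem HasC1Bound.add {Ψ Ψ' : C₀(ℝ × W, Cliff H)} {c c' : ℝ} (h : HasC1Bound Ψ c)
    (h' : HasC1Bound Ψ' c') : HasC1Bound (Ψ + Ψ') (c + c') := by
  intro Z hZ
  obtain ⟨D, hD, hc⟩ := h Z hZ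
  obtain ⟨D', hD', hc'⟩ := h' Z hZ
  exact ⟨D + D', fun q => HasDerivAt.add (hD q) (hD' q), (norm_add_le _ _).trans (add_le_add hc hc')⟩

theorem HasC1Bound.smul {Ψ : C₀(ℝ × W, Cliff H)} {c : ℝ} (h : HasC1Bound Ψ c) (r : ℂ) :
    HasC1Bound (r • Ψ) (‖r‖ * c) := by
  intro Z hZ
  obtain ⟨D, hD, hc⟩ := h Z hZ
  refine ⟨r • D, fun q => HasDerivAt.const_smul r (hD q), ?_⟩
  rw [norm_smul]
  gcongr

theorem HasC1Bound.mono {Ψ : C₀(ℝ × W, Cliff H)} {c c' : ℝ} (h : HasC1Bound Ψ c) (hc : c ≤ c') :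
    HasC1Bound Ψ c' := fun Z hZ =>
  let ⟨D, hD, h1⟩ := h Z hZ
  ⟨D, hD, h1.trans hc⟩

theorem HasC1Bound.nonneg {Ψ : C₀(ℝ × W, Cliff H)} {c : ℝ} (h : HasC1Bound Ψ c) : 0 ≤ c :=
  let ⟨_, _, h1⟩ := h 0 (by simp)
  (norm_nonneg _).trans h1

theorem HasC1Bound.mul {Ψ Ψ' : C₀(ℝ × W, Cliff H)} {c c' : ℝ} (h : HasC1Bound Ψ c)
    (h' : HasC1Bound Ψ' c') : HasC1Bound (Ψ * Ψ') (c * ‖Ψ'‖ + ‖Ψ‖ * c') := by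
  intro Z hZ
  obtain ⟨D, hD, hc⟩ := h Z hZ
  obtain ⟨D', hD', hc'⟩ := h' Z hZ
  refine ⟨D * Ψ' + Ψ * D', fun q => ?_, (norm_add_le _ _).trans
    (add_le_add ((norm_mul_le _ _).trans ?_) ((norm_mul_le _ _).trans ?_))⟩
  · refine HasDerivAt.congr_deriv (HasDerivAt.mul (hD q) (hD' q)) ?_
    simp
  · gcongr
  · gcongr

theorem HasC1Bound.star {Ψ : C₀(ℝ × W, Cliff H)} {c : ℝ} (h : HasC1Bound Ψ c) :
    HasC1Bound (star Ψ) c := by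
  intro Z hZ
  obtain ⟨D, hD, hc⟩ := h Z hZ
  exact ⟨Star.star D, fun q => HasDerivAt.star (hD q), by rwa [norm_star]⟩

end Smooth

/-! ### Resolvent estimates in a Banach algebra -/

section QuasiInverse

variable {A : Type*} [NormedRing A] [NormedAlgebra ℂ A] [CompleteSpace A]

theorem isUnit_smul_one_sub (h1 : ‖(1 : A)‖ ≤ 1) {a : A} {z : ℂ} (h : ‖a‖ < ‖z‖) :
    IsUnit (z • (1 : A) - a) := by
  have := spectrum.mem_resolventSet_of_norm_lt_mul (a := a) (k := z)
    (lt_of_le_of_lt (mul_le_of_le_one_right (norm_nonneg _) h1) h)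
  rwa [spectrum.mem_resolventSet_iff, Algebra.algebraMap_eq_smul_one] at this

/-- Take norms in `z y = 1 + y a`, where `y` is the inverse. -/
theorem norm_inverse_smul_one_sub_le (h1 : ‖(1 : A)‖ ≤ 1) {a : A} {z : ℂ} {m : ℝ} (ha : ‖a‖ ≤ m)
    (hm : m < ‖z‖) : ‖Ring.inverse (z • (1 : A) - a)‖ ≤ (‖z‖ - m)⁻¹ := by
  set y := Ring.inverse (z • (1 : A) - a)
  have h : y * (z • (1 : A) - a) = 1 :=
    Ring.inverse_mul_cancel _ (isUnit_smul_one_sub h1 (ha.trans_lt hm))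
  rw [mul_sub, mul_smul_comm, mul_one, sub_eq_iff_eq_add] at h
  have h2 : ‖z‖ * ‖y‖ ≤ 1 + ‖y‖ * m := by
    rw [← norm_smul, h]
    refine (norm_add_le _ _).trans (add_le_add h1 ((norm_mul_le _ _).trans ?_))
    gcongr
  have h3 : 0 < ‖z‖ - m := by linarith
  rw [← one_div, le_div_iff₀ h3]
  linarith

/-- Left multiplication by `x` is injective on a finite-dimensional subalgebra, hence surjective, so
`1` has a preimage there. -/
theorem inverse_mem_of_finite {S : Subalgebra ℂ A} (hS : (Subalgebra.toSubmodule S).FG) {x : A}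
    (hx : x ∈ S) (hu : IsUnit x) : Ring.inverse x ∈ S := by
  have : FiniteDimensional ℂ S := Module.Finite.iff_fg.mpr hS
  let L : S →ₗ[ℂ] S := LinearMap.mulLeft ℂ (⟨x, hx⟩ : S)
  have hinj : Function.Injective L := by
    intro a b hab
    have h := congrArg Subtype.val hab
    exact Subtype.ext (hu.mul_left_cancel h)
  obtain ⟨y, hy⟩ := LinearMap.surjective_of_injective hinj 1
  have h : x * (y : A) = 1 := congrArg Subtype.val hy
  have : Ring.inverse x = y := by
    rw [← mul_one (Ring.inverse x), ← h, ← mul_assoc, Ring.inverse_mul_cancel _ hu, one_mul]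
  rw [this]
  exact y.2

end QuasiInverse

/-! ### Resolvents of `C¹`-functions, and passage between `F` and its symmetric model -/

section Smooth

variable {H : Type u} [NormedAddCommGroup H] [InnerProductSpace ℝ H]
variable {W : Submodule ℝ H} [FiniteDimensional ℝ W]

theorem cliffordSubE_fg (W : Submodule ℝ H) [FiniteDimensional ℝ W] :
    (Subalgebra.toSubmodule (cliffordSubE W).toSubalgebra).FG :=
  finiteDimensional_cliffExt W _ (by simp) (cliffordSub_fg W)

/-- The function `(z - Ψ)⁻¹ - z⁻¹`. -/
theorem exists_quasiInverse {Ψ : C₀(ℝ × W, Cliff H)} (hΨ : IsSym W Ψ) {c m : ℝ} {z : ℂ}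
    (hc : HasC1Bound Ψ c) (hm : ‖Ψ‖ ≤ m) (hz : m < ‖z‖) :
    ∃ E : C₀(ℝ × W, Cliff H), IsSym W E ∧ HasC1Bound E ((‖z‖ - m)⁻¹ * c * (‖z‖ - m)⁻¹) ∧
      z • E - z⁻¹ • Ψ - Ψ * E = 0 ∧ z • E - z⁻¹ • Ψ - E * Ψ = 0 := by
  have hz0 : z ≠ 0 := fun h => by
    rw [h, norm_zero] at hz
    exact absurd ((norm_nonneg _).trans hm) (not_le.mpr hz)
  have hq : ∀ q, ‖Ψ q‖ ≤ m := fun q => (c0_norm_apply_le Ψ q).trans hm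
  set R : ℝ × W → Cliff H := fun q => Ring.inverse (z • (1 : Cliff H) - Ψ q) with hR
  have hu : ∀ q, IsUnit (z • (1 : Cliff H) - Ψ q) := fun q =>
    isUnit_smul_one_sub norm_cliff_one_le ((hq q).trans_lt hz)
  have hRn : ∀ q, ‖R q‖ ≤ (‖z‖ - m)⁻¹ := fun q =>
    norm_inverse_smul_one_sub_le norm_cliff_one_le (hq q) hz
  have hR1 : ∀ q, R q * (z • (1 : Cliff H) - Ψ q) = 1 := fun q => Ring.inverse_mul_cancel _ (hu q)
  have hR2 : ∀ q, (z • (1 : Cliff H) - Ψ q) * R q = 1 := fun q => Ring.mul_inverse_cancel _ (hu q)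
  have hRc : Continuous R := by
    rw [continuous_iff_continuousAt]
    intro q
    have h1 : ContinuousAt Ring.inverse (z • (1 : Cliff H) - Ψ q) := by
      have := NormedRing.inverse_continuousAt (hu q).unit
      rwa [(hu q).unit_spec] at this
    exact ContinuousAt.comp (f := fun q => z • (1 : Cliff H) - Ψ q) h1
      (continuous_const.sub Ψ.continuous).continuousAt
  have hR1' : ∀ q, R q * Ψ q = z • R q - 1 := fun q => by
    have := hR1 q
    rw [mul_sub, mul_smul_comm, mul_one] at this
    rw [← this]; abel
  have hR2' : ∀ q, Ψ q * R q = z • R q - 1 := fun q => by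
    have := hR2 q
    rw [sub_mul, smul_mul_assoc, one_mul] at this
    rw [← this]; abel
  -- The resolvent itself does not vanish at infinity, but `R - z⁻¹ = z⁻¹ R Ψ` does.
  let E : C₀(ℝ × W, Cliff H) := z⁻¹ • c0Mul R hRc _ hRn Ψ
  have hE : ∀ q, E q = R q - z⁻¹ • 1 := fun q => by
    change z⁻¹ • (R q * Ψ q) = _
    rw [hR1', smul_sub, smul_smul, inv_mul_cancel₀ hz0, one_smul]
  refine ⟨E, ⟨fun q => ?_, fun t w => ?_⟩, ?_, ?_, ?_⟩
  · rw [hE]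
    refine sub_mem ?_ (SMulMemClass.smul_mem _ (one_mem _))
    exact inverse_mem_of_finite (S := (cliffordSubE W).toSubalgebra) (cliffordSubE_fg W)
      (sub_mem (SMulMemClass.smul_mem z (one_mem (cliffordSubE W))) (hΨ.mem q)) (hu q)
  -- The flip is an algebra homomorphism, so it carries `R (t, w)` to a left inverse of `z - Ψ (-t,
  -- w)`, and this must equal `R (-t, w)`.
  · have h1 : R (-t, w) = (flipIso H).pull (R (t, w)) := by
      have h2 : (flipIso H).pull (R (t, w)) * (z • (1 : Cliff H) - Ψ (-t, w)) = 1 := by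
        rw [hΨ.flip]
        have := congrArg (flipIso H).pull (hR1 (t, w))
        rwa [map_mul, map_sub, map_smul, map_one] at this
      calc R (-t, w) = ((flipIso H).pull (R (t, w)) * (z • (1 : Cliff H) - Ψ (-t, w)))
            * R (-t, w) := by rw [h2, one_mul]
        _ = _ := by rw [mul_assoc, hR2, mul_one]
    rw [hE, hE, h1, map_sub, map_smul, map_one]
  · intro Z hZ
    obtain ⟨D, hD, hDc⟩ := hc Z hZ
    have hcc := hc.nonneg
    have h0 : 0 ≤ (‖z‖ - m)⁻¹ := (norm_nonneg _).trans (hRn 0)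
    -- The derivative of the resolvent is `R D R`. Its two outer factors are bounded by `(‖z‖ -
    -- m)⁻¹`.
    let D1 : C₀(ℝ × W, Cliff H) := c0Mul R hRc _ hRn D
    have hD1 : Filter.Tendsto (fun q => D1 q * R q) (Filter.cocompact _) (nhds 0) := by
      have := (D1.zero_at_infty'.norm).mul_const (‖z‖ - m)⁻¹
      rw [norm_zero, zero_mul] at this
      exact squeeze_zero_norm (fun q => (norm_mul_le _ _).trans
        (mul_le_mul_of_nonneg_left (hRn q) (norm_nonneg _))) this
    refine ⟨⟨⟨fun q => D1 q * R q, D1.continuous.mul hRc⟩, hD1⟩, fun q => ?_, ?_⟩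
    · have h1 : HasDerivAt (fun s : ℝ => z • (1 : Cliff H) - Ψ (q + s • Z)) (-D q) 0 :=
        HasDerivAt.const_sub _ (hD q)
      have h2 := hasFDerivAt_ringInverse (𝕜 := ℝ) (hu q).unit
      rw [(hu q).unit_spec] at h2
      have h3 : HasFDerivAt (𝕜 := ℝ) Ring.inverse
          (-ContinuousLinearMap.mulLeftRight ℝ (Cliff H) ↑(hu q).unit⁻¹ ↑(hu q).unit⁻¹)
          ((fun s : ℝ => z • (1 : Cliff H) - Ψ (q + s • Z)) 0) := by
        simpa using h2
      have h4 := h3.comp_hasDerivAt (0 : ℝ) h1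
      have h5 : ((hu q).unit⁻¹ : (Cliff H)ˣ) = R q := by
        rw [hR]
        dsimp only
        rw [← Ring.inverse_unit (hu q).unit, (hu q).unit_spec]
      rw [h5] at h4
      have h6 : (fun s : ℝ => E (q + s • Z)) =
          fun s => (Ring.inverse ∘ fun s : ℝ => z • (1 : Cliff H) - Ψ (q + s • Z)) s - z⁻¹ • 1 := by
        funext s
        rw [hE]
        rfl
      change HasDerivAt (fun s : ℝ => E (q + s • Z)) _ 0
      rw [h6]
      refine (h4.sub_const _).congr_deriv ?_
      simp only [neg_apply, ContinuousLinearMap.mulLeftRight_apply, mul_neg,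
        neg_mul, neg_neg]
      rfl
    · refine c0_norm_le (by positivity) fun q => ?_
      change ‖R q * D q * R q‖ ≤ _
      refine (norm_mul_le _ _).trans (mul_le_mul ((norm_mul_le _ _).trans
        (mul_le_mul (hRn q) ((c0_norm_apply_le D q).trans hDc) (norm_nonneg _) h0)) (hRn q)
        (norm_nonneg _) (by positivity))
  · ext1 q
    change z • E q - z⁻¹ • Ψ q - Ψ q * E q = 0
    rw [hE, mul_sub, hR2', mul_smul_comm, mul_one, smul_sub, smul_smul, mul_inv_cancel₀ hz0,
      one_smul]
    abel
  · ext1 q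
    change z • E q - z⁻¹ • Ψ q - E q * Ψ q = 0
    rw [hE, sub_mul, hR1', smul_mul_assoc, one_mul, smul_sub, smul_smul, mul_inv_cancel₀ hz0,
      one_smul]
    abel

/-- Left multiplication by `(1 + e) / 2`. -/
def halfAdd (H : Type u) [NormedAddCommGroup H] [InnerProductSpace ℝ H] :
    Cliff H →L[ℝ] Cliff H :=
  (2⁻¹ : ℝ) • (ContinuousLinearMap.id ℝ _ + ContinuousLinearMap.mul ℝ _ (cliffE H))

/-- Left multiplication by `(1 - e) / 2`. -/
def halfSub (H : Type u) [NormedAddCommGroup H] [InnerProductSpace ℝ H] :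
    Cliff H →L[ℝ] Cliff H :=
  (2⁻¹ : ℝ) • (ContinuousLinearMap.id ℝ _ - ContinuousLinearMap.mul ℝ _ (cliffE H))

/-- The symmetric function `F_even + e F_odd` attached to an element of `𝒮 ⊗̂ 𝒞(W)`. -/
def symm (F : C₀(ℝ × W, Cliff H)) : C₀(ℝ × W, Cliff H) :=
  c0Post (halfAdd H) F + c0Post (halfSub H) (c0Refl F)

theorem two_inv_smul (a : Cliff H) : (2⁻¹ : ℂ) • a = (2⁻¹ : ℝ) • a := by
  rw [RCLike.real_smul_eq_coe_smul (K := ℂ)]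
  simp

theorem symm_apply (F : C₀(ℝ × W, Cliff H)) (t : ℝ) (w : W) :
    symm F (t, w) = evenPart F t w + cliffE H * oddPart F t w := by
  change (2⁻¹ : ℝ) • (F (t, w) + cliffE H * F (t, w)) +
    (2⁻¹ : ℝ) • (F (-t, w) - cliffE H * F (-t, w)) = _
  rw [evenPart, oddPart, two_inv_smul, two_inv_smul, mul_smul_comm, mul_sub]
  module

theorem evenPart_mem {F : C₀(ℝ × W, Cliff H)} (hF : F ∈ hktLocal W) (t : ℝ) (w : W) :
    evenPart F t w ∈ cliffordSub W :=
  SMulMemClass.smul_mem _ (add_mem (hF _) (hF _))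

theorem oddPart_mem {F : C₀(ℝ × W, Cliff H)} (hF : F ∈ hktLocal W) (t : ℝ) (w : W) :
    oddPart F t w ∈ cliffordSub W :=
  SMulMemClass.smul_mem _ (sub_mem (hF _) (hF _))

theorem isSym_symm {F : C₀(ℝ × W, Cliff H)} (hF : F ∈ hktLocal W) : IsSym W (symm F) where
  mem := fun ⟨t, w⟩ => by
    rw [symm_apply]
    exact mem_cliffordSubE.mpr ⟨_, evenPart_mem hF t w, _, oddPart_mem hF t w, rfl⟩
  flip t w := by
    rw [symm_apply, symm_apply, map_add, map_mul, flip_cliffE, flip_eq_self (evenPart_mem hF t w),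
      flip_eq_self (oddPart_mem hF t w)]
    simp only [evenPart, oddPart, neg_neg]
    rw [add_comm (F (-t, w)), neg_mul, ← mul_neg, ← smul_neg, neg_sub]

theorem norm_half_add_le (a : Cliff H) : ‖(2⁻¹ : ℝ) • (a + cliffE H * a)‖ ≤ ‖a‖ := by
  have h1 := norm_add_le a (cliffE H * a)
  have h2 := norm_mul_le (cliffE H) a
  have h3 := norm_cliffE_le (H := H)
  rw [norm_smul, norm_inv, Real.norm_two]
  nlinarith [norm_nonneg a]

theorem norm_half_sub_le (a : Cliff H) : ‖(2⁻¹ : ℝ) • (a - cliffE H * a)‖ ≤ ‖a‖ := by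
  have h1 := norm_sub_le a (cliffE H * a)
  have h2 := norm_mul_le (cliffE H) a
  have h3 := norm_cliffE_le (H := H)
  rw [norm_smul, norm_inv, Real.norm_two]
  nlinarith [norm_nonneg a]

/-- The reflected summand of `symm F` is differentiated along `(-s, w)`, so the bound on `F` is
needed in directions of both signs. -/
theorem HasC1Bound.symm {F : C₀(ℝ × W, Cliff H)} {c : ℝ} (h : HasC1Bound F c) :
    HasC1Bound (symm F) (c + c) := by
  intro Z hZ
  obtain ⟨D, hD, hDc⟩ := h Z hZ
  obtain ⟨D', hD', hDc'⟩ := h (-Z.1, Z.2) (by simpa using hZ)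
  have h1 : ∀ q, HasDerivAt (fun t : ℝ => (halfAdd H) (F (q + t • Z))) (halfAdd H (D q)) 0 :=
    fun q => HasLineDerivAt.post (hD q) (halfAdd H)
  have h2 : ∀ q, HasDerivAt (fun t : ℝ => (halfSub H) (c0Refl F (q + t • Z)))
      (halfSub H (c0Refl D' q)) 0 :=
    fun q => HasLineDerivAt.post (HasLineDerivAt.refl (hD' _)) (halfSub H)
  refine ⟨c0Post (halfAdd H) D + c0Post (halfSub H) (c0Refl D'),
    fun q => (h1 q).add (h2 q), (norm_add_le _ _).trans (add_le_add
    (c0_norm_le h.nonneg fun q => ?_) (c0_norm_le h.nonneg fun q => ?_))⟩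
  · exact (norm_half_add_le _).trans ((c0_norm_apply_le D _).trans hDc)
  · exact (norm_half_sub_le _).trans ((c0_norm_apply_le D' _).trans hDc')

/-- At each point `pointHom` replaces `e` by the unit vector `z / ρ` of the formula for `β_W` and
fixes the Clifford algebra of `W`. Where `z = 0` the odd part vanishes on both sides. This presents
`β_W` as a restriction of the multiplicative map `ext₀`. -/
theorem ext₀_symm {F : C₀(ℝ × W, Cliff H)} (hF : F ∈ hktLocal W) :
    ext₀ W (symm F) = beta W F := by
  ext1 q
  rw [ext₀_apply, symm_apply, map_add, map_mul, pointHom_of_mem _ (evenPart_mem hF _ _),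
    pointHom_of_mem _ (oddPart_mem hF _ _)]
  change _ = betaFun W F q
  simp only [betaFun]
  change _ = evenPart F (len (perpVec W ((q.1 : ℝ), q.2))) _ +
    ((len (perpVec W ((q.1 : ℝ), q.2)) : ℝ) : ℂ)⁻¹ • (cliffordVec (perpVec W ((q.1 : ℝ), q.2)) *
      oddPart F (len (perpVec W ((q.1 : ℝ), q.2))) _)
  by_cases h : perpVec W ((q.1 : ℝ), q.2) = 0
  · rw [h, len_eq_zero.mpr rfl]
    simp [oddPart]
  · rw [pointHom_e h, smul_mul_assoc, Complex.ofReal_inv]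

/-- The even and the odd part of `F` are the two components of `symm F`, and both component maps are
contractive. The factor `2` is the price of adding them up again. -/
theorem norm_le_two_mul_norm_beta {F : C₀(ℝ × W, Cliff H)} (hF : F ∈ hktLocal W) :
    ‖F‖ ≤ 2 * ‖beta W F‖ := by
  rw [← ext₀_symm hF, (isSym_symm hF).norm_ext₀]
  refine c0_norm_le (by positivity) fun ⟨t, w⟩ => ?_
  have h1 : F (t, w) = evenPart F t w + oddPart F t w := by
    rw [evenPart, oddPart]
    module
  have h2 := c0_norm_apply_le (symm F) (t, w)
  rw [symm_apply] at h2
  have h3 := norm_cliffEven_le (evenPart F t w + cliffE H * oddPart F t w)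
  have h4 := norm_cliffOdd_le (evenPart F t w + cliffE H * oddPart F t w)
  rw [cliffEven_eq (evenPart_mem hF t w) (oddPart_mem hF t w)] at h3
  rw [cliffOdd_eq (evenPart_mem hF t w) (oddPart_mem hF t w)] at h4
  have := norm_add_le (evenPart F t w) (oddPart F t w)
  rw [h1]
  linarith

theorem beta_add (F G : C₀(ℝ × W, Cliff H)) : beta W (F + G) = beta W F + beta W G := by
  ext1 q
  change betaFun W (F + G) q = betaFun W F q + betaFun W G q
  simp only [betaFun, evenPart, oddPart, ZeroAtInftyContinuousMap.add_apply, mul_add, mul_sub,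
    smul_add, smul_sub, mul_smul_comm]
  abel

theorem beta_smul (c : ℂ) (F : C₀(ℝ × W, Cliff H)) : beta W (c • F) = c • beta W F := by
  ext1 q
  change betaFun W (c • F) q = c • betaFun W F q
  simp only [betaFun, evenPart, oddPart, ZeroAtInftyContinuousMap.smul_apply, mul_sub,
    smul_add, smul_sub, mul_smul_comm, smul_comm c]

theorem norm_beta_le (F : C₀(ℝ × W, Cliff H)) : ‖beta W F‖ ≤ 2 * ‖F‖ := by
  rw [two_mul]
  exact BddFun.norm_mk_le _ _ _ (by positivity)

/-- The element of `𝒮 ⊗̂ 𝒞(W)` attached to a symmetric function. -/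
def unsymm (Ψ : C₀(ℝ × W, Cliff H)) : C₀(ℝ × W, Cliff H) := c0Post (cliffEven H + cliffOdd H) Ψ

theorem unsymm_mem {Ψ : C₀(ℝ × W, Cliff H)} (h : IsSym W Ψ) : unsymm Ψ ∈ hktLocal W := fun q =>
  add_mem (cliffEven_mem (h.mem q)) (cliffOdd_mem (h.mem q))

/-- `unsymm` sends `a₀ + e a₁` to `a₀ + a₁`. Nothing is lost, because for a symmetric function `a₀`
is even and `a₁` is odd in `t`. -/
theorem symm_unsymm {Ψ : C₀(ℝ × W, Cliff H)} (h : IsSym W Ψ) : symm (unsymm Ψ) = Ψ := by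
  ext1 ⟨t, w⟩
  rw [symm_apply, evenPart, oddPart]
  change (2⁻¹ : ℂ) • ((cliffEven H (Ψ (t, w)) + cliffOdd H (Ψ (t, w))) +
    (cliffEven H (Ψ (-t, w)) + cliffOdd H (Ψ (-t, w)))) + cliffE H * ((2⁻¹ : ℂ) •
    ((cliffEven H (Ψ (t, w)) + cliffOdd H (Ψ (t, w))) -
    (cliffEven H (Ψ (-t, w)) + cliffOdd H (Ψ (-t, w))))) = _
  rw [h.flip, cliffEven_flip, cliffOdd_flip]
  conv_rhs => rw [← cliffEven_add_cliffOdd (Ψ (t, w))]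
  congr 1
  · module
  · congr 1
    module

theorem HasC1Bound.unsymm {Ψ : C₀(ℝ × W, Cliff H)} {c : ℝ} (h : HasC1Bound Ψ c) :
    HasC1Bound (unsymm Ψ) (c + c) := by
  intro Z hZ
  obtain ⟨D, hD, hDc⟩ := h Z hZ
  refine ⟨c0Post (cliffEven H + cliffOdd H) D,
    fun q => HasLineDerivAt.post (hD q) (cliffEven H + cliffOdd H), ?_⟩
  refine c0_norm_le (add_nonneg h.nonneg h.nonneg) fun q => (norm_add_le _ _).trans ?_
  have := (c0_norm_apply_le D q).trans hDc
  exact add_le_add ((norm_cliffEven_le _).trans this) ((norm_cliffOdd_le _).trans this)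

theorem HasC1Bound.deriv_mem {F D : C₀(ℝ × W, Cliff H)} (hF : F ∈ hktLocal W) {Z : ℝ × W}
    (h : ∀ q, HasLineDerivAt ℝ F (D q) q Z) : D ∈ hktLocal W := fun q =>
  HasLineDerivAt.mem_of_isClosed (h q) (S := (cliffordSub W).toSubmodule.restrictScalars ℝ)
    (isClosed_cliffordSub W) hF

end Smooth

/-! ### `C¹`-functions in spherical coordinates -/

section Lift

variable {H : Type u} [NormedAddCommGroup H] [InnerProductSpace ℝ H]
variable {W : Submodule ℝ H} [FiniteDimensional ℝ W]
variable {G : Type*} [NormedAddCommGroup G] [NormedSpace ℝ G]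

theorem hasDerivAt_line {E : Type*} [NormedAddCommGroup E] [NormedSpace ℝ E] {f D : E → G} {Z : E}
    (x : E) (s : ℝ) (h : HasLineDerivAt ℝ f (D (x + s • Z)) (x + s • Z) Z) :
    HasDerivAt (fun s : ℝ => f (x + s • Z)) (D (x + s • Z)) s := by
  have h1 : HasDerivAt (fun t : ℝ => f (x + s • Z + t • Z)) (D (x + s • Z)) (s - s) := by
    rw [sub_self]
    exact h
  have h2 := h1.comp_sub_const s s
  refine h2.congr_of_eventuallyEq (Filter.Eventually.of_forall fun t => ?_)
  dsimp only
  congr 1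
  module

/-- Only two directional derivatives of `P` are given. Their continuity makes `(a, b) ↦ P (a, w + b
k)` strictly differentiable, and the chain rule applies along the curve `s ↦ (r s, s)`. -/
theorem hasDerivAt_comp_two {P Pt Pk : C₀(ℝ × W, G)} {k : W}
    (hPt : ∀ q, HasLineDerivAt ℝ P (Pt q) q (1, 0))
    (hPk : ∀ q, HasLineDerivAt ℝ P (Pk q) q (0, k)) {r : ℝ → ℝ} {r' : ℝ}
    (hr : HasDerivAt r r' 0) (w : W) :
    HasDerivAt (fun s : ℝ => P (r s, w + s • k)) (r' • Pt (r 0, w) + Pk (r 0, w)) 0 := by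
  have h1 : ∀ v : ℝ × ℝ, HasFDerivAt (fun a => P (a, w + v.2 • k))
      (ContinuousLinearMap.toSpanSingleton ℝ (Pt (v.1, w + v.2 • k))) v.1 := by
    intro v
    have := hasDerivAt_line (f := P) (D := Pt) (Z := ((1 : ℝ), (0 : W))) (0, w + v.2 • k) v.1
      (hPt _)
    simpa [hasDerivAt_iff_hasFDerivAt] using this
  have h2 : ∀ v : ℝ × ℝ, HasFDerivAt (fun b : ℝ => P (v.1, w + b • k))
      (ContinuousLinearMap.toSpanSingleton ℝ (Pk (v.1, w + v.2 • k))) v.2 := by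
    intro v
    have := hasDerivAt_line (f := P) (D := Pk) (Z := ((0 : ℝ), k)) (v.1, w) v.2 (hPk _)
    simpa [hasDerivAt_iff_hasFDerivAt] using this
  have hL : ∀ F : C₀(ℝ × W, G), Continuous fun v : ℝ × ℝ =>
      ContinuousLinearMap.toSpanSingleton ℝ (F (v.1, w + v.2 • k)) := by
    intro F
    have hc : Continuous fun v : ℝ × ℝ => F (v.1, w + v.2 • k) :=
      F.continuous.comp (by fun_prop)
    exact (ContinuousLinearMap.toSpanSingletonCLE (𝕜 := ℝ) (E := G)).continuous.comp hc
  have h3 := hasStrictFDerivAt_uncurry_coprod (𝕜 := ℝ) (u := (r 0, (0 : ℝ)))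
    (f := fun a b => P (a, w + b • k))
    (f₁ := fun a b => ContinuousLinearMap.toSpanSingleton ℝ (Pt (a, w + b • k)))
    (f₂ := fun a b => ContinuousLinearMap.toSpanSingleton ℝ (Pk (a, w + b • k)))
    (Filter.Eventually.of_forall h1) (Filter.Eventually.of_forall h2)
    (hL Pt).continuousAt (hL Pk).continuousAt
  have h4 : HasDerivAt (fun s : ℝ => (r s, s)) (r', 1) 0 := hr.prodMk (hasDerivAt_id 0)
  have h5 : HasFDerivAt (fun v : ℝ × ℝ => P (v.1, w + v.2 • k))
      ((ContinuousLinearMap.toSpanSingleton ℝ (Pt (r 0, w + (0 : ℝ) • k))).coprod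
        (ContinuousLinearMap.toSpanSingleton ℝ (Pk (r 0, w + (0 : ℝ) • k))))
      ((fun s : ℝ => (r s, s)) 0) := h3.hasFDerivAt
  refine (HasFDerivAt.comp_hasDerivAt (f := fun s : ℝ => (r s, s)) (0 : ℝ) h5 h4).congr_deriv ?_
  simp

/-- The difference quotient `Q(t, w) / t` of a function vanishing at `t = 0`. -/
theorem exists_quotient {Q Qt : C₀(ℝ × W, G)} (hQt : ∀ q, HasLineDerivAt ℝ Q (Qt q) q (1, 0))
    (hQ : ∀ w, Q (0, w) = 0) :
    ∃ κ : C₀(ℝ × W, G), (∀ t w, t • κ (t, w) = Q (t, w)) ∧ (∀ w, κ (0, w) = Qt (0, w)) ∧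
      ‖κ‖ ≤ ‖Qt‖ := by
  classical
  have hd : ∀ (w : W) (s : ℝ), HasDerivAt (fun a => Q (a, w)) (Qt (s, w)) s := by
    intro w s
    have := hasDerivAt_line (f := Q) (D := Qt) (Z := ((1 : ℝ), (0 : W))) (0, w) s (hQt _)
    simpa using this
  -- The value at `t = 0` is the limit of the quotient. The mean value inequality bounds `κ` by the
  -- norm of `Qt`.
  let κ : ℝ × W → G := fun q => if q.1 = 0 then Qt (0, q.2) else q.1⁻¹ • Q q
  have hne : ∀ q : ℝ × W, q.1 ≠ 0 → κ q = q.1⁻¹ • Q q := fun q h => if_neg h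
  have h0 : ∀ w, κ (0, w) = Qt (0, w) := fun w => if_pos rfl
  have hsmul : ∀ t w, t • κ (t, w) = Q (t, w) := by
    intro t w
    by_cases ht : t = 0
    · rw [ht, zero_smul, hQ]
    · rw [hne _ ht]
      exact smul_inv_smul₀ ht _
  have hbd : ∀ q, ‖κ q‖ ≤ ‖Qt‖ := by
    rintro ⟨t, w⟩
    by_cases ht : t = 0
    · rw [ht, h0]
      exact c0_norm_apply_le _ _
    · have h1 := Convex.norm_image_sub_le_of_norm_hasDerivWithin_le (s := Set.univ) (x := 0) (y := t)
        (f := fun a => Q (a, w)) (C := ‖Qt‖) (fun s _ => (hd w s).hasDerivWithinAt)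
        (fun s _ => c0_norm_apply_le _ _) convex_univ trivial trivial
      simp only [hQ, sub_zero] at h1
      rw [hne _ ht, norm_smul, norm_inv]
      rw [inv_mul_le_iff₀ (norm_pos_iff.mpr ht), mul_comm]
      exact h1
  -- Uniform continuity of `Qt` makes `δ` independent of `w`. The mean value inequality is applied
  -- to `a ↦ Q (a, w) - a Qt (0, w)`. The uniformity serves both continuity at `t = 0` and decay at
  -- infinity.
  have hnear : ∀ ε : ℝ, 0 < ε → ∃ δ : ℝ, 0 < δ ∧ ∀ (t : ℝ) (w : W), |t| < δ →
      ‖κ (t, w) - Qt (0, w)‖ ≤ ε ∧ ‖Qt (t, w) - Qt (0, w)‖ ≤ ε := by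
    intro ε hε
    obtain ⟨δ, hδ, huc⟩ := Metric.uniformContinuous_iff.mp
      (ZeroAtInftyContinuousMap.uniformContinuous Qt) ε hε
    have hQd : ∀ (s : ℝ) (w : W), |s| < δ → ‖Qt (s, w) - Qt (0, w)‖ ≤ ε := by
      intro s w hs
      rw [← dist_eq_norm]
      refine (huc ?_).le
      rw [Prod.dist_eq, dist_self]
      simpa [hδ] using hs
    refine ⟨δ, hδ, fun t w ht => ⟨?_, hQd t w ht⟩⟩
    by_cases h : t = 0
    · rw [h, h0, sub_self, norm_zero]
      exact hε.le
    · have h1 := Convex.norm_image_sub_le_of_norm_hasDerivWithin_le (s := Metric.ball (0 : ℝ) δ)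
        (x := 0) (y := t) (f := fun a => Q (a, w) - a • Qt (0, w)) (C := ε)
        (f' := fun s => Qt (s, w) - (1 : ℝ) • Qt (0, w))
        (fun s _ => ((hd w s).sub ((hasDerivAt_id s).smul_const _)).hasDerivWithinAt)
        (fun s hs => by
          rw [one_smul]
          exact hQd s w (by simpa using hs)) (convex_ball _ _) (by simpa using hδ)
        (by simpa using ht)
      simp only [hQ, sub_zero, zero_smul] at h1
      have h2 : κ (t, w) - Qt (0, w) = t⁻¹ • (Q (t, w) - t • Qt (0, w)) := by
        rw [hne _ h, smul_sub, inv_smul_smul₀ h]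
      rw [h2, norm_smul, norm_inv, inv_mul_le_iff₀ (norm_pos_iff.mpr h), mul_comm]
      exact h1
  have hcont : Continuous κ := by
    rw [continuous_iff_continuousAt]
    rintro ⟨t, w⟩
    by_cases ht : t = 0
    · subst ht
      have hc : Filter.Tendsto (fun q : ℝ × W => Qt (0, q.2)) (nhds (0, w)) (nhds (κ (0, w))) := by
        rw [h0]
        exact (Qt.continuous.comp (by fun_prop : Continuous fun q : ℝ × W => ((0 : ℝ), q.2))).tendsto
          (0, w)
      have hs : Filter.Tendsto (fun q : ℝ × W => κ q - Qt (0, q.2)) (nhds (0, w)) (nhds 0) := by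
        rw [Metric.tendsto_nhds]
        intro ε hε
        obtain ⟨δ, hδ, h⟩ := hnear (ε / 2) (half_pos hε)
        have : ∀ᶠ q : ℝ × W in nhds (0, w), |q.1| < δ :=
          (continuous_fst.abs.tendsto ((0 : ℝ), w)).eventually (gt_mem_nhds (by simpa using hδ))
        filter_upwards [this] with q hq
        rw [dist_zero_right]
        linarith [(h q.1 q.2 hq).1]
      simpa [ContinuousAt] using hs.add hc
    · have : ∀ᶠ q : ℝ × W in nhds (t, w), q.1 ≠ 0 :=
        (continuous_fst.tendsto (t, w)).eventually (isOpen_ne.mem_nhds ht)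
      refine ContinuousAt.congr (f := fun q : ℝ × W => q.1⁻¹ • Q q) ?_
        (this.mono fun q hq => (hne q hq).symm)
      exact (continuous_fst.continuousAt.inv₀ ht).smul Q.continuous.continuousAt
  -- For `|t| < δ` compare `κ` with `Qt`, which decays. For `|t| ≥ δ` the quotient is at most `‖Q‖ /
  -- δ` pointwise, and `Q` decays.
  have hzero : Filter.Tendsto κ (Filter.cocompact _) (nhds 0) := by
    rw [Metric.tendsto_nhds]
    intro ε hε
    obtain ⟨δ, hδ, h⟩ := hnear (ε / 4) (by positivity)
    have h1 := Metric.tendsto_nhds.mp Qt.zero_at_infty' (ε / 4) (by positivity)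
    have h2 := Metric.tendsto_nhds.mp Q.zero_at_infty' (δ * ε) (by positivity)
    filter_upwards [h1, h2] with q hq1 hq2
    rw [dist_zero_right] at *
    rcases lt_or_ge |q.1| δ with hq | hq
    · obtain ⟨ha, hb⟩ := h q.1 q.2 hq
      have e : κ q = (κ (q.1, q.2) - Qt (0, q.2)) - (Qt (q.1, q.2) - Qt (0, q.2)) + Qt q := by
        rw [Prod.mk.eta]
        abel
      rw [e]
      refine (norm_add_le _ _).trans_lt ?_
      have := norm_sub_le (κ (q.1, q.2) - Qt (0, q.2)) (Qt (q.1, q.2) - Qt (0, q.2))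
      have hq1' : ‖Qt q‖ < ε / 4 := hq1
      linarith
    · have hq0 : q.1 ≠ 0 := fun h => by
        rw [h, abs_zero] at hq
        linarith
      rw [hne _ hq0, norm_smul, norm_inv, Real.norm_eq_abs, inv_mul_lt_iff₀ (abs_pos.mpr hq0)]
      have hq2' : ‖Q q‖ < δ * ε := hq2
      exact hq2'.trans_le (by gcongr)
  exact ⟨⟨⟨κ, hcont⟩, hzero⟩, hsmul, h0, c0_norm_le (norm_nonneg _) hbd⟩

/-- The inclusion of `ℝ ⊕ H` in the Clifford algebra, as a continuous linear map. -/
def vecL (H : Type u) [NormedAddCommGroup H] [InnerProductSpace ℝ H] : ℝ × H →L[ℝ] Cliff H :=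
  LinearMap.mkContinuous
    { toFun := cliffordVec
      map_add' := cliffordVec_add
      map_smul' := fun r x => (cliffordVec_smul r x).trans
        (RCLike.real_smul_eq_coe_smul (K := ℂ) r (cliffordVec x)).symm } 2 fun z => by
    refine (norm_cliffordVec_le z).trans (Real.sqrt_le_iff.mpr ⟨by positivity, ?_⟩)
    have h1 := norm_fst_le z
    have h2 := norm_snd_le z
    rw [Real.norm_eq_abs] at h1
    rw [← sq_abs z.1]
    nlinarith [norm_nonneg z, abs_nonneg z.1, norm_nonneg z.2]

theorem norm_vecL_le (z : ℝ × H) : ‖vecL H z‖ ≤ len z := norm_cliffordVec_le z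

/-- The inner product of `ℝ ⊕ H`. -/
def dotE (z y : ℝ × H) : ℝ := z.1 * y.1 + inner ℝ z.2 y.2

theorem abs_dotE_le (z y : ℝ × H) : |dotE z y| ≤ len z * len y := by
  rw [len, len, ← Real.sqrt_mul (by positivity)]
  apply Real.abs_le_sqrt
  have h := abs_real_inner_le_norm z.2 y.2
  have h1 := sq_nonneg (z.1 * ‖y.2‖ - ‖z.2‖ * y.1)
  rw [dotE]
  have h2 : (inner ℝ z.2 y.2) ^ 2 ≤ (‖z.2‖ * ‖y.2‖) ^ 2 := sq_le_sq' (by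
    linarith [neg_abs_le (inner ℝ z.2 y.2)]) (le_of_abs_le h)
  have h3 : z.1 * y.1 * inner ℝ z.2 y.2 ≤ |z.1 * y.1| * (‖z.2‖ * ‖y.2‖) := by
    refine (le_abs_self _).trans ?_
    rw [abs_mul]
    gcongr
  have h4 : |z.1 * y.1| * (‖z.2‖ * ‖y.2‖) * 2 ≤ z.1 ^ 2 * ‖y.2‖ ^ 2 + ‖z.2‖ ^ 2 * y.1 ^ 2 := by
    rw [abs_mul]
    have := sq_nonneg (|z.1| * ‖y.2‖ - ‖z.2‖ * |y.1|)
    nlinarith [sq_abs z.1, sq_abs y.1]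
  nlinarith

theorem hasDerivAt_len {z y : ℝ × H} (hz : z ≠ 0) :
    HasDerivAt (fun s : ℝ => len (z + s • y)) (dotE z y / len z) 0 := by
  have h1 : HasDerivAt (fun s : ℝ => z.1 + s * y.1) y.1 0 := by
    simpa using ((hasDerivAt_id (0 : ℝ)).mul_const y.1).const_add z.1
  have h2 : HasDerivAt (fun s : ℝ => z.2 + s • y.2) y.2 0 := by
    simpa using ((hasDerivAt_id (0 : ℝ)).smul_const y.2).const_add z.2
  have h3 := (h1.pow 2).add h2.norm_sq
  have h4 : (((fun s : ℝ => z.1 + s * y.1) ^ 2) + (fun s : ℝ => ‖z.2 + s • y.2‖ ^ 2)) 0 ≠ 0 := by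
    simp only [Pi.add_apply, Pi.pow_apply, zero_mul, add_zero, zero_smul]
    rw [← len_sq]
    exact pow_ne_zero 2 fun h => hz (len_eq_zero.mp h)
  have h5 := h3.sqrt h4
  refine h5.congr_deriv ?_
  simp only [Pi.add_apply, Pi.pow_apply, zero_mul, add_zero, zero_smul]
  rw [← len, dotE]
  have : len z ≠ 0 := fun h => hz (len_eq_zero.mp h)
  field_simp
  ring

variable {E : Type*} [NormedAddCommGroup E] [NormedSpace ℝ E] [FiniteDimensional ℝ E]
  {z : E →L[ℝ] ℝ × H} {p : E →L[ℝ] W}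

/-- The map `x ↦ (|z(x)|, p(x))`. -/
def polar (z : E →L[ℝ] ℝ × H) (p : E →L[ℝ] W) (x : E) : ℝ × W := (len (z x), p x)

theorem continuous_polar : Continuous (polar z p) :=
  (continuous_len.comp z.continuous).prodMk p.continuous

/-- The hypothesis gives `‖polar z p x‖ ≥ ‖x‖ / 2`, so composing with `polar` preserves vanishing at
infinity. -/
theorem tendsto_polar (hzp : ∀ x, ‖x‖ ≤ len (z x) + ‖p x‖) :
    Filter.Tendsto (polar z p) (Filter.cocompact E) (Filter.cocompact (ℝ × W)) := by
  have : ProperSpace E := FiniteDimensional.proper ℝ E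
  rw [← Metric.cobounded_eq_cocompact, ← Metric.cobounded_eq_cocompact,
    ← tendsto_norm_atTop_iff_cobounded]
  refine Filter.tendsto_atTop_mono (f := fun x : E => 2⁻¹ * ‖x‖) (fun x => ?_)
    (tendsto_norm_cobounded_atTop.const_mul_atTop (by norm_num))
  have h1 := norm_fst_le (polar z p x)
  have h2 := norm_snd_le (polar z p x)
  have h3 := hzp x
  simp only [polar, Real.norm_eq_abs, abs_of_nonneg (len_nonneg _)] at h1 h2 ⊢
  linarith

/-- The bounded factor `L` may be discontinuous where `z x = 0`, but there `K` vanishes and the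
product tends to zero. It serves for factors such as `z / |z|`. -/
theorem exists_mul_polar (hzp : ∀ x, ‖x‖ ≤ len (z x) + ‖p x‖) {L : E → Cliff H} {C : ℝ}
    (hC : ∀ x, ‖L x‖ ≤ C) (hL : ∀ x, z x ≠ 0 → ContinuousAt L x) {K : C₀(ℝ × W, Cliff H)}
    (hK : ∀ w, K (0, w) = 0) :
    ∃ D : C₀(E, Cliff H), (∀ x, D x = L x * K (polar z p x)) ∧ ‖D‖ ≤ C * ‖K‖ := by
  have hC0 : 0 ≤ C := (norm_nonneg _).trans (hC 0)
  have hle : ∀ x, ‖L x * K (polar z p x)‖ ≤ C * ‖K (polar z p x)‖ := fun x =>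
    (norm_mul_le _ _).trans (mul_le_mul_of_nonneg_right (hC x) (norm_nonneg _))
  have hKc : Continuous fun x => K (polar z p x) := K.continuous.comp continuous_polar
  have hc : Continuous fun x => L x * K (polar z p x) := by
    rw [continuous_iff_continuousAt]
    intro x
    by_cases hx : z x = 0
    · have h0 : K (polar z p x) = 0 := by
        rw [polar, hx, len_eq_zero.mpr rfl, hK]
      have h1 : Filter.Tendsto (fun x => C * ‖K (polar z p x)‖) (nhds x) (nhds 0) := by
        have := (hKc.norm.const_mul C).tendsto x
        rwa [h0, norm_zero, mul_zero] at this
      rw [ContinuousAt, h0, mul_zero]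
      exact squeeze_zero_norm hle h1
    · exact (hL x hx).mul hKc.continuousAt
  refine ⟨⟨⟨_, hc⟩, ?_⟩, fun x => rfl, c0_norm_le (by positivity) fun x => (hle x).trans
    (mul_le_mul_of_nonneg_left (c0_norm_apply_le K _) hC0)⟩
  refine squeeze_zero_norm hle ?_
  have := ((K.zero_at_infty'.comp (tendsto_polar hzp)).norm).const_mul C
  rwa [norm_zero, mul_zero] at this

theorem inv_len_mul_le (z : ℝ × H) : (len z)⁻¹ * len z ≤ 1 := by
  rcases eq_or_lt_of_le (len_nonneg z) with h | h
  · rw [← h]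
    simp
  · rw [inv_mul_cancel₀ h.ne']

theorem abs_dotE_div_le {z y : ℝ × H} (hy : len y ≤ 1) : |dotE z y / len z| ≤ 1 := by
  rw [abs_div, abs_of_nonneg (len_nonneg z)]
  refine div_le_one_of_le₀ ?_ (len_nonneg z)
  exact (abs_dotE_le z y).trans (mul_le_of_le_one_right (len_nonneg z) hy)

theorem norm_unit_vec_le (z : ℝ × H) : ‖(len z)⁻¹ • vecL H z‖ ≤ 1 := by
  rw [norm_smul, norm_inv, Real.norm_of_nonneg (len_nonneg z)]
  exact (mul_le_mul_of_nonneg_left (norm_vecL_le z) (inv_nonneg.mpr (len_nonneg z))).trans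
    (inv_len_mul_le z)

/-- Passing to spherical coordinates preserves `C¹`-functions of the appropriate parity. -/
theorem exists_polar_C1 (hzp : ∀ x, ‖x‖ ≤ len (z x) + ‖p x‖)
    {P Q : C₀(ℝ × W, Cliff H)} {c : ℝ} (hP : HasC1Bound P c) (hQ : HasC1Bound Q c)
    (hPe : ∀ t w, P (-t, w) = P (t, w)) (hQo : ∀ t w, Q (-t, w) = -Q (t, w)) :
    ∃ F : C₀(E, Cliff H),
      (∀ x, F x = P (polar z p x) + (len (z x))⁻¹ • (vecL H (z x) * Q (polar z p x))) ∧
      ∀ Z : E, len (z Z) ≤ 1 → ‖p Z‖ ≤ 1 → ∃ D : C₀(E, Cliff H),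
        (∀ x, HasLineDerivAt ℝ F (D x) x Z) ∧ ‖D‖ ≤ 6 * c := by
  have hQ0 : ∀ w, Q (0, w) = 0 := by
    intro w
    have h := hQo 0 w
    rw [neg_zero] at h
    have h2 : (2 : ℝ) • Q (0, w) = 0 := by
      rw [two_smul]
      nth_rewrite 1 [h]
      exact neg_add_cancel _
    simpa using h2
  obtain ⟨Pt, hPt, hPtc⟩ := hP (1, 0) (by simp)
  obtain ⟨Qt, hQt, hQtc⟩ := hQ (1, 0) (by simp)
  obtain ⟨κ, hκ, hκ0, hκn⟩ := exists_quotient hQt hQ0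
  -- With `κ = Q / t` the singular factor `z / |z|` becomes the linear factor `z`, so the expression
  -- is continuous across `z x = 0`.
  have hform : ∀ x, P (polar z p x) + (len (z x))⁻¹ • (vecL H (z x) * Q (polar z p x)) =
      P (polar z p x) + vecL H (z x) * κ (polar z p x) := by
    intro x
    by_cases hx : z x = 0
    · rw [hx]
      simp
    · have : len (z x) ≠ 0 := fun h => hx (len_eq_zero.mp h)
      rw [polar, ← hκ, mul_smul_comm, inv_smul_smul₀ this]
  have hcont : Continuous fun x =>
      P (polar z p x) + (len (z x))⁻¹ • (vecL H (z x) * Q (polar z p x)) := by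
    simp only [hform]
    have h1 := P.continuous.comp (continuous_polar (z := z) (p := p))
    have h2 := κ.continuous.comp (continuous_polar (z := z) (p := p))
    exact h1.add (((vecL H).continuous.comp z.continuous).mul h2)
  have hc0 := hP.nonneg
  let F : C₀(E, Cliff H) := ⟨⟨_, hcont⟩, by
    have h1 := P.zero_at_infty'.comp (tendsto_polar hzp)
    have h2 := (Q.zero_at_infty'.comp (tendsto_polar hzp)).norm
    rw [norm_zero] at h2
    have h3 : Filter.Tendsto (fun x => (len (z x))⁻¹ • (vecL H (z x) * Q (polar z p x)))
        (Filter.cocompact E) (nhds 0) := by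
      refine squeeze_zero_norm (fun x => ?_) h2
      rw [← smul_mul_assoc]
      refine (norm_mul_le _ _).trans ?_
      exact mul_le_of_le_one_left (norm_nonneg _) (norm_unit_vec_le _)
    have h4 := h1.add h3
    rw [add_zero] at h4
    exact h4⟩
  have hF : ∀ x, F x = P (polar z p x) + (len (z x))⁻¹ • (vecL H (z x) * Q (polar z p x)) :=
    fun x => rfl
  refine ⟨F, hF, fun Z hZ1 hZ2 => ?_⟩
  have hk : (0 : ℝ) ^ 2 + ‖p Z‖ ^ 2 ≤ 1 := by nlinarith [norm_nonneg (p Z)]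
  obtain ⟨Pk, hPk, hPkc⟩ := hP (0, p Z) hk
  obtain ⟨Qk, hQk, hQkc⟩ := hQ (0, p Z) hk
  -- An even function has zero derivative at the origin. This is the vanishing that
  -- `exists_mul_polar` requires.
  have hPt0 : ∀ w, Pt (0, w) = 0 := by
    intro w
    have h1 := hPt (0, w)
    have h2 : HasDerivAt (fun t : ℝ => P (((0 : ℝ), w) + t • ((1 : ℝ), (0 : W)))) (-Pt (0, w)) 0 := by
      have h3 : HasDerivAt (fun t : ℝ => P (((0 : ℝ), w) + t • ((1 : ℝ), (0 : W)))) (Pt (0, w))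
        (-(0 : ℝ)) := by rw [neg_zero]; exact h1
      have h4 := h3.scomp (0 : ℝ) (hasDerivAt_neg (0 : ℝ))
      simp only [neg_smul, one_smul] at h4
      refine h4.congr_of_eventuallyEq (Filter.Eventually.of_forall fun t => ?_)
      simp only [Function.comp_apply, Prod.smul_mk, Prod.mk_add_mk, smul_eq_mul, mul_one, smul_zero,
        zero_add, add_zero, hPe]
    have h5 := HasDerivAt.unique h1 h2
    have h6 : (2 : ℝ) • Pt (0, w) = 0 := by
      rw [two_smul]
      nth_rewrite 1 [h5]
      exact neg_add_cancel _
    simpa using h6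
  have hQk0 : ∀ w, Qk (0, w) = 0 := by
    intro w
    refine HasDerivAt.unique (hQk (0, w)) ?_
    simpa [hQ0] using hasDerivAt_const (0 : ℝ) (0 : Cliff H)
  set y := z Z with hy
  have hclen : ∀ x, z x ≠ 0 → ContinuousAt (fun x => (len (z x))⁻¹) x := fun x hx =>
    (continuous_len.comp z.continuous).continuousAt.inv₀ fun h => hx (len_eq_zero.mp h)
  have hcdot : Continuous fun x => dotE (z x) y := by
    unfold dotE
    fun_prop
  have hcr : ∀ x, z x ≠ 0 → ContinuousAt (fun x => dotE (z x) y / len (z x)) x := fun x hx =>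
    hcdot.continuousAt.mul (hclen x hx)
  have hcv : ∀ x, z x ≠ 0 → ContinuousAt (fun x => (len (z x))⁻¹ • vecL H (z x)) x := fun x hx =>
    (hclen x hx).smul ((vecL H).continuous.comp z.continuous).continuousAt
  obtain ⟨D1, hD1, hD1n⟩ := exists_mul_polar hzp (C := 1)
    (L := fun x => (dotE (z x) y / len (z x)) • (1 : Cliff H))
    (fun x => by
      rw [norm_smul]
      exact mul_le_one₀ (abs_dotE_div_le hZ1) (norm_nonneg _) norm_cliff_one_le)
    (fun x hx => (hcr x hx).smul continuousAt_const) hPt0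
  obtain ⟨D4, hD4, hD4n⟩ := exists_mul_polar hzp (C := 1) (K := Qt - κ)
    (L := fun x => (dotE (z x) y / len (z x)) • ((len (z x))⁻¹ • vecL H (z x)))
    (fun x => by
      rw [norm_smul]
      exact mul_le_one₀ (abs_dotE_div_le hZ1) (norm_nonneg _) (norm_unit_vec_le _))
    (fun x hx => (hcr x hx).smul (hcv x hx)) (fun w => by
      rw [ZeroAtInftyContinuousMap.sub_apply, hκ0, sub_self])
  obtain ⟨D5, hD5, hD5n⟩ := exists_mul_polar hzp (C := 1) (L := fun x => (len (z x))⁻¹ • vecL H (z x))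
    (fun x => norm_unit_vec_le _) hcv hQk0
  let D2 : C₀(E, Cliff H) := ⟨⟨fun x => Pk (polar z p x), Pk.continuous.comp continuous_polar⟩,
    Pk.zero_at_infty'.comp (tendsto_polar hzp)⟩
  let D3' : C₀(E, Cliff H) := ⟨⟨fun x => κ (polar z p x), κ.continuous.comp continuous_polar⟩,
    κ.zero_at_infty'.comp (tendsto_polar hzp)⟩
  let D3 : C₀(E, Cliff H) := c0Mul (fun _ => vecL H y) continuous_const 1
    (fun _ => (norm_vecL_le _).trans hZ1) D3'
  -- The terms of the product and chain rule, with `r = ⟨z, y⟩ / ρ`: `r Pt`, `Pk`, `y κ`, `r (z / ρ)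
  -- (Qt - κ)` and `(z / ρ) Qk`. Their norms are at most `c`, `c`, `c`, `2c` and `c`, which is the
  -- source of the constant `6`.
  let D : C₀(E, Cliff H) := D1 + D2 + D3 + D4 + D5
  have hD : ∀ x, D x = (dotE (z x) y / len (z x)) • Pt (polar z p x) + Pk (polar z p x) +
      vecL H y * κ (polar z p x) + (dotE (z x) y / len (z x)) • ((len (z x))⁻¹ • vecL H (z x)) *
        (Qt (polar z p x) - κ (polar z p x)) +
      (len (z x))⁻¹ • vecL H (z x) * Qk (polar z p x) := by
    intro x
    change D1 x + Pk (polar z p x) + vecL H y * κ (polar z p x) + D4 x + D5 x = _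
    rw [hD1, hD4, hD5, smul_mul_assoc, one_mul]
    rfl
  have hreg : ∀ x, z x ≠ 0 → HasLineDerivAt ℝ F (D x) x Z := by
    intro x hx
    have hlen : len (z x) ≠ 0 := fun h => hx (len_eq_zero.mp h)
    have hr : HasDerivAt (fun s : ℝ => len (z (x + s • Z))) (dotE (z x) y / len (z x)) 0 := by
      simpa using hasDerivAt_len (y := y) hx
    have hv : HasDerivAt (fun s : ℝ => vecL H (z (x + s • Z))) (vecL H y) 0 := by
      have : HasDerivAt (fun s : ℝ => vecL H (z x) + s • vecL H y) (vecL H y) 0 := by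
        simpa using ((hasDerivAt_id (0 : ℝ)).smul_const (vecL H y)).const_add (vecL H (z x))
      simpa using this
    have h1 := hasDerivAt_comp_two hPt hPk hr (p x)
    have h2 := hasDerivAt_comp_two hQt hQk hr (p x)
    have hinv := hr.fun_inv (by simpa using hlen)
    have h3 := h1.add (hinv.fun_smul (hv.mul h2))
    have h4 := h3.congr_of_eventuallyEq (f₁ := fun s : ℝ => F (x + s • Z))
      (Filter.Eventually.of_forall fun s => by
        simp only [hF, polar, map_add, map_smul, Pi.add_apply, Pi.mul_apply])
    refine HasDerivAt.congr_deriv h4 ?_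
    have hq : Q (len (z x), p x) = len (z x) • κ (len (z x), p x) := (hκ _ _).symm
    simp only [zero_smul, add_zero, hD, polar, Pi.mul_apply, hq]
    set ρ := len (z x)
    set r := dotE (z x) y / ρ
    simp only [mul_add, mul_sub, smul_mul_assoc, mul_smul_comm, smul_add, smul_smul]
    have e1 : ρ⁻¹ * ρ = 1 := inv_mul_cancel₀ hlen
    have e2 : -r / ρ ^ 2 * ρ = -(r * ρ⁻¹) := by field_simp
    rw [e1, e2, mul_comm ρ⁻¹ r]
    module
  refine ⟨D, fun x => ?_, ?_⟩
  · by_cases hx : z x = 0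
    -- At a zero of `z` there are two cases. Either the whole line stays in the zero set, where `F`
    -- is `P (0, ·)`, or it leaves it at once. In the latter case the derivative extends by
    -- continuity from the regular points.
    · by_cases hZ : y = 0
      · have hz0 : ∀ s : ℝ, z (x + s • Z) = 0 := fun s => by
          rw [map_add, map_smul, hx, ← hy, hZ, smul_zero, add_zero]
        have h1 := hPk (0, p x)
        refine HasDerivAt.congr_deriv (HasDerivAt.congr_of_eventuallyEq h1
          (Filter.Eventually.of_forall fun s => ?_)) ?_
        · simp [hF, hz0, polar, len_eq_zero.mpr]
        · simp [hD, hx, hZ, polar, len_eq_zero.mpr, dotE]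
      · have h1 := hasDerivAt_of_hasDerivAt_of_ne (f := fun s : ℝ => F (x + s • Z))
          (g := fun s : ℝ => D (x + s • Z)) (x := 0) (fun s hs => hasDerivAt_line x s (hreg _ ?_))
          (F.continuous.comp (by fun_prop)).continuousAt
          (D.continuous.comp (by fun_prop)).continuousAt
        · simpa [HasLineDerivAt] using h1
        · rw [map_add, map_smul, hx, zero_add]
          exact smul_ne_zero hs hZ
    · exact hreg x hx
  · have n2 : ‖D2‖ ≤ c := c0_norm_le hc0 fun x => (c0_norm_apply_le Pk _).trans hPkc
    have n3 : ‖D3‖ ≤ c := c0_norm_le hc0 fun x => by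
      refine (norm_mul_le (vecL H y) (κ (polar z p x))).trans ?_
      have h1 := (norm_vecL_le y).trans hZ1
      have h2 := (c0_norm_apply_le κ (polar z p x)).trans (hκn.trans hQtc)
      exact (mul_le_of_le_one_left (norm_nonneg _) h1).trans h2
    have n4 := norm_sub_le Qt κ
    have a1 := norm_add_le (D1 + D2 + D3 + D4) D5
    have a2 := norm_add_le (D1 + D2 + D3) D4
    have a3 := norm_add_le (D1 + D2) D3
    have a4 := norm_add_le D1 D2
    change ‖D1 + D2 + D3 + D4 + D5‖ ≤ _
    linarith

end Lift

/-! ### Smooth elements of the limit algebra, and enlarging the subspace -/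

section IsSmooth

variable {H : Type u} [NormedAddCommGroup H] [InnerProductSpace ℝ H]
variable {W W' : Submodule ℝ H} [FiniteDimensional ℝ W] [FiniteDimensional ℝ W']

/-- `a` is the image of a `C¹`-element of `𝒜(W)` with derivatives bounded by `c`. -/
def IsSmooth (W : Submodule ℝ H) [FiniteDimensional ℝ W] (c : ℝ) (a : HKTFun H) : Prop :=
  ∃ Ψ : C₀(ℝ × W, Cliff H), IsSym W Ψ ∧ HasC1Bound Ψ c ∧ ext₀ W Ψ = a

theorem IsSmooth.mono {c c' : ℝ} {a : HKTFun H} (h : IsSmooth W c a) (hc : c ≤ c') :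
    IsSmooth W c' a :=
  let ⟨Ψ, h1, h2, h3⟩ := h
  ⟨Ψ, h1, h2.mono hc, h3⟩

theorem IsSmooth.nonneg {c : ℝ} {a : HKTFun H} (h : IsSmooth W c a) : 0 ≤ c :=
  let ⟨_, _, h2, _⟩ := h
  h2.nonneg

theorem IsSmooth.add {c c' : ℝ} {a b : HKTFun H} (h : IsSmooth W c a) (h' : IsSmooth W c' b) :
    IsSmooth W (c + c') (a + b) := by
  obtain ⟨Ψ, h1, h2, rfl⟩ := h
  obtain ⟨Ψ', h1', h2', rfl⟩ := h'
  exact ⟨Ψ + Ψ', h1.add h1', h2.add h2', ext₀_add _ _⟩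

theorem IsSmooth.smul {c : ℝ} {a : HKTFun H} (h : IsSmooth W c a) (r : ℂ) :
    IsSmooth W (‖r‖ * c) (r • a) := by
  obtain ⟨Ψ, h1, h2, rfl⟩ := h
  exact ⟨r • Ψ, h1.smul r, h2.smul r, ext₀_smul _ _⟩

theorem IsSmooth.mul {c c' : ℝ} {a b : HKTFun H} (h : IsSmooth W c a) (h' : IsSmooth W c' b) :
    IsSmooth W (c * ‖b‖ + ‖a‖ * c') (a * b) := by
  obtain ⟨Ψ, h1, h2, rfl⟩ := h
  obtain ⟨Ψ', h1', h2', rfl⟩ := h'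
  rw [h1.norm_ext₀, h1'.norm_ext₀]
  exact ⟨Ψ * Ψ', h1.mul h1', h2.mul h2', ext₀_mul _ _⟩

theorem IsSmooth.star {c : ℝ} {a : HKTFun H} (h : IsSmooth W c a) : IsSmooth W c (star a) := by
  obtain ⟨Ψ, h1, h2, rfl⟩ := h
  exact ⟨Star.star Ψ, h1.star, h2.star, ext₀_star _⟩

theorem isSmooth_zero : IsSmooth W 0 (0 : HKTFun H) := by
  refine ⟨0, ⟨fun q => zero_mem _, fun t w => by simp⟩, fun Z _ => ⟨0, fun q => ?_, by simp⟩, ?_⟩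
  · simpa [HasLineDerivAt] using hasDerivAt_const (0 : ℝ) (0 : Cliff H)
  · have := ext₀_smul (W := W) (0 : ℂ) (0 : C₀(ℝ × W, Cliff H))
    rwa [zero_smul, zero_smul] at this

theorem IsSmooth.exists_quasiInverse {c m : ℝ} {a : HKTFun H} (h : IsSmooth W c a)
    (hm : ‖a‖ ≤ m) {z : ℂ} (hz : m < ‖z‖) :
    ∃ b : HKTFun H, IsSmooth W ((‖z‖ - m)⁻¹ * c * (‖z‖ - m)⁻¹) b ∧
      z • b - z⁻¹ • a - a * b = 0 ∧ z • b - z⁻¹ • a - b * a = 0 := by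
  obtain ⟨Ψ, h1, h2, rfl⟩ := h
  rw [h1.norm_ext₀] at hm
  obtain ⟨E, e1, e2, e3, e4⟩ := TwistedRoe.exists_quasiInverse h1 h2 hm hz
  have e0 : ext₀ W (0 : C₀(ℝ × W, Cliff H)) = 0 := by
    have := ext₀_smul (W := W) (0 : ℂ) (0 : C₀(ℝ × W, Cliff H))
    rwa [zero_smul, zero_smul] at this
  have esub : ∀ F G : C₀(ℝ × W, Cliff H), F = G + (F - G) → ext₀ W (F - G) = ext₀ W F - ext₀ W G := by
    intro F G hFG
    have := congrArg (ext₀ W) hFG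
    rw [ext₀_add] at this
    rw [this, add_sub_cancel_left]
  refine ⟨ext₀ W E, ⟨E, e1, e2, rfl⟩, ?_, ?_⟩
  · rw [← ext₀_smul, ← ext₀_smul, ← ext₀_mul, ← esub _ _ (by abel), ← esub _ _ (by abel), e3, e0]
  · rw [← ext₀_smul, ← ext₀_smul, ← ext₀_mul, ← esub _ _ (by abel), ← esub _ _ (by abel), e4, e0]

theorem isSmooth_beta {F : C₀(ℝ × W, Cliff H)} (hF : F ∈ hktLocal W) {c : ℝ}
    (h : HasC1Bound F c) : IsSmooth W (c + c) (beta W F) :=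
  ⟨symm F, isSym_symm hF, h.symm, ext₀_symm hF⟩

theorem IsSmooth.exists_beta {c : ℝ} {a : HKTFun H} (h : IsSmooth W c a) :
    ∃ F ∈ hktLocal W, HasC1Bound F (c + c) ∧ beta W F = a := by
  obtain ⟨Ψ, h1, h2, rfl⟩ := h
  refine ⟨unsymm Ψ, unsymm_mem h1, h2.unsymm, ?_⟩
  rw [← ext₀_symm (unsymm_mem h1), symm_unsymm h1]

theorem IsSmooth.mem_hktAlgebra {V : Submodule ℝ H} (hW : W ≤ V) {c : ℝ} {a : HKTFun H}
    (h : IsSmooth W c a) : a ∈ hktAlgebra V := by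
  obtain ⟨F, hF, _, rfl⟩ := h.exists_beta
  refine NonUnitalStarSubalgebra.le_topologicalClosure _ ?_
  exact NonUnitalStarAlgebra.subset_adjoin ℂ _ ⟨W, inferInstance, hW, F, hF, rfl⟩

theorem len_inclusion (hW : W ≤ W') (v : H) :
    W.orthogonalProjectionOnto (W'.orthogonalProjectionOnto v : H) =
      W.orthogonalProjectionOnto v := by
  have h := Submodule.orthogonalProjectionOnto_starProjection_of_le hW v
  exact h

/-- This is the properness condition of `exists_polar_C1` for the splitting of `ℝ × W'` into its
`W`-part and the orthogonal part. -/
theorem norm_le_len_add (x : ℝ × W') :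
    ‖x‖ ≤ len (perpVec W (x.1, (x.2 : H))) + ‖W.orthogonalProjectionOnto (x.2 : H)‖ := by
  set z := perpVec W (x.1, (x.2 : H)) with hz
  have h1 : |z.1| ≤ len z := Real.abs_le_sqrt (by nlinarith [sq_nonneg ‖z.2‖])
  have h2 : ‖z.2‖ ≤ len z := by
    rw [← abs_of_nonneg (norm_nonneg z.2)]
    exact Real.abs_le_sqrt (by nlinarith [sq_nonneg z.1])
  have h3 : (x.2 : H) = z.2 + W.orthogonalProjectionOnto (x.2 : H) := by
    rw [hz, perpVec_apply]
    simp
  have h4 : ‖x.2‖ ≤ ‖z.2‖ + ‖W.orthogonalProjectionOnto (x.2 : H)‖ := by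
    have := norm_add_le z.2 (W.orthogonalProjectionOnto (x.2 : H) : H)
    rw [← h3] at this
    exact this
  refine max_le ?_ ?_
  · have : ‖x.1‖ = |z.1| := rfl
    rw [this]
    linarith [norm_nonneg (W.orthogonalProjectionOnto (x.2 : H))]
  · linarith

/-- Over `W'` the same element is given by `P(ρ, w) + (z / ρ) Q(ρ, w)`, where `w` is the projection
to `W`, `z` the orthogonal part in `ℝ ⊕ W'` and `ρ = |z|`. It is `C¹` across `z = 0` because `P` is
even and `Q` is odd. Enlarging `W` allows families with different `N` to be added and multiplied. -/
theorem IsSmooth.lift {c : ℝ} {a : HKTFun H} (h : IsSmooth W c a) (hW : W ≤ W') :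
    IsSmooth W' (6 * c) a := by
  obtain ⟨Ψ, h1, h2, rfl⟩ := h
  set P : C₀(ℝ × W, Cliff H) := c0Post (cliffEven H) Ψ with hPdef
  set Q : C₀(ℝ × W, Cliff H) := c0Post (cliffOdd H) Ψ with hQdef
  have hPm : ∀ q, P q ∈ cliffordSub W := fun q => cliffEven_mem (h1.mem q)
  have hQm : ∀ q, Q q ∈ cliffordSub W := fun q => cliffOdd_mem (h1.mem q)
  have hPQ : ∀ q, Ψ q = P q + cliffE H * Q q := fun q => (cliffEven_add_cliffOdd (Ψ q)).symm
  have hP : HasC1Bound P c := fun Z hZ => by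
    obtain ⟨D, hD, hDc⟩ := h2 Z hZ
    exact ⟨c0Post (cliffEven H) D, fun q => HasLineDerivAt.post (hD q) _, c0_norm_le h2.nonneg
      fun q => (norm_cliffEven_le _).trans ((c0_norm_apply_le D q).trans hDc)⟩
  have hQ : HasC1Bound Q c := fun Z hZ => by
    obtain ⟨D, hD, hDc⟩ := h2 Z hZ
    exact ⟨c0Post (cliffOdd H) D, fun q => HasLineDerivAt.post (hD q) _, c0_norm_le h2.nonneg
      fun q => (norm_cliffOdd_le _).trans ((c0_norm_apply_le D q).trans hDc)⟩
  have hPe : ∀ t w, P (-t, w) = P (t, w) := fun t w => by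
    rw [hPdef, c0Post_apply, c0Post_apply, h1.flip, cliffEven_flip]
  have hQo : ∀ t w, Q (-t, w) = -Q (t, w) := fun t w => by
    rw [hQdef, c0Post_apply, c0Post_apply, h1.flip, cliffOdd_flip]
  have hQ0 : ∀ w, Q (0, w) = 0 := by
    intro w
    have h := hQo 0 w
    rw [neg_zero] at h
    have h2 : (2 : ℝ) • Q (0, w) = 0 := by
      rw [two_smul]
      nth_rewrite 1 [h]
      exact neg_add_cancel _
    simpa using h2
  let j : ℝ × W' →L[ℝ] ℝ × H := ContinuousLinearMap.prodMap (ContinuousLinearMap.id ℝ ℝ) W'.subtypeL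
  let z : ℝ × W' →L[ℝ] ℝ × H := (perpVec W).comp j
  let p : ℝ × W' →L[ℝ] W := W.orthogonalProjectionOnto.comp
    (W'.subtypeL.comp (ContinuousLinearMap.snd ℝ ℝ W'))
  have hz : ∀ t (w : W'), z (t, w) = perpVec W (t, (w : H)) := fun t w => rfl
  have hp : ∀ t (w : W'), p (t, w) = W.orthogonalProjectionOnto (w : H) := fun t w => rfl
  obtain ⟨F, hF, hFd⟩ := exists_polar_C1 (z := z) (p := p)
    (fun x => norm_le_len_add x) hP hQ hPe hQo
  have hlen : ∀ t (w : W'), len (z (-t, w)) = len (z (t, w)) := fun t w => by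
    rw [hz, hz, perpVec_apply, perpVec_apply, len, len]
    simp
  have hzmem : ∀ x : ℝ × W', (z x).2 ∈ W' := fun x =>
    sub_mem x.2.2 (hW (W.orthogonalProjectionOnto (x.2 : H)).2)
  refine ⟨F, ⟨fun q => ?_, fun t w => ?_⟩, fun Z hZ => ?_, ?_⟩
  · rw [hF]
    have e : vecL H (z q) = cliffordVec (0, (z q).2) + q.1 • cliffE H := by
      have h0 : z q = (0, (z q).2) + q.1 • ((1 : ℝ), (0 : H)) := by
        ext
        · simp [z, j, perpVec_apply]
        · simp
      conv_lhs => rw [h0]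
      rw [map_add, map_smul]
      rfl
    refine mem_cliffordSubE.mpr ⟨P (polar z p q) + (len (z q))⁻¹ • (cliffordVec (0, (z q).2) *
      Q (polar z p q)), ?_, (len (z q))⁻¹ • (q.1 • Q (polar z p q)), ?_, ?_⟩
    · refine add_mem (cliffordSub_mono hW (hPm _)) ?_
      rw [RCLike.real_smul_eq_coe_smul (K := ℂ)]
      exact SMulMemClass.smul_mem _ (mul_mem (mem_cliffordSub_vec (hzmem q))
        (cliffordSub_mono hW (hQm _)))
    · rw [RCLike.real_smul_eq_coe_smul (K := ℂ), RCLike.real_smul_eq_coe_smul (K := ℂ)]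
      exact SMulMemClass.smul_mem _ (SMulMemClass.smul_mem _ (cliffordSub_mono hW (hQm _)))
    · rw [e, add_mul, smul_mul_assoc, mul_smul_comm, mul_smul_comm, smul_add, add_assoc]
  · rw [hF, hF]
    have e : polar z p (-t, w) = polar z p (t, w) := by
      rw [polar, polar, hlen, hp, hp]
    have e2 : z (-t, w) = (-(z (t, w)).1, (z (t, w)).2) := by
      rw [hz, hz, perpVec_apply, perpVec_apply]
    have e3 : (flipIso H).pull (vecL H (z (t, w))) = vecL H (z (-t, w)) := by
      rw [e2]
      rfl
    have e4 : (flipIso H).pull ((len (z (t, w)))⁻¹ • (vecL H (z (t, w)) * Q (polar z p (t, w)))) =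
        (len (z (t, w)))⁻¹ • (vecL H (z (-t, w)) * Q (polar z p (t, w))) := by
      rw [RCLike.real_smul_eq_coe_smul (K := ℂ), map_smul, map_mul, e3, flip_eq_self (hQm _),
        ← RCLike.real_smul_eq_coe_smul (K := ℂ)]
    rw [map_add, e4, flip_eq_self (hPm _), hlen, e]
  · refine hFd Z ?_ ?_
    · rw [len, Real.sqrt_le_one]
      have h3 : ‖(z Z).2‖ ≤ ‖Z.2‖ := by
        have := W.norm_starProjection_apply_le (Z.2 : H)
        have h4 := W.norm_sq_eq_add_norm_sq_starProjection (Z.2 : H)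
        have h5 : (z Z).2 = Wᗮ.starProjection (Z.2 : H) := by
          rw [Submodule.starProjection_orthogonal]
          rfl
        rw [h5]
        exact Wᗮ.norm_starProjection_apply_le (Z.2 : H)
      have h4 : (z Z).1 = Z.1 := rfl
      rw [h4]
      nlinarith [norm_nonneg (z Z).2]
    · have h3 : ‖p Z‖ ≤ ‖Z.2‖ := W.norm_orthogonalProjectionOnto_apply_le (Z.2 : H)
      have h4 : ‖Z.2‖ ≤ 1 := by nlinarith [sq_nonneg Z.1, norm_nonneg Z.2]
      exact h3.trans h4
  · ext1 q
    set t : ℝ := (q.1 : ℝ) with ht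
    set v : H := q.2 with hv
    have hpp : W.orthogonalProjectionOnto (W'.orthogonalProjectionOnto v : H) =
      W.orthogonalProjectionOnto v := len_inclusion hW v
    rw [ext₀_apply, ext₀_apply, hPQ, map_add, map_mul, pointHom_of_mem _ (hPm _),
      pointHom_of_mem _ (hQm _), hF]
    rw [← ht, ← hv]
    set z' := perpVec W' (t, v) with hz'
    set zz := perpVec W (t, v) with hzz
    set h := z (len z', W'.orthogonalProjectionOnto v) with hh
    have hh' : h = (len z', (W'.orthogonalProjectionOnto v : H) - W.orthogonalProjectionOnto v) := by
      rw [hh, hz, perpVec_apply, hpp]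
    have hmem : h.2 ∈ W' := hzmem _
    have hsplit : zz = z' + (0, h.2) := by
      rw [hzz, hz', hh', perpVec_apply, perpVec_apply]
      ext <;> simp
    -- Pythagoras: `z'` is orthogonal to `W'`, while the second component of `h` lies in `W'`.
    have hlenh : len h = len zz := by
      have o : inner ℝ z'.2 h.2 = 0 := inner_perpVec (t, v) hmem
      have : len h ^ 2 = len zz ^ 2 := by
        rw [hsplit, len_sq, len_sq, Prod.fst_add, Prod.snd_add, norm_add_sq_real, o]
        have h1 : h.1 = len z' := by rw [hh']
        rw [h1, len_sq]
        simp
        ring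
      exact (sq_eq_sq₀ (len_nonneg _) (len_nonneg _)).mp this
    have hpolar : polar z p (len z', W'.orthogonalProjectionOnto v) =
        (len zz, W.orthogonalProjectionOnto v) := by
      rw [polar, ← hh, hlenh, hp, hpp]
    -- The homomorphism attached to `W'` turns the component `len z' • e` of `h` into `z'` and fixes
    -- the component in `W'`. Their sum is `zz`.
    have hvec : pointHom W' (t, v) (vecL H h) = vecL H zz := by
      have e1 : h = len z' • ((1 : ℝ), (0 : H)) + (0, h.2) := by
        rw [hh']
        ext <;> simp
      have e2 : pointHom W' (t, v) (cliffordVec (0, h.2)) = cliffordVec (0, h.2) :=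
        pointHom_of_mem _ (mem_cliffordSub_vec hmem)
      have e3 : pointHom W' (t, v) (vecL H (len z' • ((1 : ℝ), (0 : H)))) = vecL H z' := by
        rw [map_smul, RCLike.real_smul_eq_coe_smul (K := ℂ), map_smul]
        change _ • pointHom W' (t, v) (cliffE H) = _
        by_cases h0 : z' = 0
        · rw [h0, len_eq_zero.mpr rfl]
          simp
        · have hl : len z' ≠ 0 := fun h => h0 (len_eq_zero.mp h)
          rw [pointHom_e h0, smul_smul, ← hz']
          simp [hl]
          rfl
      conv_lhs => rw [e1]
      rw [map_add, map_add, e3]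
      have e4 : vecL H (0, h.2) = cliffordVec (0, h.2) := rfl
      rw [e4, e2, hsplit, map_add, e4]
    rw [hpolar, hlenh, map_add, RCLike.real_smul_eq_coe_smul (K := ℂ), map_smul, map_mul, hvec,
      pointHom_of_mem _ (cliffordSub_mono hW (hPm _)),
      pointHom_of_mem _ (cliffordSub_mono hW (hQm _))]
    congr 1
    by_cases h0 : zz = 0
    · rw [h0, len_eq_zero.mpr rfl, hQ0]
      simp
    · rw [pointHom_e h0, smul_mul_assoc]
      rfl

end IsSmooth

/-! ### Supports and the ideals of an open set -/

section Ideal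

variable {H : Type u} [NormedAddCommGroup H] [InnerProductSpace ℝ H]

theorem continuous_hktSpace : Continuous
    (fun q : HKTSpace H => ((q.1 : ℝ) ^ 2 + ‖q.2‖ ^ 2, fun u : H => inner ℝ q.2 u)) :=
  continuous_induced_dom

/-- Under the inducing map the set becomes a closed subset of a product of compact intervals.
Closedness uses Riesz: a linear `φ` with `|φ u| ≤ √s ‖u‖` is represented by some `v` with `‖v‖² ≤
s`, and the missing length goes into `t = √(s - ‖v‖²)`. The resulting supply of `C₀`-functions gives
the zero element empty support. -/
theorem isCompact_hktSpace_le [CompleteSpace H] (R : ℝ) :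
    IsCompact {q : HKTSpace H | (q.1 : ℝ) ^ 2 + ‖q.2‖ ^ 2 ≤ R} := by
  have hind : Topology.IsInducing
    (fun q : HKTSpace H => ((q.1 : ℝ) ^ 2 + ‖q.2‖ ^ 2, fun u : H => inner ℝ q.2 u)) := ⟨rfl⟩
  rw [hind.isCompact_iff]
  have hbox : IsCompact (Set.Icc (0 : ℝ) R ×ˢ
      (Set.pi Set.univ fun u : H => Set.Icc (-(√R * ‖u‖)) (√R * ‖u‖))) :=
    isCompact_Icc.prod (isCompact_univ_pi fun u => isCompact_Icc)
  refine hbox.of_isClosed_subset ?_ ?_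
  · have : ((fun q : HKTSpace H => ((q.1 : ℝ) ^ 2 + ‖q.2‖ ^ 2, fun u : H => inner ℝ q.2 u)) ''
        {q : HKTSpace H | (q.1 : ℝ) ^ 2 + ‖q.2‖ ^ 2 ≤ R}) =
        {x : ℝ × (H → ℝ) | x.1 ≤ R ∧ 0 ≤ x.1 ∧ (∀ u v, x.2 (u + v) = x.2 u + x.2 v) ∧
          (∀ (c : ℝ) u, x.2 (c • u) = c * x.2 u) ∧ ∀ u, |x.2 u| ≤ √x.1 * ‖u‖} := by
      ext ⟨s, φ⟩
      constructor
      · rintro ⟨q, hq, h⟩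
        obtain ⟨rfl, rfl⟩ := Prod.ext_iff.1 h
        refine ⟨hq, by positivity, fun u v => inner_add_right _ _ _,
          fun c u => real_inner_smul_right _ _ _, fun u => ?_⟩
        refine (abs_real_inner_le_norm _ _).trans ?_
        refine mul_le_mul_of_nonneg_right (Real.le_sqrt_of_sq_le ?_) (norm_nonneg _)
        simp only
        nlinarith [sq_nonneg (q.1 : ℝ)]
      · rintro ⟨h1, h0, h2, h3, h4⟩
        simp only at h1 h0 h2 h3 h4
        let L : H →ₗ[ℝ] ℝ := { toFun := φ, map_add' := h2, map_smul' := h3 }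
        let L' : H →L[ℝ] ℝ := L.mkContinuous (√s) h4
        have hL : ‖L'‖ ≤ √s := L.mkContinuous_norm_le (Real.sqrt_nonneg _) h4
        set v : H := (InnerProductSpace.toDual ℝ H).symm L' with hv
        have hvn : ‖v‖ ≤ √s := by rwa [hv, LinearIsometryEquiv.norm_map]
        have hv2 : ‖v‖ ^ 2 ≤ s := by
          calc ‖v‖ ^ 2 ≤ √s ^ 2 := by gcongr
            _ = s := Real.sq_sqrt h0
        have hs : (√(s - ‖v‖ ^ 2)) ^ 2 + ‖v‖ ^ 2 = s := by
          rw [Real.sq_sqrt (by linarith)]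
          ring
        refine ⟨(⟨√(s - ‖v‖ ^ 2), Real.sqrt_nonneg _⟩, v), ?_, ?_⟩
        · change (√(s - ‖v‖ ^ 2)) ^ 2 + ‖v‖ ^ 2 ≤ R
          rw [hs]
          exact h1
        · refine Prod.ext hs (funext fun u => ?_)
          change inner ℝ v u = φ u
          rw [hv, InnerProductSpace.toDual_symm_apply]
          rfl
    rw [this]
    have hev : ∀ u : H, Continuous fun x : ℝ × (H → ℝ) => x.2 u :=
      fun u => (continuous_apply u).comp continuous_snd
    simp only [Set.ofPred_and, Set.ofPred_forall]
    refine (isClosed_le continuous_fst continuous_const).inter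
      ((isClosed_le continuous_const continuous_fst).inter (IsClosed.inter ?_ (IsClosed.inter ?_ ?_)))
    · exact isClosed_iInter fun u => isClosed_iInter fun v =>
        isClosed_eq (hev _) ((hev _).add (hev _))
    · exact isClosed_iInter fun c => isClosed_iInter fun v =>
        isClosed_eq (hev _) (continuous_const.mul (hev _))
    · exact isClosed_iInter fun u => isClosed_le (hev _).abs
        ((Real.continuous_sqrt.comp continuous_fst).mul continuous_const)
  · rintro _ ⟨q, hq, rfl⟩
    have hq' : (q.1 : ℝ) ^ 2 + ‖q.2‖ ^ 2 ≤ R := hq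
    refine ⟨⟨by positivity, hq⟩, fun u _ => ?_⟩
    have : |inner ℝ q.2 u| ≤ √R * ‖u‖ := by
      refine (abs_real_inner_le_norm _ _).trans ?_
      refine mul_le_mul_of_nonneg_right (Real.le_sqrt_of_sq_le ?_) (norm_nonneg _)
      nlinarith [sq_nonneg (q.1 : ℝ)]
    exact ⟨neg_le_of_abs_le this, le_of_abs_le this⟩

theorem exists_zeroAtInfty_ne_zero [CompleteSpace H] (q : HKTSpace H) :
    ∃ g : C₀(HKTSpace H, ℂ), g q ≠ 0 := by
  set R : ℝ := (q.1 : ℝ) ^ 2 + ‖q.2‖ ^ 2 + 1 with hR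
  have hc : Continuous fun q : HKTSpace H => ((max 0 (R - ((q.1 : ℝ) ^ 2 + ‖q.2‖ ^ 2)) : ℝ) : ℂ) :=
    Complex.continuous_ofReal.comp
      (continuous_const.max (continuous_const.sub (continuous_fst.comp continuous_hktSpace)))
  refine ⟨⟨⟨_, hc⟩, ?_⟩, ?_⟩
  · refine tendsto_const_nhds.congr' ?_
    filter_upwards [(isCompact_hktSpace_le (H := H) R).compl_mem_cocompact] with x hx
    have hx' : ¬ ((x.1 : ℝ) ^ 2 + ‖x.2‖ ^ 2 ≤ R) := hx
    change (0 : ℂ) = ((max 0 (R - ((x.1 : ℝ) ^ 2 + ‖x.2‖ ^ 2)) : ℝ) : ℂ)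
    rw [max_eq_left (by linarith), Complex.ofReal_zero]
  · change ((max 0 (R - ((q.1 : ℝ) ^ 2 + ‖q.2‖ ^ 2)) : ℝ) : ℂ) ≠ 0
    rw [max_eq_right (by rw [hR]; linarith), hR]
    simp

/-- A function `g` that annihilates `a` vanishes wherever `a` does not, hence also annihilates `b`.
Most closure properties of `hktIdeal` reduce to this comparison of zero sets. -/
theorem hktSupport_mono {a b : HKTFun H} (h : ∀ q, a q = 0 → b q = 0) :
    hktSupport b ⊆ hktSupport a := by
  refine Set.compl_subset_compl.2 ?_
  rintro q ⟨g, hg, h'⟩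
  refine ⟨g, hg, fun q' => ?_⟩
  rcases smul_eq_zero.1 (h' q') with h0 | h0
  · rw [h0, zero_smul]
  · rw [h q' h0, smul_zero]

theorem hktSupport_zero [CompleteSpace H] : hktSupport (0 : HKTFun H) = ∅ := by
  rw [hktSupport, Set.compl_empty_iff, Set.eq_univ_iff_forall]
  intro q
  obtain ⟨g, hg⟩ := exists_zeroAtInfty_ne_zero q
  exact ⟨g, hg, fun q' => by simp⟩

/-- If `g` annihilates `a` and `k` annihilates `b`, then `g k` annihilates the sum. -/
theorem hktSupport_add (a b : HKTFun H) : hktSupport (a + b) ⊆ hktSupport a ∪ hktSupport b := by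
  intro q hq
  by_contra hc
  simp only [Set.mem_union, not_or, hktSupport, Set.mem_compl_iff, not_not] at hc
  obtain ⟨⟨g, hg, h1⟩, ⟨k, hk, h2⟩⟩ := hc
  refine hq ⟨g * k, mul_ne_zero hg hk, fun q' => ?_⟩
  rw [BddFun.add_apply, smul_add, ZeroAtInftyContinuousMap.mul_apply, mul_smul (g q') _ (b q'), h2,
    smul_zero, mul_comm, mul_smul, h1, smul_zero, add_zero]

variable {V : Submodule ℝ H} {O : Set (HKTSpace H)}

theorem mem_hktIdeal_of_vanish {a b : HKTFun H} (ha : a ∈ hktIdeal V O) (hb : b ∈ hktAlgebra V)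
    (h : ∀ q, a q = 0 → b q = 0) : b ∈ hktIdeal V O :=
  ⟨hb, (hktSupport_mono h).trans ha.2⟩

theorem zero_mem_hktIdeal [CompleteSpace H] : (0 : HKTFun H) ∈ hktIdeal V O :=
  ⟨zero_mem _, by rw [hktSupport_zero]; exact Set.empty_subset _⟩

theorem add_mem_hktIdeal {a b : HKTFun H} (ha : a ∈ hktIdeal V O) (hb : b ∈ hktIdeal V O) :
    a + b ∈ hktIdeal V O :=
  ⟨add_mem ha.1 hb.1, (hktSupport_add a b).trans (Set.union_subset ha.2 hb.2)⟩

theorem smul_mem_hktIdeal (c : ℂ) {a : HKTFun H} (ha : a ∈ hktIdeal V O) :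
    c • a ∈ hktIdeal V O :=
  mem_hktIdeal_of_vanish ha (SMulMemClass.smul_mem c ha.1) fun q hq => by simp [hq]

theorem mul_mem_hktIdeal {a b : HKTFun H} (ha : a ∈ hktIdeal V O) (hb : b ∈ hktAlgebra V) :
    a * b ∈ hktIdeal V O :=
  mem_hktIdeal_of_vanish ha (mul_mem ha.1 hb) fun q hq => by simp [hq]

theorem star_mem_hktIdeal {a : HKTFun H} (ha : a ∈ hktIdeal V O) : star a ∈ hktIdeal V O :=
  mem_hktIdeal_of_vanish ha (star_mem ha.1) fun q hq => by simp [hq]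

/-- Where `a` vanishes, the quasi-inverse equation reads `z b = 0`. -/
theorem quasiInverse_mem_hktIdeal {a b : HKTFun H} (ha : a ∈ hktIdeal V O)
    (hb : b ∈ hktAlgebra V) {z : ℂ} (hz : z ≠ 0) (h : z • b - z⁻¹ • a - a * b = 0) :
    b ∈ hktIdeal V O := by
  refine mem_hktIdeal_of_vanish ha hb fun q hq => ?_
  have h1 := congrArg (fun g : HKTFun H => g q) h
  simp only [BddFun.sub_apply, BddFun.smul_apply, BddFun.mul_apply, BddFun.zero_apply, hq,
    smul_zero, zero_mul, sub_zero] at h1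
  exact (smul_eq_zero.1 h1).resolve_left hz

end Ideal

/-! ### Gauges and the algebra of good matrix families -/

section Gauge

/-- An `I`-indexed family of `*`-subalgebras of a C*-algebra, with a filtration by `C¹`-bounds that
is compatible with the operations and with quasi-inverses. -/
structure Gauge (I : Type*) (A : Type u) [NonUnitalCStarAlgebra A] where
  Mem : I → ℕ → ℝ → A → Prop
  nonneg : ∀ {i N c a}, Mem i N c a → 0 ≤ c
  mono : ∀ {i N c c' a}, Mem i N c a → c ≤ c' → Mem i N c' a
  lift : ∀ {i N N' c a}, Mem i N c a → N ≤ N' → Mem i N' (6 * c) a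
  zero : ∀ {i N}, Mem i N 0 0
  add : ∀ {i N c c' a b}, Mem i N c a → Mem i N c' b → Mem i N (c + c') (a + b)
  smul : ∀ {i N c a} (r : ℂ), Mem i N c a → Mem i N (‖r‖ * c) (r • a)
  mul : ∀ {i N c c' a b}, Mem i N c a → Mem i N c' b → Mem i N (c * ‖b‖ + ‖a‖ * c') (a * b)
  star : ∀ {i N c a}, Mem i N c a → Mem i N c (star a)
  quasiInverse : ∀ {i N c a m} {z : ℂ}, Mem i N c a → ‖a‖ ≤ m → m < ‖z‖ →
    ∃ b, Mem i N ((‖z‖ - m)⁻¹ * c * (‖z‖ - m)⁻¹) b ∧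
      z • b - z⁻¹ • a - a * b = 0 ∧ z • b - z⁻¹ • a - b * a = 0

/-- Balls of a given radius have uniformly bounded cardinality, over a family of spaces. -/
class UniformGeometry {I : Type*} (Xs : I → Type u) [∀ i, MetricSpace (Xs i)] : Prop where
  exists_ball : ∀ r : ℝ, ∃ L : ℕ, ∀ i (x : Xs i),
    ∃ s : Finset (Xs i), s.card ≤ L ∧ ∀ y, dist x y ≤ r → y ∈ s

variable {I A : Type u} [NonUnitalCStarAlgebra A]

theorem Gauge.mem_zero (Γ : Gauge I A) {i N c} (hc : 0 ≤ c) : Γ.Mem i N c 0 :=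
  Γ.mono Γ.zero hc

theorem Gauge.sum (Γ : Gauge I A) {i N c} {ι : Type*} (s : Finset ι) (g : ι → A)
    (h : ∀ z ∈ s, Γ.Mem i N c (g z)) : Γ.Mem i N (s.card * c) (∑ z ∈ s, g z) := by
  classical
  induction s using Finset.induction_on with
  | empty => simpa using Γ.zero
  | insert a s ha ih =>
    rw [Finset.sum_insert ha, Finset.card_insert_of_notMem ha]
    refine Γ.mono (Γ.add (h a (by simp)) (ih fun z hz => h z (by simp [hz]))) ?_
    push_cast
    linarith

/-- The elements of the `i`-th algebra. -/
def Gauge.sub (Γ : Gauge I A) (i : I) (N : ℕ) : Submodule ℂ A where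
  carrier := {a | ∃ c, Γ.Mem i N c a}
  zero_mem' := ⟨0, Γ.zero⟩
  add_mem' := fun ⟨_, h⟩ ⟨_, h'⟩ => ⟨_, Γ.add h h'⟩
  smul_mem' := fun r _ ⟨_, h⟩ => ⟨_, Γ.smul r h⟩

variable {Xs : I → Type u} [∀ i, MetricSpace (Xs i)]

/-- Families of matrices of finite rank entries, with uniformly bounded propagation, entries and
derivatives. -/
structure IsGood (Γ : Gauge I A) (T : ∀ i, RCMat (Xs i) A) : Prop where
  prop : ∃ S : ℝ, ∀ i x y, (T i).entry x y ≠ 0 → dist x y < S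
  bdd : ∃ M : ℝ, ∀ i x y, ‖(T i).entry x y‖ ≤ M
  mem : ∃ (N : ℕ) (c : ℝ), 0 ≤ c ∧ ∀ i x y, Γ.Mem i N c ((T i).entry x y)
  fin : ∀ i, ∃ U : Submodule ℂ A, U.FG ∧ ∀ x y, (T i).entry x y ∈ U

namespace IsGood

variable {Γ : Gauge I A} {S T : ∀ i, RCMat (Xs i) A}

theorem exists_prop (h : IsGood Γ T) :
    ∃ S : ℝ, 0 < S ∧ ∀ i x y, (T i).entry x y ≠ 0 → dist x y < S := by
  obtain ⟨S, hS⟩ := h.prop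
  exact ⟨max S 1, by positivity, fun i x y hxy => (hS i x y hxy).trans_le (le_max_left _ _)⟩

theorem exists_bdd (h : IsGood Γ T) :
    ∃ M : ℝ, 0 < M ∧ ∀ i x y, ‖(T i).entry x y‖ ≤ M := by
  obtain ⟨S, hS⟩ := h.bdd
  exact ⟨max S 1, by positivity, fun i x y => (hS i x y).trans (le_max_left _ _)⟩

theorem exists_common (h : IsGood Γ S) (h' : IsGood Γ T) :
    ∃ (N : ℕ) (c : ℝ), 0 ≤ c ∧ (∀ i x y, Γ.Mem i N c ((S i).entry x y)) ∧
      ∀ i x y, Γ.Mem i N c ((T i).entry x y) := by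
  obtain ⟨N, c, hc, h1⟩ := h.mem
  obtain ⟨N', c', hc', h2⟩ := h'.mem
  refine ⟨max N N', max (6 * c) (6 * c'), by positivity,
    fun i x y => Γ.mono (Γ.lift (h1 i x y) (le_max_left _ _)) (le_max_left _ _),
    fun i x y => Γ.mono (Γ.lift (h2 i x y) (le_max_right _ _)) (le_max_right _ _)⟩

theorem zero : IsGood Γ (0 : ∀ i, RCMat (Xs i) A) where
  prop := ⟨0, fun i x y h => absurd (RCMat.zero_apply x y) h⟩
  bdd := ⟨0, fun i x y => by
    change ‖(0 : RCMat (Xs i) A).entry x y‖ ≤ 0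
    rw [RCMat.zero_apply, norm_zero]⟩
  mem := ⟨0, 0, le_rfl, fun i x y => Γ.zero⟩
  fin := fun i => ⟨⊥, Submodule.fg_bot, fun x y => rfl⟩

theorem add (h : IsGood Γ S) (h' : IsGood Γ T) : IsGood Γ (S + T) where
  prop := by
    obtain ⟨s, hs⟩ := h.prop
    obtain ⟨t, ht⟩ := h'.prop
    refine ⟨max s t, fun i x y hxy => ?_⟩
    by_contra hc
    have hc' := not_lt.1 hc
    refine hxy ?_
    have e1 : (S i).entry x y = 0 := by
      by_contra h0
      exact hc ((hs i x y h0).trans_le (le_max_left _ _))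
    have e2 : (T i).entry x y = 0 := by
      by_contra h0
      exact hc ((ht i x y h0).trans_le (le_max_right _ _))
    change (S i).entry x y + (T i).entry x y = 0
    rw [e1, e2, add_zero]
  bdd := by
    obtain ⟨s, hs⟩ := h.bdd
    obtain ⟨t, ht⟩ := h'.bdd
    exact ⟨s + t, fun i x y => (norm_add_le _ _).trans (add_le_add (hs i x y) (ht i x y))⟩
  mem := by
    obtain ⟨N, c, hc, h1, h2⟩ := h.exists_common h'
    exact ⟨N, c + c, by positivity, fun i x y => Γ.add (h1 i x y) (h2 i x y)⟩
  fin := fun i => by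
    obtain ⟨U, hU, h1⟩ := h.fin i
    obtain ⟨U', hU', h2⟩ := h'.fin i
    exact ⟨U ⊔ U', hU.sup hU', fun x y => Submodule.add_mem _
      (Submodule.mem_sup_left (h1 x y)) (Submodule.mem_sup_right (h2 x y))⟩

theorem star (h : IsGood Γ T) : IsGood Γ (Star.star T) where
  prop := by
    obtain ⟨s, hs⟩ := h.prop
    refine ⟨s, fun i x y hxy => ?_⟩
    rw [dist_comm]
    exact hs i y x fun h0 => hxy (by
      change Star.star ((T i).entry y x) = 0
      rw [h0, star_zero])
  bdd := by
    obtain ⟨s, hs⟩ := h.bdd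
    exact ⟨s, fun i x y => (norm_star _).trans_le (hs i y x)⟩
  mem := by
    obtain ⟨N, c, hc, h1⟩ := h.mem
    exact ⟨N, c, hc, fun i x y => Γ.star (h1 i y x)⟩
  fin := fun i => by
    classical
    obtain ⟨U, ⟨s, rfl⟩, h1⟩ := h.fin i
    refine ⟨Submodule.span ℂ (s.image Star.star : Finset A), ⟨_, rfl⟩, fun x y => ?_⟩
    have : ∀ a ∈ Submodule.span ℂ (s : Set A),
        Star.star a ∈ Submodule.span ℂ ((s.image Star.star : Finset A) : Set A) := by
      intro a ha
      induction ha using Submodule.span_induction with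
      | mem a ha => exact Submodule.subset_span (Finset.mem_coe.2 (Finset.mem_image_of_mem _ ha))
      | zero => rw [star_zero]; exact zero_mem _
      | add a b _ _ ha hb => rw [star_add]; exact add_mem ha hb
      | smul r a _ ha => rw [star_smul]; exact Submodule.smul_mem _ _ ha
    exact this _ (h1 y x)

/-- Each entry of the product is a sum of at most `L` terms, with `L` a ball cardinality uniform in
`i`. So the bounds on norms and derivatives stay uniform. -/
theorem mul [UniformGeometry Xs] (h : IsGood Γ S) (h' : IsGood Γ T) : IsGood Γ (S * T) := by
  obtain ⟨s, hs⟩ := h.prop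
  obtain ⟨t, ht⟩ := h'.prop
  obtain ⟨M, hM, hSM⟩ := h.exists_bdd
  obtain ⟨M', hM', hTM⟩ := h'.exists_bdd
  obtain ⟨L, hL⟩ := UniformGeometry.exists_ball (Xs := Xs) s
  have key : ∀ i x y, ∃ F : Finset (Xs i), F.card ≤ L ∧
      ((S * T) i).entry x y = ∑ z ∈ F, (S i).entry x z * (T i).entry z y := fun i x y => by
    obtain ⟨F, hF, hF'⟩ := hL i x
    exact ⟨F, hF, RCMat.mul_eq_sum _ _ _ _ _ fun z hz => hF' z (hs i x z hz).le⟩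
  refine ⟨⟨s + t, fun i x y hxy => ?_⟩, ⟨L * (M * M'), fun i x y => ?_⟩, ?_, fun i => ?_⟩
  · obtain ⟨F, -, hF⟩ := key i x y
    obtain ⟨z, -, hz⟩ := Finset.exists_ne_zero_of_sum_ne_zero (hF ▸ hxy)
    exact (dist_triangle _ z _).trans_lt (add_lt_add (hs i x z fun h0 => hz (by rw [h0, zero_mul]))
      (ht i z y fun h0 => hz (by rw [h0, mul_zero])))
  · obtain ⟨F, hFL, hF⟩ := key i x y
    rw [hF]
    calc _ ≤ ∑ z ∈ F, ‖(S i).entry x z * (T i).entry z y‖ := norm_sum_le _ _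
      _ ≤ ∑ z ∈ F, M * M' := Finset.sum_le_sum fun z _ =>
          (norm_mul_le _ _).trans (mul_le_mul (hSM i x z) (hTM i z y) (norm_nonneg _) hM.le)
      _ = F.card * (M * M') := by simp
      _ ≤ L * (M * M') := by gcongr
  · obtain ⟨N, c, hc, h1, h2⟩ := h.exists_common h'
    refine ⟨N, L * (c * M' + M * c), by positivity, fun i x y => ?_⟩
    obtain ⟨F, hFL, hF⟩ := key i x y
    rw [hF]
    refine Γ.mono (Γ.sum (c := c * M' + M * c) F _ fun z _ =>
      Γ.mono (Γ.mul (h1 i x z) (h2 i z y)) ?_) (by gcongr)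
    exact add_le_add (mul_le_mul_of_nonneg_left (hTM i z y) hc)
      (mul_le_mul_of_nonneg_right (hSM i x z) hc)
  · obtain ⟨U, hU, h1⟩ := h.fin i
    obtain ⟨U', hU', h2⟩ := h'.fin i
    refine ⟨Submodule.map₂ (LinearMap.mul ℂ A) U U', hU.map₂ _ hU', fun x y => ?_⟩
    obtain ⟨F, -, hF⟩ := key i x y
    rw [hF]
    exact Submodule.sum_mem _ fun z _ => Submodule.apply_mem_map₂ _ (h1 x z) (h2 z y)

end IsGood

/-- Entrywise multiplication by a scalar kernel. -/
def schur (k : ∀ i, Xs i → Xs i → ℂ) (T : ∀ i, RCMat (Xs i) A) : ∀ i, RCMat (Xs i) A :=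
  fun i => ⟨fun x y => k i x y • (T i).entry x y,
    fun x => ((T i).finite_row x).subset fun y hy h => hy (by simp only [h, smul_zero]),
    fun y => ((T i).finite_col y).subset fun x hx h => hx (by simp only [h, smul_zero])⟩

theorem schur_entry (k : ∀ i, Xs i → Xs i → ℂ) (T : ∀ i, RCMat (Xs i) A) (i x y) :
    (schur k T i).entry x y = k i x y • (T i).entry x y := rfl

theorem IsGood.schur {Γ : Gauge I A} {T : ∀ i, RCMat (Xs i) A} (h : IsGood Γ T)
    {k : ∀ i, Xs i → Xs i → ℂ} {C : ℝ} (hk : ∀ i x y, ‖k i x y‖ ≤ C) :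
    IsGood Γ (schur k T) where
  prop := by
    obtain ⟨s, hs⟩ := h.prop
    exact ⟨s, fun i x y hxy => hs i x y fun h0 => hxy (by rw [schur_entry, h0, smul_zero])⟩
  bdd := by
    obtain ⟨s, hs0, hs⟩ := h.exists_bdd
    refine ⟨C * s, fun i x y => ?_⟩
    rw [schur_entry, norm_smul]
    exact mul_le_mul (hk i x y) (hs i x y) (norm_nonneg _) ((norm_nonneg _).trans (hk i x y))
  mem := by
    obtain ⟨N, c, hc, h1⟩ := h.mem
    refine ⟨N, max C 0 * c, by positivity, fun i x y => Γ.mono (Γ.smul _ (h1 i x y)) ?_⟩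
    exact mul_le_mul_of_nonneg_right ((hk i x y).trans (le_max_left _ _)) hc
  fin := fun i => by
    obtain ⟨U, hU, h1⟩ := h.fin i
    exact ⟨U, hU, fun x y => U.smul_mem _ (h1 x y)⟩

theorem smul_eq_schur (r : ℂ) (T : ∀ i, RCMat (Xs i) A) : r • T = schur (fun _ _ _ => r) T := rfl

/-- The `*`-algebra of good families. -/
def goodAlgebra (Γ : Gauge I A) (Xs : I → Type u) [∀ i, MetricSpace (Xs i)] [UniformGeometry Xs] :
    NonUnitalStarSubalgebra ℂ (∀ i, RCMat (Xs i) A) where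
  carrier := {T | IsGood Γ T}
  zero_mem' := IsGood.zero
  add_mem' := IsGood.add
  mul_mem' := IsGood.mul
  star_mem' := IsGood.star
  smul_mem' := fun r T h => by
    rw [smul_eq_schur]
    exact IsGood.schur h (C := ‖r‖) fun _ _ _ => le_rfl

theorem mem_goodAlgebra {Γ : Gauge I A} [UniformGeometry Xs] {T : ∀ i, RCMat (Xs i) A} :
    T ∈ goodAlgebra Γ Xs ↔ IsGood Γ T := Iff.rfl

open Classical in
/-- Diagonal matrices. -/
def diagMat (d : ∀ i, Xs i → A) : ∀ i, RCMat (Xs i) A :=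
  fun i => ⟨fun x y => if x = y then d i x else 0,
    fun x => (Set.finite_singleton x).subset fun y hy => by
      by_contra h
      exact hy (if_neg fun h' => h h'.symm),
    fun y => (Set.finite_singleton y).subset fun x hx => by
      by_contra h
      exact hx (if_neg h)⟩

theorem diagMat_same (d : ∀ i, Xs i → A) (i x) : (diagMat d i).entry x x = d i x := if_pos rfl

theorem diagMat_ne (d : ∀ i, Xs i → A) {i} {x y : Xs i} (h : x ≠ y) :
    (diagMat d i).entry x y = 0 := if_neg h

theorem diagMat_mul (d : ∀ i, Xs i → A) (T : ∀ i, RCMat (Xs i) A) (i x y) :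
    ((diagMat d * T) i).entry x y = d i x * (T i).entry x y := by
  change (diagMat d i * T i).entry x y = _
  rw [RCMat.mul_eq_sum (diagMat d i) (T i) x y {x} fun z hz => ?_, Finset.sum_singleton,
    diagMat_same]
  by_contra h
  exact hz (diagMat_ne d fun h' => h (by simp [h']))

theorem diagMat_mul_diagMat (d e : ∀ i, Xs i → A) : diagMat d * diagMat e = diagMat (d * e) := by
  funext i
  ext x y
  rw [diagMat_mul]
  by_cases h : x = y
  · subst h
    rw [diagMat_same, diagMat_same]
    rfl
  · rw [diagMat_ne _ h, diagMat_ne _ h, mul_zero]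

theorem diagMat_add (d e : ∀ i, Xs i → A) : diagMat (d + e) = diagMat d + diagMat e := by
  funext i
  ext x y
  change _ = (diagMat d i).entry x y + (diagMat e i).entry x y
  by_cases h : x = y
  · subst h
    rw [diagMat_same, diagMat_same, diagMat_same]
    rfl
  · rw [diagMat_ne _ h, diagMat_ne _ h, diagMat_ne _ h, add_zero]

theorem diagMat_smul (r : ℂ) (d : ∀ i, Xs i → A) : diagMat (r • d) = r • diagMat d := by
  funext i
  ext x y
  change _ = r • (diagMat d i).entry x y
  by_cases h : x = y
  · subst h
    rw [diagMat_same, diagMat_same]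
    rfl
  · rw [diagMat_ne _ h, diagMat_ne _ h, smul_zero]

theorem star_diagMat (d : ∀ i, Xs i → A) : star (diagMat d) = diagMat (star d) := by
  funext i
  ext x y
  change star ((diagMat d i).entry y x) = _
  by_cases h : x = y
  · subst h
    rw [diagMat_same, diagMat_same]
    rfl
  · rw [diagMat_ne _ h, diagMat_ne _ (Ne.symm h), star_zero]

theorem isGood_diagMat {Γ : Gauge I A} {d : ∀ i, Xs i → A} {N : ℕ} {c M : ℝ} (hc : 0 ≤ c)
    (hM : ∀ i x, ‖d i x‖ ≤ M) (hd : ∀ i x, Γ.Mem i N c (d i x))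
    (hfin : ∀ i, ∃ U : Submodule ℂ A, U.FG ∧ ∀ x, d i x ∈ U) : IsGood Γ (diagMat d) where
  prop := ⟨1, fun i x y h => by
    by_cases hxy : x = y
    · rw [hxy, dist_self]
      exact one_pos
    · exact absurd (diagMat_ne d hxy) h⟩
  bdd := ⟨M, fun i x y => by
    by_cases hxy : x = y
    · rw [hxy, diagMat_same]
      exact hM i y
    · rw [diagMat_ne d hxy, norm_zero]
      exact (norm_nonneg _).trans (hM i x)⟩
  mem := ⟨N, c, hc, fun i x y => by
    by_cases hxy : x = y
    · rw [hxy, diagMat_same]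
      exact hd i y
    · rw [diagMat_ne d hxy]
      exact Γ.mem_zero hc⟩
  fin := fun i => by
    obtain ⟨U, hU, h⟩ := hfin i
    refine ⟨U, hU, fun x y => ?_⟩
    by_cases hxy : x = y
    · rw [hxy, diagMat_same]
      exact h y
    · rw [diagMat_ne d hxy]
      exact zero_mem _

/-- Multiplication of the rows by scalars. -/
def rowMul (φ : ∀ i, Xs i → ℂ) (T : ∀ i, RCMat (Xs i) A) : ∀ i, RCMat (Xs i) A :=
  schur (fun i x _ => φ i x) T

theorem rowMul_entry (φ : ∀ i, Xs i → ℂ) (T : ∀ i, RCMat (Xs i) A) (i x y) :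
    (rowMul φ T i).entry x y = φ i x • (T i).entry x y := rfl

/-- Scalar row multiplications are in general not elements of the algebra. This adjoint relation
lets them act as multipliers inside a representation. -/
theorem star_mul_rowMul (φ : ∀ i, Xs i → ℂ) (S T : ∀ i, RCMat (Xs i) A) :
    star S * rowMul φ T = star (rowMul (star φ) S) * T := by
  funext i
  ext x y
  have h : ∀ z, (T i).entry z y ≠ 0 → z ∈ ((T i).finite_col y).toFinset :=
    fun z hz => by simpa using hz
  have h2 : ∀ z, (rowMul φ T i).entry z y ≠ 0 → z ∈ ((T i).finite_col y).toFinset :=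
    fun z hz => h z fun h => hz (by rw [rowMul_entry, h, smul_zero])
  change (star (S i) * rowMul φ T i).entry x y = (star (rowMul (star φ) S i) * T i).entry x y
  rw [RCMat.mul_eq_sum' _ _ x y _ h2, RCMat.mul_eq_sum' _ _ x y _ h]
  refine Finset.sum_congr rfl fun z _ => ?_
  change star ((S i).entry z x) * (φ i z • (T i).entry z y) =
    star (star (φ i z) • (S i).entry z x) * (T i).entry z y
  rw [star_smul, star_star, smul_mul_assoc, mul_smul_comm]

theorem rowMul_rowMul (φ ψ : ∀ i, Xs i → ℂ) (T : ∀ i, RCMat (Xs i) A) :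
    rowMul φ (rowMul ψ T) = rowMul (φ * ψ) T := by
  funext i
  ext x y
  exact smul_smul _ _ _

theorem IsGood.rowMul {Γ : Gauge I A} {T : ∀ i, RCMat (Xs i) A} (h : IsGood Γ T)
    {φ : ∀ i, Xs i → ℂ} {C : ℝ} (hφ : ∀ i x, ‖φ i x‖ ≤ C) : IsGood Γ (rowMul φ T) :=
  h.schur fun i x _ => hφ i x

end Gauge

/-! ### Representations and scalar row multipliers -/

section Representation

variable {I A : Type u} [NonUnitalCStarAlgebra A] {Xs : I → Type u} [∀ i, MetricSpace (Xs i)]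
  [UniformGeometry Xs] {Γ : Gauge I A}
  {K : Type v} [NormedAddCommGroup K] [InnerProductSpace ℂ K] [CompleteSpace K]

theorem sum_entry {ι : Type*} (s : Finset ι) (T : ι → ∀ i, RCMat (Xs i) A) (i x y) :
    ((∑ j ∈ s, T j) i).entry x y = ∑ j ∈ s, (T j i).entry x y := by
  classical
  induction s using Finset.induction_on with
  | empty => rfl
  | insert a s ha ih =>
    rw [Finset.sum_insert ha, Finset.sum_insert ha, ← ih]
    rfl

theorem IsGood.sum {ι : Type*} (s : Finset ι) {T : ι → ∀ i, RCMat (Xs i) A}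
    (h : ∀ j ∈ s, IsGood Γ (T j)) : IsGood Γ (∑ j ∈ s, T j) :=
  sum_mem (S := goodAlgebra Γ Xs) h

theorem IsGood.smul {T : ∀ i, RCMat (Xs i) A} (h : IsGood Γ T) (r : ℂ) : IsGood Γ (r • T) :=
  (goodAlgebra Γ Xs).smul_mem' r h

theorem IsGood.sub {S T : ∀ i, RCMat (Xs i) A} (h : IsGood Γ S) (h' : IsGood Γ T) :
    IsGood Γ (S - T) :=
  sub_mem (show S ∈ goodAlgebra Γ Xs from h) h'

open Classical in
/-- A representation of the algebra of good families, extended by zero. -/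
def rep (π : goodAlgebra Γ Xs →⋆ₙₐ[ℂ] (K →L[ℂ] K)) (T : ∀ i, RCMat (Xs i) A) : K →L[ℂ] K :=
  if h : IsGood Γ T then π ⟨T, h⟩ else 0

variable (π : goodAlgebra Γ Xs →⋆ₙₐ[ℂ] (K →L[ℂ] K)) {S T R : ∀ i, RCMat (Xs i) A}

theorem rep_of (h : IsGood Γ T) : rep π T = π ⟨T, h⟩ := dif_pos h

theorem rep_add (hS : IsGood Γ S) (hT : IsGood Γ T) : rep π (S + T) = rep π S + rep π T := by
  rw [rep_of π hS, rep_of π hT, rep_of π (hS.add hT), ← map_add]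
  rfl

theorem rep_sub (hS : IsGood Γ S) (hT : IsGood Γ T) : rep π (S - T) = rep π S - rep π T := by
  rw [rep_of π hS, rep_of π hT, rep_of π (hS.sub hT), ← map_sub]
  rfl

theorem rep_mul (hS : IsGood Γ S) (hT : IsGood Γ T) : rep π (S * T) = rep π S * rep π T := by
  rw [rep_of π hS, rep_of π hT, rep_of π (hS.mul hT), ← map_mul]
  rfl

theorem rep_smul (hT : IsGood Γ T) (r : ℂ) : rep π (r • T) = r • rep π T := by
  rw [rep_of π hT, rep_of π (hT.smul r), ← map_smul]
  rfl

theorem rep_star (hT : IsGood Γ T) : rep π (star T) = star (rep π T) := by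
  rw [rep_of π hT, rep_of π hT.star, ← map_star]
  rfl

theorem rep_sum {ι : Type*} (s : Finset ι) {T : ι → ∀ i, RCMat (Xs i) A}
    (h : ∀ j ∈ s, IsGood Γ (T j)) : rep π (∑ j ∈ s, T j) = ∑ j ∈ s, rep π (T j) := by
  classical
  induction s using Finset.induction_on with
  | empty =>
    rw [Finset.sum_empty, Finset.sum_empty, rep_of π IsGood.zero]
    exact map_zero π
  | insert a s ha ih =>
    rw [Finset.sum_insert ha, Finset.sum_insert ha, rep_add π (h a (by simp))
      (IsGood.sum s fun j hj => h j (by simp [hj])), ih fun j hj => h j (by simp [hj])]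

theorem norm_rep_sq (hT : IsGood Γ T) : ‖rep π (star T * T)‖ = ‖rep π T‖ ^ 2 := by
  rw [rep_mul π hT.star hT, rep_star π hT, CStarRing.norm_star_mul_self, sq]

theorem inner_rep (hS : IsGood Γ S) (hT : IsGood Γ T) (v w : K) :
    inner ℂ (rep π (star S * T) v) w = inner ℂ (rep π T v) (rep π S w) := by
  rw [rep_mul π hS.star hT, rep_star π hS, ContinuousLinearMap.star_eq_adjoint]
  rw [_root_.mul_apply_eq_comp, ContinuousLinearMap.adjoint_inner_left]

theorem norm_rep_apply_sq (hT : IsGood Γ T) (v : K) :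
    ((‖rep π T v‖ ^ 2 : ℝ) : ℂ) = inner ℂ (rep π (star T * T) v) v := by
  rw [inner_rep π hT hT, inner_self_eq_norm_sq_to_K]
  norm_cast

theorem star_rowMul_mul_rowMul (φ : ∀ i, Xs i → ℂ) (R : ∀ i, RCMat (Xs i) A) :
    star (rowMul φ R) * rowMul φ R = star R * rowMul (star φ * φ) R := by
  rw [← rowMul_rowMul, star_mul_rowMul (star φ), star_star]

/-- The squared norms are `⟨π(R* |φⱼ|² R) v, v⟩`, and `∑ⱼ |φⱼ|² = 1` makes the matrices `R* |φⱼ|² R`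
add up to `R* R`. -/
theorem sum_norm_rep_rowMul {J : Type*} [Fintype J] (φ : J → ∀ i, Xs i → ℂ)
    (hφ : ∀ i x, ∑ j, ‖φ j i x‖ ^ 2 = 1) (hR : IsGood Γ R) (v : K) :
    ∑ j, ‖rep π (rowMul (φ j) R) v‖ ^ 2 = ‖rep π R v‖ ^ 2 := by
  have h1 : ∀ j i x, ‖φ j i x‖ ≤ 1 := by
    intro j i x
    have := Finset.single_le_sum (f := fun j => ‖φ j i x‖ ^ 2) (fun j _ => sq_nonneg _)
      (Finset.mem_univ j)
    rw [hφ] at this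
    nlinarith [norm_nonneg (φ j i x)]
  have hg : ∀ j, IsGood Γ (rowMul (φ j) R) := fun j => hR.rowMul (h1 j)
  have h2 : ∀ j i x, ‖(star (φ j) * φ j) i x‖ ≤ 1 := by
    intro j i x
    change ‖star (φ j i x) * φ j i x‖ ≤ 1
    rw [norm_mul, norm_star]
    exact mul_le_one₀ (h1 j i x) (norm_nonneg _) (h1 j i x)
  have hg2 : ∀ j, IsGood Γ (rowMul (star (φ j) * φ j) R) := fun j => hR.rowMul (h2 j)
  have hsum : ∑ j, star R * rowMul (star (φ j) * φ j) R = star R * R := by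
    rw [← Finset.mul_sum]
    congr 1
    funext i
    ext x y
    rw [sum_entry]
    simp only [rowMul_entry]
    rw [← Finset.sum_smul]
    have : ∑ j, (star (φ j) * φ j) i x = 1 := by
      have h3 : ∀ j, (star (φ j) * φ j) i x = ((‖φ j i x‖ ^ 2 : ℝ) : ℂ) := fun j => by
        change star (φ j i x) * φ j i x = _
        rw [Complex.star_def, Complex.conj_mul']
        norm_cast
      simp only [h3]
      rw [← Complex.ofReal_sum, hφ, Complex.ofReal_one]
    rw [this, one_smul]
  have : ((∑ j, ‖rep π (rowMul (φ j) R) v‖ ^ 2 : ℝ) : ℂ) = ((‖rep π R v‖ ^ 2 : ℝ) : ℂ) := by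
    rw [Complex.ofReal_sum]
    simp only [norm_rep_apply_sq π (hg _), norm_rep_apply_sq π hR, star_rowMul_mul_rowMul]
    rw [← hsum, rep_sum π _ fun j _ => hR.star.mul (hg2 j), _root_.sum_apply,
      sum_inner]
  exact_mod_cast this

/-- Complete `φ` by `√(1 - |φ|²)` to a partition of unity with two members, and drop the second
summand. -/
theorem norm_rep_rowMul_le_of_le_one {φ : ∀ i, Xs i → ℂ} (hφ : ∀ i x, ‖φ i x‖ ≤ 1)
    (hR : IsGood Γ R) : ‖rep π (rowMul φ R)‖ ≤ ‖rep π R‖ := by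
  refine ContinuousLinearMap.opNorm_le_bound _ (norm_nonneg _) fun v => ?_
  refine le_trans ?_ ((rep π R).le_opNorm v)
  let ψ : Bool → ∀ i, Xs i → ℂ := fun b i x =>
    if b then φ i x else ((√(1 - ‖φ i x‖ ^ 2) : ℝ) : ℂ)
  have h := sum_norm_rep_rowMul π ψ (fun i x => ?_) hR v
  · rw [Fintype.sum_bool] at h
    have h2 : ψ true = φ := rfl
    rw [h2] at h
    exact le_of_sq_le_sq (by nlinarith [sq_nonneg ‖rep π (rowMul (ψ false) R) v‖]) (norm_nonneg _)
  · have h0 : 0 ≤ 1 - ‖φ i x‖ ^ 2 := by nlinarith [hφ i x, norm_nonneg (φ i x)]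
    rw [Fintype.sum_bool]
    change ‖φ i x‖ ^ 2 + ‖((√(1 - ‖φ i x‖ ^ 2) : ℝ) : ℂ)‖ ^ 2 = 1
    rw [Complex.norm_real, Real.norm_of_nonneg (Real.sqrt_nonneg _), Real.sq_sqrt h0]
    ring

theorem norm_rep_rowMul_le {φ : ∀ i, Xs i → ℂ} {C : ℝ} (hC : 0 < C) (hφ : ∀ i x, ‖φ i x‖ ≤ C)
    (hR : IsGood Γ R) : ‖rep π (rowMul φ R)‖ ≤ C * ‖rep π R‖ := by
  have h1 : ∀ i x, ‖((C : ℂ)⁻¹ • φ) i x‖ ≤ 1 := by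
    intro i x
    change ‖(C : ℂ)⁻¹ * φ i x‖ ≤ 1
    rw [norm_mul, norm_inv, Complex.norm_real, Real.norm_of_nonneg hC.le, inv_mul_le_one₀ hC]
    exact hφ i x
  have h2 : rowMul φ R = (C : ℂ) • rowMul ((C : ℂ)⁻¹ • φ) R := by
    funext i
    ext x y
    change φ i x • (R i).entry x y = (C : ℂ) • (((C : ℂ)⁻¹ * φ i x) • (R i).entry x y)
    rw [smul_smul, mul_inv_cancel_left₀ (by exact_mod_cast hC.ne')]
  rw [h2, rep_smul π (hR.rowMul h1), norm_smul, Complex.norm_real, Real.norm_of_nonneg hC.le]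
  exact mul_le_mul_of_nonneg_left (norm_rep_rowMul_le_of_le_one π h1 hR) hC.le

end Representation

/-! ### Diagonal matrices with finitely many values for each index -/

section Diagonal

variable {I A : Type u} [NonUnitalCStarAlgebra A] {Xs : I → Type u} [∀ i, MetricSpace (Xs i)]
  [UniformGeometry Xs] {Γ : Gauge I A}
  {K : Type v} [NormedAddCommGroup K] [InnerProductSpace ℂ K] [CompleteSpace K]
  (π : goodAlgebra Γ Xs →⋆ₙₐ[ℂ] (K →L[ℂ] K))

/-- If `e` is a quasi-inverse then `z⁻¹ + e` inverts `z - a`, so the spectrum lies in the disc of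
radius `m`. For a self-adjoint element the spectral radius is the norm. -/
theorem norm_le_of_quasiInverse {B : Type*} [CStarAlgebra B] {a : B} (ha : IsSelfAdjoint a) {m : ℝ}
    (hm : 0 ≤ m) (h : ∀ z : ℂ, m < ‖z‖ → ∃ e : B, z • e - z⁻¹ • a - a * e = 0 ∧
      z • e - z⁻¹ • a - e * a = 0) : ‖a‖ ≤ m := by
  have h1 : spectralRadius ℂ a ≤ ENNReal.ofReal m := by
    refine iSup₂_le fun z hz => ?_
    by_contra hc
    have hz' : m < ‖z‖ := by
      rw [not_le, ← ENNReal.ofReal_coe_nnreal, ENNReal.ofReal_lt_ofReal_iff_of_nonneg hm] at hc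
      exact hc
    have hz0 : z ≠ 0 := fun h0 => by
      rw [h0, norm_zero] at hz'
      linarith
    obtain ⟨e, h1, h2⟩ := h z hz'
    refine hz ⟨⟨z • 1 - a, z⁻¹ • 1 + e, ?_, ?_⟩, ?_⟩
    · have : (z • (1 : B) - a) * (z⁻¹ • 1 + e) = 1 + (z • e - z⁻¹ • a - a * e) := by
        simp only [sub_mul, mul_add, smul_sub, smul_mul_assoc, mul_smul_comm, one_mul, mul_one, smul_smul,
          one_smul, inv_mul_cancel₀ hz0]
        abel
      rw [this, h1, add_zero]
    · have : (z⁻¹ • 1 + e) * (z • (1 : B) - a) = 1 + (z • e - z⁻¹ • a - e * a) := by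
        simp only [mul_sub, add_mul, smul_add, smul_mul_assoc, mul_smul_comm, one_mul, mul_one, smul_smul,
          mul_inv_cancel₀ hz0, one_smul]
        abel
      rw [this, h2, add_zero]
    · rw [Algebra.algebraMap_eq_smul_one]
  rw [ha.spectralRadius_eq_nnnorm, ← ENNReal.ofReal_coe_nnreal,
    ENNReal.ofReal_le_ofReal_iff hm] at h1
  exact h1

theorem fg_of_finite_range {Z : Type*} {d : Z → A} (h : (Set.range d).Finite) :
    ∃ U : Submodule ℂ A, U.FG ∧ ∀ x, d x ∈ U :=
  ⟨Submodule.span ℂ (Set.range d), Submodule.fg_span h, fun x => Submodule.subset_span ⟨x, rfl⟩⟩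

/-- Quasi-inverses taken entrywise form a good family: their `C¹`-bound depends only on `c`, `m` and
`‖z‖`, and finite range keeps the entries for each `i` in a finite-dimensional space. So the
resolvent exists inside the algebra before `π` is applied. -/
theorem norm_rep_diagMat_le_of_selfAdjoint {d : ∀ i, Xs i → A} {N : ℕ} {c m : ℝ} (hc : 0 ≤ c)
    (hm0 : 0 ≤ m) (hm : ∀ i x, ‖d i x‖ ≤ m) (hd : ∀ i x, Γ.Mem i N c (d i x))
    (hfin : ∀ i, (Set.range (d i)).Finite) (hs : star d = d) :
    ‖rep π (diagMat d)‖ ≤ m := by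
  have hg : IsGood Γ (diagMat d) := isGood_diagMat hc hm hd fun i => fg_of_finite_range (hfin i)
  refine norm_le_of_quasiInverse ?_ hm0 fun z hz => ?_
  · rw [IsSelfAdjoint, ← rep_star π hg, star_diagMat, hs]
  have hz0 : 0 < ‖z‖ - m := by linarith
  -- The quasi-inverse is chosen as a function of the value `a`, not of the point, so that the new
  -- diagonal again has finite range.
  have key : ∀ i (a : A), ∃ b : A, a ∈ Set.range (d i) →
      Γ.Mem i N ((‖z‖ - m)⁻¹ * c * (‖z‖ - m)⁻¹) b ∧
      z • b - z⁻¹ • a - a * b = 0 ∧ z • b - z⁻¹ • a - b * a = 0 := by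
    intro i a
    by_cases ha : a ∈ Set.range (d i)
    · obtain ⟨x, rfl⟩ := ha
      obtain ⟨b, hb⟩ := Γ.quasiInverse (hd i x) (hm i x) hz
      exact ⟨b, fun _ => hb⟩
    · exact ⟨0, fun h => absurd h ha⟩
  choose b hb using key
  set e : ∀ i, Xs i → A := fun i x => b i (d i x) with he
  have hb' : ∀ i x, Γ.Mem i N ((‖z‖ - m)⁻¹ * c * (‖z‖ - m)⁻¹) (e i x) ∧
      z • e i x - z⁻¹ • d i x - d i x * e i x = 0 ∧
      z • e i x - z⁻¹ • d i x - e i x * d i x = 0 := fun i x => hb i _ ⟨x, rfl⟩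
  have hen : ∀ i x, ‖e i x‖ ≤ (‖z‖ - m)⁻¹ * (‖z‖⁻¹ * m) := by
    intro i x
    obtain ⟨-, h1, -⟩ := hb' i x
    rw [inv_mul_eq_div, le_div_iff₀ hz0]
    have h2 : z • e i x = z⁻¹ • d i x + d i x * e i x := by
      rw [sub_sub, sub_eq_zero] at h1
      exact h1
    have h3 := congrArg norm h2
    rw [norm_smul] at h3
    have h4 : ‖z⁻¹ • d i x‖ ≤ ‖z‖⁻¹ * m := by
      rw [norm_smul, norm_inv]
      exact mul_le_mul_of_nonneg_left (hm i x) (by positivity)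
    have h5 : ‖d i x * e i x‖ ≤ m * ‖e i x‖ :=
      (norm_mul_le _ _).trans (mul_le_mul_of_nonneg_right (hm i x) (norm_nonneg _))
    have h6 := norm_add_le (z⁻¹ • d i x) (d i x * e i x)
    nlinarith
  have hge : IsGood Γ (diagMat e) := isGood_diagMat (by positivity) hen (fun i x => (hb' i x).1)
    fun i => fg_of_finite_range (((hfin i).image (b i)).subset (by
      rintro _ ⟨x, rfl⟩
      exact ⟨d i x, ⟨x, rfl⟩, rfl⟩))
  refine ⟨rep π (diagMat e), ?_, ?_⟩
  · have : z • diagMat e - z⁻¹ • diagMat d - diagMat d * diagMat e = 0 := by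
      rw [diagMat_mul_diagMat, ← diagMat_smul, ← diagMat_smul, sub_sub, ← diagMat_add, sub_eq_zero]
      congr 1
      funext i x
      have := (hb' i x).2.1
      rw [sub_sub, sub_eq_zero] at this
      exact this
    rw [← rep_smul π hge, ← rep_smul π hg, ← rep_mul π hg hge, ← rep_sub π (hge.smul z) (hg.smul _),
      ← rep_sub π ((hge.smul z).sub (hg.smul _)) (hg.mul hge), this, rep_of π IsGood.zero]
    exact map_zero π
  · have : z • diagMat e - z⁻¹ • diagMat d - diagMat e * diagMat d = 0 := by
      rw [diagMat_mul_diagMat, ← diagMat_smul, ← diagMat_smul, sub_sub, ← diagMat_add, sub_eq_zero]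
      congr 1
      funext i x
      have := (hb' i x).2.2
      rw [sub_sub, sub_eq_zero] at this
      exact this
    rw [← rep_smul π hge, ← rep_smul π hg, ← rep_mul π hge hg, ← rep_sub π (hge.smul z) (hg.smul _),
      ← rep_sub π ((hge.smul z).sub (hg.smul _)) (hge.mul hg), this, rep_of π IsGood.zero]
    exact map_zero π

/-- By the C*-identity, pass to `d* d`, which is self-adjoint, diagonal and still of finite range.
-/
theorem norm_rep_diagMat_le_of_finite {d : ∀ i, Xs i → A} {N : ℕ} {c m : ℝ} (hc : 0 ≤ c)
    (hm0 : 0 ≤ m) (hm : ∀ i x, ‖d i x‖ ≤ m) (hd : ∀ i x, Γ.Mem i N c (d i x))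
    (hfin : ∀ i, (Set.range (d i)).Finite) :
    ‖rep π (diagMat d)‖ ≤ m := by
  have hg : IsGood Γ (diagMat d) := isGood_diagMat hc hm hd fun i => fg_of_finite_range (hfin i)
  refine le_of_sq_le_sq ?_ hm0
  rw [← norm_rep_sq π hg, star_diagMat, diagMat_mul_diagMat]
  refine norm_rep_diagMat_le_of_selfAdjoint π (N := N) (c := c * m + m * c) (by positivity)
    (by positivity) (fun i x => ?_) (fun i x => ?_) (fun i => ?_) ?_
  · change ‖star (d i x) * d i x‖ ≤ _
    rw [CStarRing.norm_star_mul_self, ← sq]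
    exact pow_le_pow_left₀ (norm_nonneg _) (hm i x) 2
  · refine Γ.mono (Γ.mul (Γ.star (hd i x)) (hd i x)) ?_
    change c * ‖d i x‖ + ‖star (d i x)‖ * c ≤ c * m + m * c
    rw [norm_star]
    exact add_le_add (mul_le_mul_of_nonneg_left (hm i x) hc)
      (mul_le_mul_of_nonneg_right (hm i x) hc)
  · refine ((hfin i).image fun a => star a * a).subset ?_
    rintro _ ⟨x, rfl⟩
    exact ⟨d i x, ⟨x, rfl⟩, rfl⟩
  · rw [star_mul, star_star]

end Diagonal

/-! ### Finite-range approximation with control of the remainder -/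

section Approximation

/-- Bounded sets of coordinate vectors are totally bounded. The approximants are taken among the
values of `τ` itself, so they inherit every bound known for those values. -/
theorem exists_finite_approx {Z : Type*} {n : ℕ} (τ : Z → Fin n → ℂ) (C : ℝ)
    (h : ∀ x m, ‖τ x m‖ ≤ C) {δ : ℝ} (hδ : 0 < δ) :
    ∃ r : Z → Z, (Set.range r).Finite ∧ ∀ x m, ‖τ x m - τ (r x) m‖ ≤ δ := by
  rcases isEmpty_or_nonempty Z with hZ | hZ
  · exact ⟨id, Set.toFinite _, fun x => hZ.elim x⟩
  have hb : TotallyBounded (Set.range τ) := by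
    refine (isCompact_closedBall (0 : Fin n → ℂ) (max C 0)).totallyBounded.subset ?_
    rintro _ ⟨x, rfl⟩
    rw [mem_closedBall_zero_iff]
    exact (pi_norm_le_iff_of_nonneg (le_max_right _ _)).2 fun m => (h x m).trans (le_max_left _ _)
  obtain ⟨s, hs, hsf, hcov⟩ := Metric.finite_approx_of_totallyBounded hb δ hδ
  have h1 : ∀ y : Fin n → ℂ, ∃ z : Z, y ∈ s → τ z = y := by
    intro y
    by_cases hy : y ∈ s
    · obtain ⟨z, hz⟩ := hs hy
      exact ⟨z, fun _ => hz⟩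
    · exact ⟨hZ.some, fun h => absurd h hy⟩
  choose g hg using h1
  have h2 : ∀ x : Z, ∃ y ∈ s, dist (τ x) y < δ := by
    intro x
    have := hcov ⟨x, rfl⟩
    simpa using this
  choose q hq hq' using h2
  refine ⟨fun x => g (q x), (hsf.image g).subset ?_, fun x m => ?_⟩
  · rintro _ ⟨x, rfl⟩
    exact ⟨q x, hq x, rfl⟩
  · rw [hg _ (hq x)]
    refine le_trans ?_ (hq' x).le
    rw [dist_eq_norm]
    exact norm_le_pi_norm (τ x - q x) m

variable {I A : Type u} [NonUnitalCStarAlgebra A] {Γ : Gauge I A}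

/-- Take a basis of the span of the values, which consists of smooth elements, and divide each basis
vector by `1 + ‖b‖ + e`, where `e` bounds its derivatives. Norms and `C¹`-bounds are then at most
`1`, uniformly in `i`. Only the dimension `n` and the bound `C` may depend on `i`. -/
theorem Gauge.exists_coords {Z : Type*} (i : I) {N : ℕ} {c M : ℝ} {d : Z → A}
    (hM : ∀ z, ‖d z‖ ≤ M) (hd : ∀ z, Γ.Mem i N c (d z))
    (hfin : ∃ U : Submodule ℂ A, U.FG ∧ ∀ z, d z ∈ U) :
    ∃ (n : ℕ) (t : Z → Fin n → ℂ) (a : Fin n → A) (C : ℝ), (∀ m, Γ.Mem i N 1 (a m)) ∧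
      (∀ m, ‖a m‖ ≤ 1) ∧ (∀ z m, ‖t z m‖ ≤ C) ∧ ∀ z, d z = ∑ m, t z m • a m := by
  obtain ⟨U, hU, hdU⟩ := hfin
  set U₀ : Submodule ℂ A := Submodule.span ℂ (Set.range d) with hU₀
  have hle : U₀ ≤ U := Submodule.span_le.2 (by rintro _ ⟨z, rfl⟩; exact hdU z)
  have hle2 : U₀ ≤ Γ.sub i N := Submodule.span_le.2 (by rintro _ ⟨z, rfl⟩; exact ⟨c, hd z⟩)
  have : Module.Finite ℂ U := Module.Finite.iff_fg.2 hU
  have : Module.Finite ℂ U₀ := Submodule.finiteDimensional_of_le hle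
  let b := Module.finBasis ℂ U₀
  have hb : ∀ m, ∃ e, Γ.Mem i N e (b m : A) := fun m => hle2 (b m).2
  choose e he using hb
  have he0 : ∀ m, 0 ≤ e m := fun m => Γ.nonneg (he m)
  set s : Fin (Module.finrank ℂ U₀) → ℝ := fun m => 1 + ‖(b m : A)‖ + e m with hs
  have hs0 : ∀ m, 0 < s m := fun m => by
    have := he0 m
    positivity
  let L : U₀ →L[ℂ] (Fin (Module.finrank ℂ U₀) → ℂ) :=
    LinearMap.toContinuousLinearMap (b.equivFun : U₀ →ₗ[ℂ] _)
  have hLb : ∀ (z : Z) m, ‖b.equivFun ⟨d z, Submodule.subset_span ⟨z, rfl⟩⟩ m‖ ≤ ‖L‖ * M := by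
    intro z m
    have h1 := L.le_opNorm ⟨d z, Submodule.subset_span ⟨z, rfl⟩⟩
    refine (norm_le_pi_norm (L ⟨d z, Submodule.subset_span ⟨z, rfl⟩⟩) m).trans (h1.trans ?_)
    exact mul_le_mul_of_nonneg_left (hM z) (norm_nonneg _)
  refine ⟨_, fun z m => (s m : ℂ) * b.equivFun ⟨d z, Submodule.subset_span ⟨z, rfl⟩⟩ m,
    fun m => ((s m)⁻¹ : ℂ) • (b m : A), (∑ m, s m) * (‖L‖ * M), fun m => ?_, fun m => ?_,
    fun z m => ?_, fun z => ?_⟩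
  · refine Γ.mono (Γ.smul _ (he m)) ?_
    rw [norm_inv, Complex.norm_real, Real.norm_of_nonneg (hs0 m).le, inv_mul_le_one₀ (hs0 m), hs]
    simp only
    linarith [norm_nonneg (b m : A)]
  · rw [norm_smul, norm_inv, Complex.norm_real, Real.norm_of_nonneg (hs0 m).le,
      inv_mul_le_one₀ (hs0 m), hs]
    simp only
    linarith [he0 m]
  · rw [norm_mul, Complex.norm_real, Real.norm_of_nonneg (hs0 m).le]
    exact mul_le_mul (Finset.single_le_sum (fun m _ => (hs0 m).le) (Finset.mem_univ m)) (hLb z m)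
      (norm_nonneg _) (Finset.sum_nonneg fun m _ => (hs0 m).le)
  · have h1 := congrArg (Subtype.val) (b.sum_equivFun ⟨d z, Submodule.subset_span ⟨z, rfl⟩⟩)
    rw [AddSubmonoidClass.coe_finsetSum] at h1
    refine h1.symm.trans (Finset.sum_congr rfl fun m _ => ?_)
    have hne : (s m : ℂ) ≠ 0 := by exact_mod_cast (hs0 m).ne'
    rw [smul_smul]
    have h2 : ∀ u : ℂ, (s m : ℂ) * u * (s m : ℂ)⁻¹ = u := fun u => by field_simp
    exact (congrArg (fun u : ℂ => u • (b m : A)) (h2 _)).symm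

/-- The dimension `n` depends on `i` without a uniform bound, so the error has to anticipate it. The
factor `(1 / 2) ^ m` makes the sum over basis vectors converge, and `(n + 1)⁻²` leaves room for
rescaling by `n + 1` in `norm_rep_diagMat_le_of_small`. -/
theorem Gauge.exists_approx {Z : Type*} (i : I) {N : ℕ} {c M : ℝ} {d : Z → A}
    (hM : ∀ z, ‖d z‖ ≤ M) (hd : ∀ z, Γ.Mem i N c (d z))
    (hfin : ∃ U : Submodule ℂ A, U.FG ∧ ∀ z, d z ∈ U) {ε : ℝ} (hε : 0 < ε) :
    ∃ (r : Z → Z) (n : ℕ) (t : ℕ → Z → ℂ) (a : ℕ → A), (Set.range r).Finite ∧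
      (∀ m, Γ.Mem i N 1 (a m)) ∧ (∀ m, ‖a m‖ ≤ 1) ∧
      (∀ m z, ‖t m z‖ ≤ ε * (1 / 2) ^ m / (n + 1) ^ 2) ∧
      ∀ z, d z - d (r z) = ∑ m ∈ Finset.range n, t m z • a m := by
  obtain ⟨n, t, a, C, h1, h2, h3, h4⟩ := Γ.exists_coords i hM hd hfin
  obtain ⟨r, hr, hr'⟩ := exists_finite_approx t C h3
    (δ := ε * (1 / 2) ^ n / (n + 1) ^ 2) (by positivity)
  refine ⟨r, n, fun m z => if h : m < n then t z ⟨m, h⟩ - t (r z) ⟨m, h⟩ else 0,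
    fun m => if h : m < n then a ⟨m, h⟩ else 0, hr, fun m => ?_, fun m => ?_, fun m z => ?_,
    fun z => ?_⟩
  · dsimp only
    split_ifs with h
    · exact h1 _
    · exact Γ.mem_zero zero_le_one
  · dsimp only
    split_ifs with h
    · exact h2 _
    · simp
  · dsimp only
    split_ifs with h
    · refine (hr' z _).trans ?_
      gcongr ε * ?_ / _
      exact pow_le_pow_of_le_one (by norm_num) (by norm_num) h.le
    · rw [norm_zero]
      positivity
  · rw [h4, h4, ← Finset.sum_sub_distrib, Finset.sum_range]
    refine Finset.sum_congr rfl fun m _ => ?_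
    simp only [m.2, dif_pos, sub_smul]

end Approximation

/-! ### General diagonal matrices -/

section Diagonal

variable {I A : Type u} [NonUnitalCStarAlgebra A] {Xs : I → Type u} [∀ i, MetricSpace (Xs i)]
  [UniformGeometry Xs] {Γ : Gauge I A}
  {K : Type v} [NormedAddCommGroup K] [InnerProductSpace ℂ K] [CompleteSpace K]
  (π : goodAlgebra Γ Xs →⋆ₙₐ[ℂ] (K →L[ℂ] K))

theorem diagMat_rowMul (φ : ∀ i, Xs i → ℂ) (d : ∀ i, Xs i → A) :
    rowMul φ (diagMat d) = diagMat fun i x => φ i x • d i x := by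
  funext i
  ext x y
  rw [rowMul_entry]
  by_cases h : x = y
  · subst h
    rw [diagMat_same, diagMat_same]
  · rw [diagMat_ne _ h, diagMat_ne _ h, smul_zero]

theorem diagMat_sum {ι : Type*} (s : Finset ι) (d : ι → ∀ i, Xs i → A) :
    diagMat (fun i x => ∑ j ∈ s, d j i x) = ∑ j ∈ s, diagMat (d j) := by
  funext i
  ext x y
  rw [sum_entry]
  by_cases h : x = y
  · subst h
    simp only [diagMat_same]
  · simp only [diagMat_ne _ h, Finset.sum_const_zero]

open Classical in
/-- A diagonal matrix whose entries are small combinations of fixed elements is small. -/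
theorem norm_rep_diagMat_le_of_small {N : ℕ} {ε : ℝ} (hε : 0 < ε) {n : I → ℕ}
    {t : ∀ i, ℕ → Xs i → ℂ} {a : I → ℕ → A} (h1 : ∀ i m, Γ.Mem i N 1 (a i m))
    (h2 : ∀ i m, ‖a i m‖ ≤ 1) (h3 : ∀ i m x, ‖t i m x‖ ≤ ε * (1 / 2) ^ m / (n i + 1) ^ 2)
    {d : ∀ i, Xs i → A} (hd : ∀ i x, d i x = ∑ m ∈ Finset.range (n i), t i m x • a i m) :
    ‖rep π (diagMat d)‖ ≤ 2 * ε := by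
  -- The rescaled diagonal still has norms and `C¹`-bounds at most `ε`, so it is good and `π` of it
  -- is some bounded operator of unspecified norm.
  set Q : ∀ i, Xs i → A := fun i x => ((n i + 1 : ℝ) : ℂ) • d i x with hQ
  have ht : ∀ i m x, ‖((n i + 1 : ℝ) : ℂ) * t i m x‖ ≤ ε / (n i + 1) := by
    intro i m x
    rw [norm_mul, Complex.norm_real, Real.norm_of_nonneg (by positivity)]
    calc (n i + 1 : ℝ) * ‖t i m x‖ ≤ (n i + 1) * (ε * (1 / 2) ^ m / (n i + 1) ^ 2) := by
          gcongr
          exact h3 i m x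
      _ = ε * (1 / 2) ^ m / (n i + 1) := by field_simp
      _ ≤ ε * 1 / (n i + 1) := by
          gcongr
          exact pow_le_one₀ (by norm_num) (by norm_num)
      _ = _ := by rw [mul_one]
  have hQs : ∀ i x, Q i x = ∑ m ∈ Finset.range (n i), (((n i + 1 : ℝ) : ℂ) * t i m x) • a i m := by
    intro i x
    rw [hQ]
    simp only [hd, Finset.smul_sum, smul_smul]
  have hle : ∀ i, (n i : ℝ) * (ε / (n i + 1)) ≤ ε := by
    intro i
    rw [mul_div_assoc', div_le_iff₀ (by positivity)]
    nlinarith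
  have hQn : ∀ i x, ‖Q i x‖ ≤ ε := by
    intro i x
    rw [hQs]
    calc _ ≤ ∑ m ∈ Finset.range (n i), ‖(((n i + 1 : ℝ) : ℂ) * t i m x) • a i m‖ := norm_sum_le _ _
      _ ≤ ∑ m ∈ Finset.range (n i), ε / (n i + 1) := Finset.sum_le_sum fun m _ => by
          rw [norm_smul]
          exact (mul_le_mul (ht i m x) (h2 i m) (norm_nonneg _) (by positivity)).trans_eq
            (mul_one _)
      _ = (n i : ℝ) * (ε / (n i + 1)) := by simp
      _ ≤ ε := hle i
  have hQm : ∀ i x, Γ.Mem i N ε (Q i x) := by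
    intro i x
    rw [hQs]
    refine Γ.mono (Γ.sum (c := ε / (n i + 1)) _ _ fun m _ =>
      Γ.mono (Γ.smul _ (h1 i m)) ?_) (by rw [Finset.card_range]; exact hle i)
    rw [mul_one]
    exact ht i m x
  have hQg : IsGood Γ (diagMat Q) := isGood_diagMat hε.le hQn hQm fun i =>
    ⟨Submodule.span ℂ ((Finset.range (n i)).image (a i) : Finset A), ⟨_, rfl⟩, fun x => by
      rw [hQs]
      exact Submodule.sum_mem _ fun m hm => Submodule.smul_mem _ _
        (Submodule.subset_span (Finset.mem_coe.2 (Finset.mem_image_of_mem _ hm)))⟩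
  -- Indices with `n i ≤ J` give a sum of `J` row multiples of diagonals constant for each `i`,
  -- bounded by a geometric series. On the others `d = (n i + 1)⁻¹ Q`, which costs at most `(J +
  -- 1)⁻¹` times the norm of `π(Q)`. Letting `J` grow removes this second term.
  have key : ∀ J : ℕ, ‖rep π (diagMat d)‖ ≤ 2 * ε + (J + 1 : ℝ)⁻¹ * ‖rep π (diagMat Q)‖ := by
    intro J
    set B : ℕ → ∀ i, Xs i → A := fun m i _ => if m < n i ∧ n i ≤ J then a i m else 0 with hB
    have hBn : ∀ m i x, ‖B m i x‖ ≤ 1 := by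
      intro m i x
      simp only [hB]
      split_ifs
      · exact h2 i m
      · simp
    have hBm : ∀ m i x, Γ.Mem i N 1 (B m i x) := by
      intro m i x
      simp only [hB]
      split_ifs
      · exact h1 i m
      · exact Γ.mem_zero zero_le_one
    have hBf : ∀ m i, (Set.range (B m i)).Finite := fun m i =>
      (Set.finite_singleton (if m < n i ∧ n i ≤ J then a i m else 0)).subset (by
        rintro _ ⟨x, rfl⟩
        rfl)
    have hBg : ∀ m, IsGood Γ (diagMat (B m)) := fun m =>
      isGood_diagMat zero_le_one (hBn m) (hBm m) fun i => fg_of_finite_range (hBf m i)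
    have htb : ∀ m i x, ‖t i m x‖ ≤ ε * (1 / 2) ^ m := by
      intro m i x
      refine (h3 i m x).trans (div_le_self (by positivity) ?_)
      exact one_le_pow₀ (by linarith [(Nat.cast_nonneg (n i) : (0 : ℝ) ≤ n i)])
    set ψ : ∀ i, Xs i → ℂ := fun i _ => if n i ≤ J then 0 else ((n i + 1 : ℝ) : ℂ)⁻¹ with hψ
    have hψb : ∀ i x, ‖ψ i x‖ ≤ (J + 1 : ℝ)⁻¹ := by
      intro i x
      simp only [hψ]
      split_ifs with h
      · rw [norm_zero]
        positivity
      · rw [norm_inv, Complex.norm_real, Real.norm_of_nonneg (by positivity)]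
        gcongr
        exact (not_le.1 h).le
    have hdec : diagMat d = ∑ m ∈ Finset.range J, rowMul (fun i x => t i m x) (diagMat (B m)) +
        rowMul ψ (diagMat Q) := by
      simp only [diagMat_rowMul]
      rw [← diagMat_sum, ← diagMat_add]
      congr 1
      funext i x
      change d i x = ∑ m ∈ Finset.range J, t i m x • B m i x + ψ i x • Q i x
      by_cases h : n i ≤ J
      · simp only [hψ, hB, h, if_true, and_true, zero_smul, add_zero, hd]
        rw [← Finset.sum_subset (Finset.range_subset_range.2 h)]
        · exact Finset.sum_congr rfl fun m hm => by rw [if_pos (Finset.mem_range.1 hm)]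
        · intro m _ hm
          rw [if_neg (by simpa using hm), smul_zero]
      · have hne : ((n i + 1 : ℝ) : ℂ) ≠ 0 := by
          exact_mod_cast (by positivity : (n i + 1 : ℝ) ≠ 0)
        simp only [hψ, hB, h, if_false, and_false, smul_zero, Finset.sum_const_zero, zero_add, hQ,
          smul_smul, inv_mul_cancel₀ hne, one_smul]
    have hg1 : ∀ m, IsGood Γ (rowMul (fun i x => t i m x) (diagMat (B m))) := fun m =>
      (hBg m).rowMul (htb m)
    rw [hdec, rep_add π (IsGood.sum _ fun m _ => hg1 m) (hQg.rowMul hψb),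
      rep_sum π _ fun m _ => hg1 m]
    refine (norm_add_le _ _).trans (add_le_add ?_
      (norm_rep_rowMul_le π (by positivity) hψb hQg))
    calc _ ≤ ∑ m ∈ Finset.range J, ‖rep π (rowMul (fun i x => t i m x) (diagMat (B m)))‖ :=
          norm_sum_le _ _
      _ ≤ ∑ m ∈ Finset.range J, ε * (1 / 2) ^ m := Finset.sum_le_sum fun m _ => by
          refine (norm_rep_rowMul_le π (by positivity) (htb m) (hBg m)).trans ?_
          have := norm_rep_diagMat_le_of_finite π zero_le_one zero_le_one (hBn m) (hBm m) (hBf m)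
          exact (mul_le_mul_of_nonneg_left this (by positivity)).trans_eq (mul_one _)
      _ = ε * ∑ m ∈ Finset.range J, (1 / 2 : ℝ) ^ m := by rw [Finset.mul_sum]
      _ ≤ ε * 2 := by
          gcongr
          exact sum_geometric_two_le J
      _ = 2 * ε := by ring
  have hlim : Filter.Tendsto (fun J : ℕ => 2 * ε + (J + 1 : ℝ)⁻¹ * ‖rep π (diagMat Q)‖)
      Filter.atTop (nhds (2 * ε + 0 * ‖rep π (diagMat Q)‖)) := by
    refine tendsto_const_nhds.add (Filter.Tendsto.mul_const _ ?_)
    simpa [one_div] using tendsto_one_div_add_atTop_nhds_zero_nat (𝕜 := ℝ)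
  rw [zero_mul, add_zero] at hlim
  exact ge_of_tendsto' hlim key

/-- Split `d` into a finite-range part made of values of `d`, with the same bound `m`, and a
remainder that is small under `π`. This is the point where arbitrary representations become
controlled by the norm of `A`. -/
theorem norm_rep_diagMat_le {d : ∀ i, Xs i → A} {m : ℝ} (hm0 : 0 ≤ m) (hg : IsGood Γ (diagMat d))
    (hm : ∀ i x, ‖d i x‖ ≤ m) : ‖rep π (diagMat d)‖ ≤ m := by
  obtain ⟨N, c, hc, hmem⟩ := hg.mem
  have hd : ∀ i x, Γ.Mem i N c (d i x) := fun i x => by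
    have := hmem i x x
    rwa [diagMat_same] at this
  have hfin : ∀ i, ∃ U : Submodule ℂ A, U.FG ∧ ∀ x, d i x ∈ U := fun i => by
    obtain ⟨U, hU, h⟩ := hg.fin i
    exact ⟨U, hU, fun x => diagMat_same d i x ▸ h x x⟩
  refine le_of_forall_pos_le_add fun δ hδ => ?_
  have happ := fun i => Γ.exists_approx i (hm i) (hd i) (hfin i) (half_pos hδ)
  choose r n t a hr h1 h2 h3 h4 using happ
  set d₁ : ∀ i, Xs i → A := fun i x => d i (r i x) with hd₁
  set d₂ : ∀ i, Xs i → A := fun i x => d i x - d i (r i x) with hd₂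
  have hf1 : ∀ i, (Set.range (d₁ i)).Finite := fun i => ((hr i).image (d i)).subset (by
    rintro _ ⟨x, rfl⟩
    exact ⟨r i x, ⟨x, rfl⟩, rfl⟩)
  have hg1 : IsGood Γ (diagMat d₁) := isGood_diagMat hc (fun i x => hm i (r i x))
    (fun i x => hd i (r i x)) fun i => fg_of_finite_range (hf1 i)
  have heq : d = d₁ + d₂ := by
    funext i x
    change d i x = d i (r i x) + (d i x - d i (r i x))
    abel
  have hsub : diagMat d₂ = diagMat d - diagMat d₁ := by
    rw [heq, diagMat_add, add_sub_cancel_left]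
  have hg2 : IsGood Γ (diagMat d₂) := by
    rw [hsub]
    exact hg.sub hg1
  rw [heq, diagMat_add, rep_add π hg1 hg2]
  refine (norm_add_le _ _).trans (add_le_add
    (norm_rep_diagMat_le_of_finite π hc hm0 (fun i x => hm i (r i x)) (fun i x => hd i (r i x))
      hf1) ?_)
  refine (norm_rep_diagMat_le_of_small π (half_pos hδ) h1 h2 h3 fun i x => h4 i x).trans_eq ?_
  ring

end Diagonal

/-! ### The C*-norm of finite matrices -/

section MatNorm

variable {A A' : Type*} [NonUnitalCStarAlgebra A] [NonUnitalCStarAlgebra A'] {B : Type*} [Fintype B]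

/-- The C*-norm of a finite matrix over a C*-algebra. -/
def matNorm (M : B → B → A) : ℝ :=
  letI := CStarAlgebra.spectralOrder A
  letI := CStarAlgebra.spectralOrderedRing A
  ‖(CStarMatrix.ofMatrix M : CStarMatrix B B A)‖

theorem matNorm_nonneg (M : B → B → A) : 0 ≤ matNorm M := by
  let _ := CStarAlgebra.spectralOrder A
  let _ := CStarAlgebra.spectralOrderedRing A
  exact norm_nonneg (CStarMatrix.ofMatrix M : CStarMatrix B B A)

theorem norm_entry_le_matNorm (M : B → B → A) (x y : B) : ‖M x y‖ ≤ matNorm M := by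
  let _ := CStarAlgebra.spectralOrder A
  let _ := CStarAlgebra.spectralOrderedRing A
  exact CStarMatrix.norm_entry_le_norm (M := (CStarMatrix.ofMatrix M : CStarMatrix B B A))

theorem matNorm_mul_le (M N : B → B → A) :
    matNorm (fun x y => ∑ z, M x z * N z y) ≤ matNorm M * matNorm N := by
  let _ := CStarAlgebra.spectralOrder A
  let _ := CStarAlgebra.spectralOrderedRing A
  exact norm_mul_le (CStarMatrix.ofMatrix M : CStarMatrix B B A) (CStarMatrix.ofMatrix N)

theorem matNorm_star_mul_self (M : B → B → A) :
    matNorm (fun x y => ∑ z, star (M z x) * M z y) = matNorm M ^ 2 := by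
  let _ := CStarAlgebra.spectralOrder A
  let _ := CStarAlgebra.spectralOrderedRing A
  rw [sq]
  exact CStarRing.norm_star_mul_self (x := (CStarMatrix.ofMatrix M : CStarMatrix B B A))

theorem matNorm_map (φ : A →⋆ₙₐ[ℂ] A') (hφ : Function.Injective φ) (M : B → B → A) :
    matNorm (fun x y => φ (M x y)) = matNorm M := by
  let _ := CStarAlgebra.spectralOrder A
  let _ := CStarAlgebra.spectralOrderedRing A
  let _ := CStarAlgebra.spectralOrder A'
  let _ := CStarAlgebra.spectralOrderedRing A'
  have h : Function.Injective (CStarMatrix.mapₙₐ (n := B) φ) :=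
    CStarMatrix.map_injective hφ
  exact NonUnitalStarAlgHom.norm_map _ h (CStarMatrix.ofMatrix M)

/-- It is enough to test on vectors in the range of `M*`: with `a` such a vector and `b` its image,
`‖a‖² = ⟨b, v⟩ ≤ m ‖a‖ ‖v‖`. The restriction matters because such vectors have coordinates in any
ideal containing the entries of `M`. -/
theorem matNorm_le {M : B → B → A} {m : ℝ} (hm : 0 ≤ m)
    (h : ∀ ξ : B → A, ∀ ζ : B → A, (∀ y, ζ y = ∑ x, star (M x y) * ξ x) →
      ‖∑ x, star (∑ y, M x y * ζ y) * ∑ y, M x y * ζ y‖ ≤ m ^ 2 * ‖∑ y, star (ζ y) * ζ y‖) :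
    matNorm M ≤ m := by
  let _ := CStarAlgebra.spectralOrder A
  let _ := CStarAlgebra.spectralOrderedRing A
  set N : CStarMatrix B B A := CStarMatrix.ofMatrix M with hN
  change ‖CStarMatrix.toCLM N‖ ≤ m
  refine ContinuousLinearMap.opNorm_le_bound _ hm fun v => ?_
  set a := CStarMatrix.toCLM N v with ha
  set b := CStarMatrix.toCLM N.conjTranspose a with hb
  -- `CStarMatrix.toCLM` multiplies row vectors from the right. Taking stars converts to the column
  -- vectors of the hypothesis.
  set ζ : B → A := fun y => ∑ x, star (M x y) * star (v x) with hζ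
  have ha' : ∀ y, a y = star (ζ y) := by
    intro y
    rw [ha, CStarMatrix.toCLM_apply_eq_sum]
    simp only [hζ, star_sum, star_mul, star_star]
    rfl
  have hb' : ∀ x, b x = star (∑ y, M x y * ζ y) := by
    intro x
    rw [hb, CStarMatrix.toCLM_apply_eq_sum]
    change ∑ y, a y * star (M x y) = _
    simp only [ha', star_sum, star_mul]
  have h1 : ‖b‖ ^ 2 ≤ m ^ 2 * ‖a‖ ^ 2 := by
    have := h (fun x => star (v x)) ζ fun y => rfl
    rw [WithCStarModule.pi_norm_sq, WithCStarModule.pi_norm_sq]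
    simp only [WithCStarModule.inner_def, ha', hb', star_star]
    exact this
  have h2 : ‖b‖ ≤ m * ‖a‖ := le_of_sq_le_sq (by rw [mul_pow]; exact h1) (by positivity)
  have h3 : ‖a‖ ^ 2 ≤ ‖b‖ * ‖v‖ := by
    rw [CStarModule.norm_sq_eq A]
    have : inner A a a = inner A b v := by
      exact (CStarMatrix.inner_toCLM_conjTranspose_left (M := N) (v := a) (w := v)).symm
    rw [this]
    exact CStarModule.norm_inner_le _
  rcases (norm_nonneg a).eq_or_lt with h0 | h0
  · rw [← h0]
    positivity
  · have : ‖b‖ * ‖v‖ ≤ m * ‖a‖ * ‖v‖ := mul_le_mul_of_nonneg_right h2 (norm_nonneg v)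
    nlinarith

end MatNorm

/-! ### Matrices of fixed propagation -/

section Propagation

variable {I A : Type u} [NonUnitalCStarAlgebra A] {Xs : I → Type u} [∀ i, MetricSpace (Xs i)]
  [UniformGeometry Xs] {Γ : Gauge I A}
  {K : Type v} [NormedAddCommGroup K] [InnerProductSpace ℂ K] [CompleteSpace K]
  (π : goodAlgebra Γ Xs →⋆ₙₐ[ℂ] (K →L[ℂ] K))

/-- A matrix with at most one nonzero entry in each row and each column. -/
theorem norm_rep_le_of_monomial {T : ∀ i, RCMat (Xs i) A} {M : ℝ} (hM0 : 0 ≤ M)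
    (hT : IsGood Γ T) (hM : ∀ i x y, ‖(T i).entry x y‖ ≤ M)
    (hrow : ∀ i x y y', (T i).entry x y ≠ 0 → (T i).entry x y' ≠ 0 → y = y')
    (hcol : ∀ i x x' y, (T i).entry x y ≠ 0 → (T i).entry x' y ≠ 0 → x = x') :
    ‖rep π T‖ ≤ M := by
  set e : ∀ i, Xs i → A := fun i x => ((star T * T) i).entry x x with he
  have hmul : ∀ i x y, ((star T * T) i).entry x y =
      ∑ᶠ z, star ((T i).entry z x) * (T i).entry z y := fun i x y => rfl
  have hd : star T * T = diagMat e := by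
    funext i
    ext x y
    by_cases h : x = y
    · rw [h, diagMat_same]
    · rw [diagMat_ne _ h, hmul]
      refine finsum_eq_zero_of_forall_eq_zero fun z => ?_
      by_contra hz
      refine h (hrow i z x y (fun h0 => hz ?_) fun h0 => hz ?_)
      · rw [h0, star_zero, zero_mul]
      · rw [h0, mul_zero]
  have hen : ∀ i x, ‖e i x‖ ≤ M ^ 2 := by
    intro i x
    simp only [he, hmul]
    by_cases hz : ∃ z, (T i).entry z x ≠ 0
    · obtain ⟨z, hz⟩ := hz
      rw [finsum_eq_single _ z, CStarRing.norm_star_mul_self, ← sq]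
      · exact pow_le_pow_left₀ (norm_nonneg _) (hM i z x) 2
      · intro z' hz'
        by_contra h0
        exact hz' (hcol i z' z x (fun h1 => h0 (by rw [h1, mul_zero])) hz)
    · push Not at hz
      rw [finsum_eq_zero_of_forall_eq_zero fun z => by rw [hz z, mul_zero], norm_zero]
      positivity
  refine le_of_sq_le_sq ?_ hM0
  rw [← norm_rep_sq π hT, hd]
  exact norm_rep_diagMat_le π (by positivity) (hd ▸ hT.star.mul hT) hen

variable (Xs) in
theorem exists_numbering (r : ℝ) : ∃ (L : ℕ) (num : ∀ i, Xs i → Xs i → Fin (L + 1)),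
    ∀ i x y y', dist x y ≤ r → dist x y' ≤ r → num i x y = num i x y' → y = y' := by
  classical
  obtain ⟨L, hL⟩ := UniformGeometry.exists_ball (Xs := Xs) r
  choose s hs hs' using hL
  refine ⟨L, fun i x y => if h : y ∈ s i x then
    ⟨(s i x).equivFin ⟨y, h⟩, by have := ((s i x).equivFin ⟨y, h⟩).2; have := hs i x; omega⟩ else 0,
    fun i x y y' hy hy' h => ?_⟩
  dsimp only at h
  rw [dif_pos (hs' i x y hy), dif_pos (hs' i x y' hy'), Fin.mk.injEq] at h
  have := (s i x).equivFin.injective (Fin.ext h)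
  exact congrArg Subtype.val this

variable (Xs) in
-- Colour the entry `(x, y)` by the number of `y` in the ball around `x` together with the number of
-- `x` in the ball around `y`. Each of the `(L + 1)²` colour classes has at most one nonzero entry
-- in each row and column. The constant depends only on `r` and the spaces, not on `π` or `T`.
theorem exists_norm_rep_le (Γ : Gauge I A) (r : ℝ) : ∃ C : ℝ, 0 ≤ C ∧
    ∀ (K : Type v) [NormedAddCommGroup K] [InnerProductSpace ℂ K] [CompleteSpace K]
      (π : goodAlgebra Γ Xs →⋆ₙₐ[ℂ] (K →L[ℂ] K)) (T : ∀ i, RCMat (Xs i) A) (M : ℝ),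
      0 ≤ M → IsGood Γ T → (∀ i x y, (T i).entry x y ≠ 0 → dist x y ≤ r) →
      (∀ i x y, ‖(T i).entry x y‖ ≤ M) → ‖rep π T‖ ≤ C * M := by
  classical
  obtain ⟨L, num, hnum⟩ := exists_numbering Xs r
  refine ⟨((L + 1 : ℕ) * (L + 1 : ℕ) : ℕ), by positivity, fun K _ _ _ π T M hM0 hT hr hM => ?_⟩
  set k : Fin (L + 1) × Fin (L + 1) → ∀ i, Xs i → Xs i → ℂ := fun c i x y =>
    if c = (num i x y, num i y x) then 1 else 0 with hk
  have hk1 : ∀ c i x y, ‖k c i x y‖ ≤ 1 := by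
    intro c i x y
    simp only [hk]
    split_ifs <;> simp
  have hkT : ∀ c i x y, (schur (k c) T i).entry x y ≠ 0 →
      c = (num i x y, num i y x) ∧ dist x y ≤ r := by
    intro c i x y h
    rw [schur_entry] at h
    refine ⟨?_, hr i x y fun h0 => h (by rw [h0, smul_zero])⟩
    by_contra hc
    exact h (by simp only [hk]; rw [if_neg hc, zero_smul])
  have hg : ∀ c, IsGood Γ (schur (k c) T) := fun c => hT.schur (hk1 c)
  have hsum : T = ∑ c, schur (k c) T := by
    funext i
    ext x y
    rw [sum_entry]
    simp only [schur_entry, ← Finset.sum_smul, hk]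
    rw [Finset.sum_ite_eq' Finset.univ, if_pos (Finset.mem_univ _), one_smul]
  rw [hsum, rep_sum π _ fun c _ => hg c]
  refine (norm_sum_le _ _).trans ?_
  have hc : ∀ c, ‖rep π (schur (k c) T)‖ ≤ M := by
    intro c
    refine norm_rep_le_of_monomial π hM0 (hg c) (fun i x y => ?_) (fun i x y y' h h' => ?_)
      fun i x x' y h h' => ?_
    · rw [schur_entry, norm_smul]
      exact (mul_le_mul (hk1 c i x y) (hM i x y) (norm_nonneg _) zero_le_one).trans_eq (one_mul M)
    · obtain ⟨h1, h2⟩ := hkT c i x y h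
      obtain ⟨h1', h2'⟩ := hkT c i x y' h'
      exact hnum i x y y' h2 h2' (Prod.ext_iff.1 (h1.symm.trans h1')).1
    · obtain ⟨h1, h2⟩ := hkT c i x y h
      obtain ⟨h1', h2'⟩ := hkT c i x' y h'
      rw [dist_comm] at h2 h2'
      exact hnum i y x x' h2 h2' (Prod.ext_iff.1 (h1.symm.trans h1')).2
  refine (Finset.sum_le_sum fun c _ => hc c).trans_eq ?_
  simp

end Propagation

/-! ### Block matrices -/

section Blocks

variable {I A : Type u} [NonUnitalCStarAlgebra A] {Xs : I → Type u} [∀ i, MetricSpace (Xs i)]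
  [UniformGeometry Xs] {Γ : Gauge I A}
  {K : Type v} [NormedAddCommGroup K] [InnerProductSpace ℂ K] [CompleteSpace K]
  (π : goodAlgebra Γ Xs →⋆ₙₐ[ℂ] (K →L[ℂ] K))

/-- The compression of a matrix to a finite set. -/
def compress {Z : Type u} (T : RCMat Z A) (B : Finset Z) : B → B → A := fun x y => T.entry x y

/-- Every nonzero entry of `Q` lies in one of the blocks given by the labelling `lab`. -/
def IsBlock (lab : ∀ i, Xs i → Option (Xs i)) (Q : ∀ i, RCMat (Xs i) A) : Prop :=
  ∀ i x y, (Q i).entry x y ≠ 0 → ∃ z, lab i x = some z ∧ lab i y = some z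

variable {lab : ∀ i, Xs i → Option (Xs i)} {Q R : ∀ i, RCMat (Xs i) A}

theorem IsBlock.mul (hQ : IsBlock lab Q) (hR : IsBlock lab R) : IsBlock lab (Q * R) := by
  intro i x y h
  obtain ⟨z, hz⟩ : ∃ z, (Q i).entry x z * (R i).entry z y ≠ 0 := by
    by_contra! hc
    exact h (finsum_eq_zero_of_forall_eq_zero hc)
  obtain ⟨a, ha, ha'⟩ := hQ i x z fun h0 => hz (by rw [h0, zero_mul])
  obtain ⟨b, hb, hb'⟩ := hR i z y fun h0 => hz (by rw [h0, mul_zero])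
  refine ⟨a, ha, ?_⟩
  rw [hb', ← hb, ha']

theorem IsBlock.star (hQ : IsBlock lab Q) : IsBlock lab (star Q) := by
  intro i x y h
  obtain ⟨z, h1, h2⟩ := hQ i y x fun h0 => h (by
    change Star.star ((Q i).entry y x) = 0
    rw [h0, star_zero])
  exact ⟨z, h2, h1⟩

theorem IsBlock.compress_mul (hQ : IsBlock lab Q) (i : I) (B : Finset (Xs i)) (z : Xs i)
    (hB : ∀ x, x ∈ B ↔ lab i x = some z) :
    compress ((Q * R) i) B = fun x y => ∑ w, compress (Q i) B x w * compress (R i) B w y := by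
  funext x y
  have : ((Q * R) i).entry x y = ∑ w ∈ B, (Q i).entry x w * (R i).entry w y := by
    refine RCMat.mul_eq_sum (Q i) (R i) x y B fun w hw => ?_
    obtain ⟨a, ha, ha'⟩ := hQ i x w hw
    rw [(hB x).1 x.2] at ha
    rw [hB, ha', ha]
  rw [compress, this, ← Finset.sum_coe_sort]
  rfl

/-- A constant factor disappears on taking roots of high powers. -/
theorem le_of_pow_le {a b C : ℝ} (hb : 0 < b)
    (h : ∀ k : ℕ, a ^ (2 ^ (k + 1)) ≤ C * b ^ (2 ^ (k + 1))) : a ≤ b := by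
  by_contra hc
  have hc' : 1 < a / b := (one_lt_div hb).2 (not_le.1 hc)
  obtain ⟨n, hn⟩ := pow_unbounded_of_one_lt C hc'
  have h1 : (a / b) ^ (2 ^ (n + 1)) ≤ C := by
    rw [div_pow, div_le_iff₀ (by positivity)]
    exact h n
  have h2 : (a / b) ^ n ≤ (a / b) ^ (2 ^ (n + 1)) :=
    pow_le_pow_right₀ hc'.le ((Nat.lt_two_pow_self (n := n)).le.trans
      (Nat.pow_le_pow_right (by norm_num) (by omega)))
  linarith

/-- Powers of `Q* Q` keep the block pattern and hence propagation at most `2r`. So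
`exists_norm_rep_le` applies to all of them with one constant `C`. The power `2 ^ k` of `Q* Q` has
entries bounded by `m ^ (2 ^ (k + 1))`, and roots remove `C`. -/
theorem norm_rep_le_of_isBlock {r m : ℝ} (hm : 0 < m)
    (hr : ∀ i x z, lab i x = some z → dist z x ≤ r) (hQ : IsGood Γ Q) (hb : IsBlock lab Q)
    (hc : ∀ i (z : Xs i) (B : Finset (Xs i)), (∀ x, x ∈ B ↔ lab i x = some z) →
      matNorm (compress (Q i) B) ≤ m) : ‖rep π Q‖ ≤ m := by
  classical
  obtain ⟨C, hC, hCK⟩ := exists_norm_rep_le.{u, v} Xs Γ (r + r)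
  obtain ⟨L, hL⟩ := UniformGeometry.exists_ball (Xs := Xs) r
  have hBex : ∀ i z, ∃ B : Finset (Xs i), ∀ x, x ∈ B ↔ lab i x = some z := by
    intro i z
    obtain ⟨s, -, hs⟩ := hL i z
    exact ⟨s.filter fun x => lab i x = some z, fun x => by
      rw [Finset.mem_filter]
      exact ⟨fun h => h.2, fun h => ⟨hs x (hr i x z h), h⟩⟩⟩
  -- `P` is obtained from `star Q * Q` by squaring `k` times. The C*-identity computes the norm of
  -- its image exactly.
  have key : ∀ k : ℕ, ∃ P : ∀ i, RCMat (Xs i) A, IsGood Γ P ∧ IsBlock lab P ∧ star P = P ∧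
      ‖rep π P‖ = ‖rep π Q‖ ^ (2 ^ (k + 1)) ∧
      ∀ i (z : Xs i) (B : Finset (Xs i)), (∀ x, x ∈ B ↔ lab i x = some z) →
        matNorm (compress (P i) B) ≤ m ^ (2 ^ (k + 1)) := by
    intro k
    induction k with
    | zero =>
      refine ⟨star Q * Q, hQ.star.mul hQ, hb.star.mul hb, by rw [star_mul, star_star], ?_, ?_⟩
      · rw [norm_rep_sq π hQ]
        norm_num
      · intro i z B hB
        rw [hb.star.compress_mul i B z hB]
        refine (matNorm_star_mul_self (compress (Q i) B)).trans_le ?_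
        norm_num
        exact pow_le_pow_left₀ (matNorm_nonneg _) (hc i z B hB) 2
    | succ k ih =>
      obtain ⟨P, h1, h2, h3, h4, h5⟩ := ih
      refine ⟨P * P, h1.mul h1, h2.mul h2, by rw [star_mul, h3], ?_, ?_⟩
      · have := norm_rep_sq π h1
        rw [h3] at this
        rw [this, h4, ← pow_mul, ← pow_succ]
      · intro i z B hB
        rw [h2.compress_mul i B z hB]
        refine (matNorm_mul_le _ _).trans ?_
        rw [pow_succ 2 (k + 1), mul_two, pow_add]
        exact mul_le_mul (h5 i z B hB) (h5 i z B hB) (matNorm_nonneg _) (by positivity)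
  refine le_of_pow_le (C := C) hm fun k => ?_
  obtain ⟨P, h1, h2, h3, h4, h5⟩ := key k
  rw [← h4]
  refine hCK K π P _ (by positivity) h1 (fun i x y h => ?_) fun i x y => ?_
  · obtain ⟨z, hx, hy⟩ := h2 i x y h
    refine (dist_triangle x z y).trans (add_le_add ?_ (hr i y z hy))
    rw [dist_comm]
    exact hr i x z hx
  · by_cases h : (P i).entry x y = 0
    · rw [h, norm_zero]
      positivity
    · obtain ⟨z, hx, hy⟩ := h2 i x y h
      obtain ⟨B, hB⟩ := hBex i z
      exact (norm_entry_le_matNorm (compress (P i) B) ⟨x, (hB x).2 hx⟩ ⟨y, (hB y).2 hy⟩).trans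
        (h5 i z B hB)

end Blocks

/-! ### Schur multiplication by property A kernels -/

section Kernel

variable {I A : Type u} [NonUnitalCStarAlgebra A] {Xs : I → Type u} [∀ i, MetricSpace (Xs i)]
  [UniformGeometry Xs] {Γ : Gauge I A}
  {K : Type v} [NormedAddCommGroup K] [InnerProductSpace ℂ K] [CompleteSpace K]
  (π : goodAlgebra Γ Xs →⋆ₙₐ[ℂ] (K →L[ℂ] K))

open Classical in
/-- The block kernel of a labelling. -/
def blockKer (lab : ∀ i, Xs i → Option (Xs i)) (i : I) (x y : Xs i) : ℂ :=
  if ∃ z, lab i x = some z ∧ lab i y = some z then 1 else 0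

theorem norm_blockKer_le (lab : ∀ i, Xs i → Option (Xs i)) (i : I) (x y : Xs i) :
    ‖blockKer lab i x y‖ ≤ 1 := by
  rw [blockKer]
  split_ifs <;> simp

theorem norm_rep_blockKer_le {T : ∀ i, RCMat (Xs i) A} {lab : ∀ i, Xs i → Option (Xs i)} {r m : ℝ}
    (hm : 0 < m) (hr : ∀ i x z, lab i x = some z → dist z x ≤ r) (hT : IsGood Γ T)
    (hc : ∀ i (B : Finset (Xs i)), matNorm (compress (T i) B) ≤ m) :
    ‖rep π (schur (blockKer lab) T)‖ ≤ m := by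
  refine norm_rep_le_of_isBlock π (lab := lab) hm hr (hT.schur (norm_blockKer_le lab)) ?_ ?_
  · intro i x y h
    by_contra hc
    refine h ?_
    rw [schur_entry, blockKer, if_neg hc, zero_smul]
  · intro i z B hB
    have : compress (schur (blockKer lab) T i) B = compress (T i) B := by
      funext x y
      rw [compress, schur_entry, blockKer, if_pos ⟨z, (hB x).1 x.2, (hB y).1 y.2⟩, one_smul]
      rfl
    rw [this]
    exact hc i B

/-- The kernel `∑ⱼ Dⱼ(x) Dⱼ(y) χⱼ(x, y)`. -/
def sumKer {n : ℕ} (lab : Fin n → ∀ i, Xs i → Option (Xs i)) (D : Fin n → ∀ i, Xs i → ℝ)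
    (i : I) (x y : Xs i) : ℂ :=
  ∑ j, (D j i x : ℂ) * (D j i y : ℂ) * blockKer (lab j) i x y

/-- The scalar `Dⱼ` at the column index is carried over to the rows of the right factor `R`, so that
only row multiplications occur. A right factor is needed because `Dⱼ` alone need not be in the
algebra. -/
theorem schur_sumKer_mul {n : ℕ} (lab : Fin n → ∀ i, Xs i → Option (Xs i))
    (D : Fin n → ∀ i, Xs i → ℝ) (T R : ∀ i, RCMat (Xs i) A) :
    schur (sumKer lab D) T * R = ∑ j, rowMul (fun i x => (D j i x : ℂ))
      (schur (blockKer (lab j)) T * rowMul (fun i x => (D j i x : ℂ)) R) := by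
  funext i
  ext x y
  have h : ∀ z, (T i).entry x z ≠ 0 → z ∈ ((T i).finite_row x).toFinset :=
    fun z hz => by simpa using hz
  have h2 : ∀ k : ∀ i, Xs i → Xs i → ℂ, ∀ z, (schur k T i).entry x z ≠ 0 →
      z ∈ ((T i).finite_row x).toFinset :=
    fun k z hz => h z fun h => hz (by rw [schur_entry, h, smul_zero])
  have e1 : ∀ (k : ∀ i, Xs i → Xs i → ℂ) (S : ∀ i, RCMat (Xs i) A),
      ((schur k T * S) i).entry x y =
        ∑ z ∈ ((T i).finite_row x).toFinset, (schur k T i).entry x z * (S i).entry z y :=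
    fun k S => RCMat.mul_eq_sum _ _ _ _ _ (h2 k)
  rw [sum_entry, e1]
  simp only [rowMul_entry, e1, schur_entry, Finset.smul_sum]
  rw [Finset.sum_comm]
  refine Finset.sum_congr rfl fun z _ => ?_
  rw [sumKer, Finset.sum_smul, Finset.sum_mul]
  refine Finset.sum_congr rfl fun j _ => ?_
  rw [smul_mul_assoc, smul_mul_smul_comm, smul_smul]
  congr 1
  ring

theorem norm_rep_sumKer_le {n : ℕ} {lab : Fin n → ∀ i, Xs i → Option (Xs i)}
    {D : Fin n → ∀ i, Xs i → ℝ} (hD : ∀ i x, ∑ j, D j i x ^ 2 = 1) {T : ∀ i, RCMat (Xs i) A}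
    {r m : ℝ} (hm : 0 < m) (hr : ∀ j i x z, lab j i x = some z → dist z x ≤ r) (hT : IsGood Γ T)
    (hc : ∀ i (B : Finset (Xs i)), matNorm (compress (T i) B) ≤ m) :
    IsGood Γ (schur (sumKer lab D) T) ∧ ‖rep π (schur (sumKer lab D) T)‖ ≤ m := by
  have hD1 : ∀ j i x, ‖(D j i x : ℂ)‖ ≤ 1 := by
    intro j i x
    have := Finset.single_le_sum (f := fun j => D j i x ^ 2) (fun j _ => sq_nonneg _)
      (Finset.mem_univ j)
    rw [hD] at this
    rw [Complex.norm_real]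
    exact abs_le_one_iff_mul_self_le_one.2 (by rw [← sq]; exact this)
  have hD2 : ∀ i x, ∑ j, ‖(D j i x : ℂ)‖ ^ 2 = 1 := fun i x => by
    rw [← hD i x]
    refine Finset.sum_congr rfl fun j _ => ?_
    rw [Complex.norm_real, Real.norm_eq_abs, sq_abs]
  set φ : Fin n → ∀ i, Xs i → ℂ := fun j i x => (D j i x : ℂ) with hφ
  have hstar : ∀ j, star (φ j) = φ j := fun j => by
    funext i x
    exact Complex.conj_ofReal _
  have hgM : IsGood Γ (schur (sumKer lab D) T) := hT.schur (C := n) fun i x y => by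
    refine (norm_sum_le _ _).trans ((Finset.sum_le_sum (g := fun _ => (1 : ℝ)) fun j _ => ?_).trans
      (by simp))
    rw [norm_mul, norm_mul]
    exact mul_le_one₀ (mul_le_one₀ (hD1 j i x) (norm_nonneg _) (hD1 j i y)) (norm_nonneg _)
      (norm_blockKer_le _ _ _ _)
  refine ⟨hgM, ?_⟩
  set M := schur (sumKer lab D) T with hM
  have hgχ : ∀ j, IsGood Γ (schur (blockKer (lab j)) T) := fun j =>
    hT.schur (norm_blockKer_le (lab j))
  -- Each block term is bounded by `m`. Cauchy–Schwarz over `j` together with `∑ⱼ Dⱼ² = 1`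
  -- reassembles the norms of `π(R) v` and `π(R') w` without loss.
  have key : ∀ (R R' : ∀ i, RCMat (Xs i) A), IsGood Γ R → IsGood Γ R' → ∀ v w : K,
      ‖inner ℂ (rep π (M * R) v) (rep π R' w)‖ ≤ m * (‖rep π R v‖ * ‖rep π R' w‖) := by
    intro R R' hR hR' v w
    have hgR : ∀ j, IsGood Γ (rowMul (φ j) R) := fun j => hR.rowMul (hD1 j)
    have hgR' : ∀ j, IsGood Γ (rowMul (φ j) R') := fun j => hR'.rowMul (hD1 j)
    have e1 : star R' * (M * R) = ∑ j, star (rowMul (φ j) R') *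
        (schur (blockKer (lab j)) T * rowMul (φ j) R) := by
      rw [hM, schur_sumKer_mul, Finset.mul_sum]
      refine Finset.sum_congr rfl fun j _ => ?_
      rw [star_mul_rowMul]
      change star (rowMul (star (φ j)) R') * _ = _
      rw [hstar]
    have e2 : inner ℂ (rep π (M * R) v) (rep π R' w) =
        ∑ j, inner ℂ (rep π (schur (blockKer (lab j)) T) (rep π (rowMul (φ j) R) v))
          (rep π (rowMul (φ j) R') w) := by
      rw [← inner_rep π hR' (hgM.mul hR), e1,
        rep_sum π _ fun j _ => (hgR' j).star.mul ((hgχ j).mul (hgR j)), _root_.sum_apply, sum_inner]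
      refine Finset.sum_congr rfl fun j _ => ?_
      rw [inner_rep π (hgR' j) ((hgχ j).mul (hgR j)), rep_mul π (hgχ j) (hgR j)]
      rfl
    rw [e2]
    calc _ ≤ ∑ j, m * (‖rep π (rowMul (φ j) R) v‖ * ‖rep π (rowMul (φ j) R') w‖) := by
          refine (norm_sum_le _ _).trans (Finset.sum_le_sum fun j _ => ?_)
          refine (norm_inner_le_norm _ _).trans ?_
          rw [← mul_assoc]
          refine mul_le_mul_of_nonneg_right ?_ (norm_nonneg _)
          exact ContinuousLinearMap.le_of_opNorm_le _
            (norm_rep_blockKer_le π hm (hr j) hT hc) _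
      _ = m * ∑ j, ‖rep π (rowMul (φ j) R) v‖ * ‖rep π (rowMul (φ j) R') w‖ := by
          rw [Finset.mul_sum]
      _ ≤ m * (√(∑ j, ‖rep π (rowMul (φ j) R) v‖ ^ 2) *
            √(∑ j, ‖rep π (rowMul (φ j) R') w‖ ^ 2)) := by
          gcongr
          exact Real.sum_mul_le_sqrt_mul_sqrt _ _ _
      _ = _ := by
          rw [sum_norm_rep_rowMul π φ hD2 hR, sum_norm_rep_rowMul π φ hD2 hR',
            Real.sqrt_sq (norm_nonneg _), Real.sqrt_sq (norm_nonneg _)]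
  have h2 : ∀ (R : ∀ i, RCMat (Xs i) A), IsGood Γ R → ‖rep π (M * R)‖ ≤ m * ‖rep π R‖ := by
    intro R hR
    refine ContinuousLinearMap.opNorm_le_bound _ (by positivity) fun v => ?_
    have h3 := key R (M * R) hR (hgM.mul hR) v v
    rw [inner_self_eq_norm_sq_to_K, norm_pow, RCLike.norm_ofReal, abs_norm] at h3
    have h4 : ‖rep π (M * R) v‖ ≤ m * ‖rep π R v‖ := by
      rcases (norm_nonneg (rep π (M * R) v)).eq_or_lt with h0 | h0
      · rw [← h0]
        positivity
      · nlinarith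
    refine h4.trans ?_
    rw [mul_assoc]
    exact mul_le_mul_of_nonneg_left ((rep π R).le_opNorm v) hm.le
  -- Choosing `R = M*` frees the estimate from its right factor: `‖π M‖² = ‖π(M M*)‖ ≤ m ‖π M‖`.
  have h5 := h2 (star M) hgM.star
  have h6 := norm_rep_sq π hgM.star
  rw [star_star] at h6
  rw [h6, rep_star π hgM, norm_star] at h5
  rcases (norm_nonneg (rep π M)).eq_or_lt with h0 | h0
  · rw [← h0]
    exact hm.le
  · nlinarith

/-- Kernels that witness property A uniformly over a family of spaces. -/
def HasKernels {I : Type u} (Xs : I → Type u) [∀ i, MetricSpace (Xs i)] : Prop :=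
  ∀ R : ℝ, 0 < R → ∀ ε : ℝ, 0 < ε → ∃ (n : ℕ) (lab : Fin n → ∀ i, Xs i → Option (Xs i))
    (D : Fin n → ∀ i, Xs i → ℝ) (r : ℝ), (∀ i x, ∑ j, D j i x ^ 2 = 1) ∧
    (∀ j i x z, lab j i x = some z → dist z x ≤ r) ∧
    ∀ i x y, dist x y ≤ R → ‖1 - sumKer lab D i x y‖ ≤ ε

/-- Under property A, a representation is bounded by the norms of the finite compressions. -/
theorem norm_rep_le_of_matNorm (hA : HasKernels Xs) {T : ∀ i, RCMat (Xs i) A} (hT : IsGood Γ T)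
    {m : ℝ} (hm : 0 ≤ m) (hc : ∀ i (B : Finset (Xs i)), matNorm (compress (T i) B) ≤ m) :
    ‖rep π T‖ ≤ m := by
  obtain ⟨R, hR, hprop⟩ := hT.exists_prop
  obtain ⟨M, hM, hbdd⟩ := hT.exists_bdd
  obtain ⟨C, hC, hCK⟩ := exists_norm_rep_le.{u, v} Xs Γ R
  refine le_of_forall_pos_le_add fun δ hδ => ?_
  -- The kernel is taken so close to `1` on the propagation strip that the difference, which keeps
  -- propagation `R` and entries at most this number times `M`, contributes no more than `δ / 2`.
  obtain ⟨n, lab, D, r, hD, hr, hk⟩ := hA R hR (δ / 2 / ((C + 1) * M)) (by positivity)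
  obtain ⟨hg, hle⟩ := norm_rep_sumKer_le π hD (m := m + δ / 2) (by positivity) hr hT
    fun i B => (hc i B).trans (by linarith)
  have hg2 := hT.sub hg
  have h1 : rep π T = rep π (schur (sumKer lab D) T) + rep π (T - schur (sumKer lab D) T) := by
    rw [rep_sub π hT hg, add_sub_cancel]
  have hent : ∀ i x y, ((T - schur (sumKer lab D) T) i).entry x y =
      (1 - sumKer lab D i x y) • (T i).entry x y := by
    intro i x y
    rw [sub_smul, one_smul]
    rfl
  have h2 : ‖rep π (T - schur (sumKer lab D) T)‖ ≤ C * (δ / 2 / ((C + 1) * M) * M) := by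
    refine hCK K π _ _ (by positivity) hg2 (fun i x y h => ?_) fun i x y => ?_
    · rw [hent] at h
      exact (hprop i x y fun h0 => h (by rw [h0, smul_zero])).le
    · rw [hent]
      by_cases h0 : (T i).entry x y = 0
      · rw [h0, smul_zero, norm_zero]
        positivity
      · rw [norm_smul]
        exact mul_le_mul (hk i x y (hprop i x y h0).le) (hbdd i x y) (norm_nonneg _) (by positivity)
  have h3 : C * (δ / 2 / ((C + 1) * M) * M) ≤ δ / 2 := by
    have : C * (δ / 2 / ((C + 1) * M) * M) = C / (C + 1) * (δ / 2) := by field_simp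
    rw [this]
    exact mul_le_of_le_one_left (by positivity) ((div_le_one (by positivity)).2 (by linarith))
  rw [h1]
  refine (norm_add_le _ _).trans ?_
  linarith

end Kernel

/-! ### From equi-property A to kernels -/

section PropertyA

/-- Greedy colouring along a well-ordering. -/
theorem exists_coloring {Z : Type*} {L : ℕ} (s : Z → Finset Z) (hs : ∀ x, (s x).card ≤ L) :
    ∃ col : Z → Fin (L + 1), ∀ x y, y ∈ s x → x ∈ s y → col x = col y → x = y := by
  classical
  have key : ∀ (x : Z) (g : Z → Fin (L + 1)), ∃ c, c ∉ (s x).image g := by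
    intro x g
    -- At most `L` colours occur on `s x`, so one of the `L + 1` is free.
    obtain ⟨c, -, hc⟩ := Finset.exists_mem_notMem_of_card_lt_card (s := (s x).image g)
      (t := Finset.univ) (by
        rw [Finset.card_univ, Fintype.card_fin]
        exact Nat.lt_succ_of_le (Finset.card_image_le.trans (hs x)))
    exact ⟨c, hc⟩
  choose F hF using key
  have wf : WellFounded (WellOrderingRel : Z → Z → Prop) := IsWellFounded.wf
  let col : Z → Fin (L + 1) := wf.fix fun x rec =>
    F x fun y => if h : WellOrderingRel y x then rec y h else 0
  have hcol : ∀ x y, y ∈ s x → WellOrderingRel y x → col x ≠ col y := by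
    intro x y hy hlt heq
    have h1 : col x = F x fun y => if WellOrderingRel y x then col y else 0 := wf.fix_eq _ x
    refine hF x (fun y => if WellOrderingRel y x then col y else 0) ?_
    rw [← h1, heq]
    exact Finset.mem_image.2 ⟨y, hy, if_pos hlt⟩
  refine ⟨col, fun x y hy hx heq => ?_⟩
  rcases trichotomous_of WellOrderingRel x y with h | h | h
  · exact absurd heq.symm (hcol y x hx h)
  · exact h
  · exact absurd heq (hcol x y hy h)

variable {X I : Type u} [MetricSpace X]

instance [BoundedGeometry X] (Xs : I → Set X) : UniformGeometry fun i => Xs i where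
  exists_ball := fun r => by
    obtain ⟨L, hL⟩ := BoundedGeometry.bound (X := X) (max r 1) (by positivity)
    refine ⟨L, fun i x => ?_⟩
    have h1 : (Subtype.val ⁻¹' Metric.closedBall (x : X) (max r 1) : Set (Xs i)).encard ≤ L := by
      rw [← Subtype.val_injective.encard_image]
      exact (Set.encard_le_encard (Set.image_preimage_subset _ _)).trans (hL x)
    have hfin := Set.finite_of_encard_le_coe h1
    refine ⟨hfin.toFinset, ?_, fun y hy => ?_⟩
    · rw [hfin.encard_eq_coe_toFinset_card] at h1
      exact_mod_cast h1
    · rw [Set.Finite.mem_toFinset, Set.mem_preimage, Metric.mem_closedBall, dist_comm]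
      exact hy.trans (le_max_left _ _)

/-- Colour the points so that equally coloured ones are more than `2S` apart. Then every `x` sees at
most one point `z` of colour `j` within `S`. Call it the label of `x` and put `Dⱼ(x) = ξ_x(z)`.
Splitting `⟨ξ_x, ξ_y⟩` by colours yields `sumKer`, since `x` and `y` share a nonzero coordinate of
colour `j` only if their labels agree. -/
theorem hasKernels_of_equiPropertyA [BoundedGeometry X] {Xs : I → Set X} (h : EquiPropertyA Xs) :
    HasKernels fun i => Xs i := by
  classical
  intro R hR ε hε
  obtain ⟨S, hS, ξ, -, hnorm, ⟨δ, hδ, hdist⟩, hsupp⟩ := h R hR ε hε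
  obtain ⟨L, hL⟩ := UniformGeometry.exists_ball (Xs := fun i => Xs i) (S + S)
  choose s hs hs' using hL
  have hcol := fun i => exists_coloring (s i) (hs i)
  choose col hcol using hcol
  have huniq : ∀ i (x z z' : Xs i), dist z x < S → dist z' x < S → col i z = col i z' → z = z' := by
    intro i x z z' h1 h2 h3
    have h4 : dist z z' ≤ S + S :=
      (dist_triangle z x z').trans (add_le_add h1.le (by rw [dist_comm]; exact h2.le))
    exact hcol i z z' (hs' i z z' h4) (hs' i z' z (by rwa [dist_comm])) h3
  let lab : Fin (L + 1) → ∀ i, Xs i → Option (Xs i) := fun j i x =>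
    if hz : ∃ z, col i z = j ∧ dist z x < S then some hz.choose else none
  have hlab : ∀ j i x z, lab j i x = some z ↔ col i z = j ∧ dist z x < S := by
    intro j i x z
    by_cases hz : ∃ z, col i z = j ∧ dist z x < S
    · have e : lab j i x = some hz.choose := dif_pos hz
      rw [e, Option.some.injEq]
      refine ⟨fun h => h ▸ hz.choose_spec, fun h => ?_⟩
      exact huniq i x _ _ hz.choose_spec.2 h.2 (hz.choose_spec.1.trans h.1.symm)
    · have e : lab j i x = none := dif_neg hz
      rw [e]
      exact ⟨fun h => absurd h (by simp), fun h => absurd ⟨z, h⟩ hz⟩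
  -- The value is `0` when no point of colour `j` is near `x`, so such colours contribute nothing to
  -- `∑ⱼ Dⱼ(x)²`.
  let D : Fin (L + 1) → ∀ i, Xs i → ℝ := fun j i x => (lab j i x).elim 0 fun z => ξ i x z
  have hinner : ∀ i (x y : Xs i), sumKer lab D i x y = ((inner ℝ (ξ i x) (ξ i y) : ℝ) : ℂ) := by
    intro i x y
    set F : Finset (Xs i) := (s i x).filter fun z => dist z x < S ∧ dist z y < S with hF
    have hFm : ∀ z, z ∈ F ↔ dist z x < S ∧ dist z y < S := by
      intro z
      rw [hF, Finset.mem_filter]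
      refine ⟨fun h => h.2, fun h => ⟨hs' i x z ?_, h⟩⟩
      rw [dist_comm]
      linarith [h.1]
    have h1 : inner ℝ (ξ i x) (ξ i y) = ∑ z ∈ F, ξ i x z * ξ i y z := by
      rw [lp.inner_eq_tsum, tsum_eq_sum (s := F)]
      · exact Finset.sum_congr rfl fun z _ => mul_comm _ _
      · intro z hz
        rw [hFm, not_and_or] at hz
        rcases hz with hz | hz
        · have : ξ i x z = 0 := by
            by_contra h0
            exact hz (hsupp i x z h0)
          rw [this, inner_zero_left]
        · have : ξ i y z = 0 := by
            by_contra h0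
            exact hz (hsupp i y z h0)
          rw [this, inner_zero_right]
    rw [h1, ← Finset.sum_fiberwise F (col i), Complex.ofReal_sum, sumKer]
    refine Finset.sum_congr rfl fun j _ => ?_
    by_cases hz : ∃ z, lab j i x = some z ∧ lab j i y = some z
    · rw [blockKer, if_pos hz, mul_one]
      obtain ⟨z, hzx, hzy⟩ := hz
      have hzx' := (hlab j i x z).1 hzx
      have hzy' := (hlab j i y z).1 hzy
      have hs1 : F.filter (fun w => col i w = j) = {z} := by
        ext w
        rw [Finset.mem_filter, Finset.mem_singleton, hFm]
        constructor
        · rintro ⟨hw, hw'⟩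
          exact huniq i x w z hw.1 hzx'.2 (hw'.trans hzx'.1.symm)
        · rintro rfl
          exact ⟨⟨hzx'.2, hzy'.2⟩, hzx'.1⟩
      rw [hs1, Finset.sum_singleton, Complex.ofReal_mul]
      simp only [D, hzx, hzy, Option.elim_some]
    · rw [blockKer, if_neg hz, mul_zero, Finset.filter_eq_empty_iff.2, Finset.sum_empty,
        Complex.ofReal_zero]
      intro w hw hj
      rw [hFm] at hw
      exact hz ⟨w, (hlab j i x w).2 ⟨hj, hw.1⟩, (hlab j i y w).2 ⟨hj, hw.2⟩⟩
  refine ⟨L + 1, lab, D, S, fun i x => ?_, fun j i x z hz => ((hlab j i x z).1 hz).2.le,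
    fun i x y hxy => ?_⟩
  · have h1 := hinner i x x
    rw [real_inner_self_eq_norm_sq, hnorm, one_pow] at h1
    have h2 : sumKer lab D i x x = ((∑ j, D j i x ^ 2 : ℝ) : ℂ) := by
      rw [sumKer, Complex.ofReal_sum]
      refine Finset.sum_congr rfl fun j _ => ?_
      rw [Complex.ofReal_pow, sq]
      by_cases hz : ∃ z, lab j i x = some z ∧ lab j i x = some z
      · rw [blockKer, if_pos hz, mul_one]
      · have hn : lab j i x = none := by
          rcases hl : lab j i x with - | z
          · rfl
          · exact absurd ⟨z, hl, hl⟩ hz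
        simp only [D, hn, Option.elim_none, Complex.ofReal_zero, zero_mul]
    rw [h2] at h1
    exact_mod_cast h1
  · rw [hinner, ← Complex.ofReal_one, ← Complex.ofReal_sub, Complex.norm_real, Real.norm_eq_abs]
    have h1 := norm_sub_sq_real (ξ i x) (ξ i y)
    rw [hnorm, hnorm] at h1
    -- For unit vectors `1 - ⟨ξ_x, ξ_y⟩ = ‖ξ_x - ξ_y‖² / 2`. As the distance is at most `2`, this is
    -- at most the distance itself.
    have h2 : ‖ξ i x - ξ i y‖ ≤ 2 := (norm_sub_le _ _).trans (by rw [hnorm, hnorm]; norm_num)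
    have h3 := hdist i x y hxy
    have h4 := norm_nonneg (ξ i x - ξ i y)
    rw [abs_of_nonneg (by nlinarith)]
    nlinarith

end PropertyA

/-! ### Twisted families are the good families of the gauge of smooth elements -/

section Twisted

variable {X Y H I : Type u} [MetricSpace X] [MetricSpace Y] [BoundedGeometry Y]
  [NormedAddCommGroup H] [InnerProductSpace ℝ H]

theorem fibreSpan_mono (f : Y → H) {n n' : ℕ} (h : n ≤ n') (y : Y) :
    fibreSpan f n y ≤ fibreSpan f n' y := by
  refine Submodule.span_mono (Set.image_mono fun y' hy' => ?_)
  have h1 : dist y y' ≤ (n : ℝ) ^ 2 := hy'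
  have h2 : (n : ℝ) ≤ n' := by exact_mod_cast h
  exact h1.trans (by gcongr)

theorem fibreSpan_le_totalSpan (f : Y → H) (n : ℕ) (y : Y) : fibreSpan f n y ≤ totalSpan f :=
  Submodule.span_mono (Set.image_subset_range _ _)

/-- The `C¹`-filtration of the algebras `𝒜_{O_i}`. -/
def hktGauge [CompleteSpace H] (f : Y → H) (p : X → Y) (O : I → Set (HKTSpace H)) (x₀ : I → X) :
    Gauge I (HKTFun H) where
  Mem i N c a := a ∈ hktIdeal (totalSpan f) (O i) ∧ IsSmooth (fibreSpan f N (p (x₀ i))) c a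
  nonneg h := h.2.nonneg
  mono h hc := ⟨h.1, h.2.mono hc⟩
  lift h hN := ⟨h.1, h.2.lift (fibreSpan_mono f hN _)⟩
  zero := ⟨zero_mem_hktIdeal, isSmooth_zero⟩
  add h h' := ⟨add_mem_hktIdeal h.1 h'.1, h.2.add h'.2⟩
  smul r h := ⟨smul_mem_hktIdeal r h.1, h.2.smul r⟩
  mul h h' := ⟨mul_mem_hktIdeal h.1 h'.1.1, h.2.mul h'.2⟩
  star h := ⟨star_mem_hktIdeal h.1, h.2.star⟩
  quasiInverse := fun {i N c a m z} h hm hz => by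
    obtain ⟨b, h1, h2, h3⟩ := h.2.exists_quasiInverse hm hz
    have hz0 : z ≠ 0 := fun h0 => by
      rw [h0, norm_zero] at hz
      linarith [norm_nonneg a]
    exact ⟨b, ⟨quasiInverse_mem_hktIdeal h.1 (h1.mem_hktAlgebra (fibreSpan_le_totalSpan f N _))
      hz0 h2, h1⟩, h2, h3⟩

section Local

variable {W : Submodule ℝ H} [FiniteDimensional ℝ W]

theorem beta_sum_smul {n : ℕ} (t : Fin n → ℂ) (F : Fin n → C₀(ℝ × W, Cliff H)) :
    beta W (∑ m, t m • F m) = ∑ m, t m • beta W (F m) := by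
  let L : C₀(ℝ × W, Cliff H) →ₗ[ℂ] HKTFun H :=
    { toFun := beta W, map_add' := beta_add, map_smul' := beta_smul }
  exact (map_sum L _ _).trans (Finset.sum_congr rfl fun m _ => L.map_smul _ _)

theorem beta_injOn {F G : C₀(ℝ × W, Cliff H)} (hF : F ∈ hktLocal W) (hG : G ∈ hktLocal W)
    (h : beta W F = beta W G) : F = G := by
  have h1 := norm_le_two_mul_norm_beta (Submodule.sub_mem _ hF hG)
  have h2 : beta W (F - G) = 0 := by
    have := beta_add (F - G) G
    rw [sub_add_cancel, h] at this
    exact (left_eq_add (a := beta W G) (b := beta W (F - G))).1 (by rwa [add_comm])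
  rw [h2, norm_zero, mul_zero] at h1
  exact sub_eq_zero.1 (norm_le_zero_iff.1 h1)

theorem hasLineDerivAt_sum_smul {n : ℕ} (t : Fin n → ℂ) {F D : Fin n → C₀(ℝ × W, Cliff H)}
    {Z : ℝ × W} (h : ∀ m q, HasLineDerivAt ℝ (F m) (D m q) q Z) (q : ℝ × W) :
    HasLineDerivAt ℝ (∑ m, t m • F m : C₀(ℝ × W, Cliff H)) ((∑ m, t m • D m) q) q Z := by
  suffices ∀ s : Finset (Fin n), HasLineDerivAt ℝ
      (∑ m ∈ s, t m • F m : C₀(ℝ × W, Cliff H)) ((∑ m ∈ s, t m • D m) q) q Z from this _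
  intro s
  induction s using Finset.induction_on with
  | empty =>
    simp only [Finset.sum_empty]
    exact hasDerivAt_const (0 : ℝ) (0 : Cliff H)
  | insert a s ha ih =>
    rw [Finset.sum_insert ha, Finset.sum_insert ha]
    exact HasDerivAt.add (HasDerivAt.const_smul (t a) (h a q)) ih

/-- Directions with `s ≤ 0` are negatives of directions in the half space. The factor `2` passes
from the norm of `β_W(D)` to that of `D`, which needs `D` to take values in the Clifford algebra of
`W`. -/
theorem hasC1Bound_of_halfSpace {F : C₀(ℝ × W, Cliff H)} (hF : F ∈ hktLocal W) {c : ℝ}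
    (h : ∀ (s : ℝ) (w : W), 0 ≤ s → s ^ 2 + ‖w‖ ^ 2 ≤ 1 → ∃ D : C₀(ℝ × W, Cliff H),
      (∀ q, HasLineDerivAt ℝ F (D q) q (s, w)) ∧ ‖beta W D‖ ≤ c) : HasC1Bound F (2 * c) := by
  have key : ∀ Z D, (∀ q, HasLineDerivAt ℝ F (D q) q Z) → ‖beta W D‖ ≤ c → ‖D‖ ≤ 2 * c :=
    fun Z D hD hc => (norm_le_two_mul_norm_beta (HasC1Bound.deriv_mem hF hD)).trans (by linarith)
  rintro ⟨s, w⟩ hZ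
  rcases le_total 0 s with hs | hs
  · obtain ⟨D, h1, h2⟩ := h s w hs hZ
    exact ⟨D, h1, key _ D h1 h2⟩
  · obtain ⟨D, h1, h2⟩ := h (-s) (-w) (by linarith) (by rw [norm_neg, neg_sq]; exact hZ)
    refine ⟨-D, fun q => ?_, by rw [norm_neg]; exact key _ D h1 h2⟩
    have := (h1 q).smul (-1)
    rwa [neg_one_smul, neg_one_smul, Prod.neg_mk, neg_neg, neg_neg] at this

end Local

theorem sum_smul_mem_hktIdeal [CompleteSpace H] {V : Submodule ℝ H} {O : Set (HKTSpace H)} {n : ℕ}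
    (t : Fin n → ℂ) {a : Fin n → HKTFun H} (h : ∀ m, a m ∈ hktIdeal V O) :
    ∑ m, t m • a m ∈ hktIdeal V O :=
  Finset.sum_induction _ (· ∈ hktIdeal V O) (fun _ _ => add_mem_hktIdeal) zero_mem_hktIdeal
    fun m _ => smul_mem_hktIdeal _ (h m)

variable {f : Y → H} {p : X → Y} {O : I → Set (HKTSpace H)} {x₀ : I → X} {Xs : I → Set X}

theorem IsTwisted.isGood [CompleteSpace H] {T : ∀ i, RCMat (Xs i) (HKTFun H)}
    (h : IsTwisted f p O x₀ Xs T) : IsGood (hktGauge f p O x₀) T where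
  prop := by
    obtain ⟨S, -, hS⟩ := h.propagation
    exact ⟨S, hS⟩
  bdd := by
    obtain ⟨M, -, hM⟩ := h.bounded
    exact ⟨M, fun i x y => (hM i x y).le⟩
  fin := fun i => by
    obtain ⟨n, t, a, -, -, he⟩ := h.mem_tensor i
    refine ⟨Submodule.span ℂ (Set.range a), Submodule.fg_span (Set.finite_range a), fun x y => ?_⟩
    rw [he]
    exact Submodule.sum_mem _ fun m _ => Submodule.smul_mem _ _ (Submodule.subset_span ⟨m, rfl⟩)
  mem := by
    obtain ⟨N, T₁, h1, h2, c, hc, h3⟩ := h.smooth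
    refine ⟨N, 2 * c + 2 * c, by positivity, fun i x y => ⟨?_, ?_⟩⟩
    · obtain ⟨n, t, a, -, ha, he⟩ := h.mem_tensor i
      rw [he]
      exact sum_smul_mem_hktIdeal _ ha
    · have hmem : T₁ i x y ∈ hktLocal (fibreSpan f N (p (x₀ i))) := by
        obtain ⟨n, t, a, -, ha, he⟩ := h1 i
        rw [he]
        exact Submodule.sum_mem _ fun m _ => Submodule.smul_mem _ _ (ha m)
      rw [← h2]
      refine isSmooth_beta hmem (hasC1Bound_of_halfSpace hmem fun s w hs hw => ?_)
      obtain ⟨D, -, hD1, hD2⟩ := h3 i s w hs hw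
      exact ⟨D x y, hD1 x y, hD2 x y⟩

/-- For each `i` the entries span a finite-dimensional space of smooth elements, so coordinates give
elementary tensors and lift to `𝒜(W)`. Being good is visibly stable under the algebra operations,
and this equivalence transfers the stability to the original definition. -/
theorem IsGood.isTwisted [CompleteSpace H] {T : ∀ i, RCMat (Xs i) (HKTFun H)}
    (h : IsGood (hktGauge f p O x₀) T) : IsTwisted f p O x₀ Xs T := by
  classical
  obtain ⟨S, hS0, hS⟩ := h.exists_prop
  obtain ⟨M, hM0, hM⟩ := h.exists_bdd
  obtain ⟨N, c, hc, hmem⟩ := h.mem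
  have hcoord := fun i => Gauge.exists_coords (Γ := hktGauge f p O x₀) (Z := Xs i × Xs i) i
    (d := fun z => (T i).entry z.1 z.2) (fun z => hM i z.1 z.2) (fun z => hmem i z.1 z.2)
    (by
      obtain ⟨U, hU, hU'⟩ := h.fin i
      exact ⟨U, hU, fun z => hU' z.1 z.2⟩)
  choose n t a C ha1 _ha ht he using hcoord
  have hF := fun i m => (ha1 i m).2.exists_beta
  choose F hFm hFc hFa using hF
  -- The coordinate matrices are cut off outside the propagation strip, where the entries of `T`
  -- vanish, to make them elements of the uniform Roe algebra.
  set t' : ∀ i, Fin (n i) → Xs i → Xs i → ℂ := fun i m x y =>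
    if dist x y < S then t i (x, y) m else 0 with ht'
  have ht'u : ∀ i m, t' i m ∈ uniformRoe (Xs i) := by
    refine fun i m => ⟨⟨S, hS0, fun x y hxy => if_neg (not_lt.2 hxy)⟩, max (C i) 0, fun x y => ?_⟩
    simp only [ht']
    split_ifs
    · exact (ht i (x, y) m).trans (le_max_left _ _)
    · rw [norm_zero]
      exact le_max_right _ _
  have he' : ∀ i x y, (T i).entry x y = ∑ m, t' i m x y • a i m := by
    intro i x y
    by_cases hxy : dist x y < S
    · simp only [ht', if_pos hxy]
      exact he i (x, y)
    · simp only [ht', if_neg hxy, zero_smul, Finset.sum_const_zero]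
      by_contra h0
      exact hxy (hS i x y h0)
  set T₁ : ∀ i, Xs i → Xs i → C₀(ℝ × fibreSpan f N (p (x₀ i)), Cliff H) := fun i x y =>
    ∑ m, t' i m x y • F i m with hT₁
  have hT₁m : ∀ i x y, T₁ i x y ∈ hktLocal (fibreSpan f N (p (x₀ i))) := fun i x y =>
    Submodule.sum_mem _ fun m _ => Submodule.smul_mem _ _ (hFm i m)
  have hT₁b : ∀ i x y, beta (fibreSpan f N (p (x₀ i))) (T₁ i x y) = (T i).entry x y := by
    intro i x y
    rw [he', hT₁]
    dsimp only
    rw [beta_sum_smul]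
    exact Finset.sum_congr rfl fun m _ => by rw [hFa]
  refine ⟨fun i => ⟨n i, t' i, a i, ht'u i, fun m => (ha1 i m).1, he' i⟩, ⟨S, hS0, hS⟩,
    ⟨M + 1, by positivity, fun i x y => (hM i x y).trans_lt (by linarith)⟩, N, T₁,
    fun i => ⟨n i, t' i, F i, ht'u i, hFm i, fun x y => rfl⟩, hT₁b, 2 * (c + c) + 1,
    by positivity, fun i s w _ hsw => ?_⟩
  choose D hD _hDc using fun m => hFc i m (s, w) hsw
  refine ⟨fun x y => ∑ m, t' i m x y • D m, ⟨n i, t' i, D, ht'u i,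
    fun m => HasC1Bound.deriv_mem (hFm i m) (hD m), fun x y => rfl⟩,
    fun x y q => hasLineDerivAt_sum_smul _ hD q, fun x y => ?_⟩
  -- Coordinates are not bounded uniformly in `i`, so the derivative is not estimated through them.
  -- The entry itself has a lift `G` with uniform bound `c + c`. By injectivity of `β_W` it equals
  -- `T₁ i x y`, and derivatives are unique.
  obtain ⟨G, hG, hGc, hGb⟩ := (hmem i x y).2.exists_beta
  have hGT : G = T₁ i x y := beta_injOn hG (hT₁m i x y) (hGb.trans (hT₁b i x y).symm)
  obtain ⟨D', hD', hD'c⟩ := hGc (s, w) hsw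
  have hDD : ∑ m, t' i m x y • D m = D' := by
    ext1 q
    rw [hGT] at hD'
    exact (hasLineDerivAt_sum_smul (fun m => t' i m x y) hD q).unique (hD' q)
  refine (norm_beta_le _).trans ?_
  dsimp only
  rw [hDD]
  linarith

theorem isTwisted_iff [CompleteSpace H] {T : ∀ i, RCMat (Xs i) (HKTFun H)} :
    IsTwisted f p O x₀ Xs T ↔ IsGood (hktGauge f p O x₀) T :=
  ⟨IsTwisted.isGood, IsGood.isTwisted⟩

theorem twistedSubalgebra_eq [BoundedGeometry X] [CompleteSpace H] :
    twistedSubalgebra f p O x₀ Xs = goodAlgebra (hktGauge f p O x₀) (fun i => Xs i) := by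
  refine le_antisymm (NonUnitalStarAlgebra.adjoin_le fun T hT => IsTwisted.isGood hT) fun T hT => ?_
  exact NonUnitalStarAlgebra.subset_adjoin ℂ _ (IsGood.isTwisted hT)

end Twisted

/-! ### The reduced norm dominates finite compressions -/

section Reduced

variable {X H I : Type u} [MetricSpace X] [NormedAddCommGroup H] [InnerProductSpace ℝ H]
  {Xs : I → Set X} {V : Submodule ℝ H} {O : I → Set (HKTSpace H)}

theorem moduleNorm_eq (ξ : (Σ i, Xs i) → HKTFun H) :
    moduleNorm ξ = ENNReal.ofReal √‖∑' z, star (ξ z) * ξ z‖ := by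
  rw [moduleNorm, ← ofReal_norm, ENNReal.ofReal_rpow_of_nonneg (norm_nonneg _) (by norm_num),
    Real.sqrt_eq_rpow, one_div]

theorem norm_sum_star_mul_self_mono {A : Type*} [NonUnitalCStarAlgebra A] {ι : Type*}
    {s t : Finset ι} (h : s ⊆ t) (η : ι → A) :
    ‖∑ x ∈ s, star (η x) * η x‖ ≤ ‖∑ x ∈ t, star (η x) * η x‖ := by
  let _ := CStarAlgebra.spectralOrder A
  let _ := CStarAlgebra.spectralOrderedRing A
  refine CStarAlgebra.norm_le_norm_of_nonneg_of_le
    (Finset.sum_nonneg fun x _ => star_mul_self_nonneg _) ?_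
  exact Finset.sum_le_sum_of_subset_of_nonneg h fun x _ _ => star_mul_self_nonneg _

/-- Extend `ζ` by zero to a vector of the Hilbert module. Both series are then finite sums, and
restricting the image to `B` only decreases its norm, by positivity. -/
theorem norm_sum_le_of_redNorm_aux [CompleteSpace H] {T : ∀ i, RCMat (Xs i) (HKTFun H)} {m : ℝ}
    (hm : 0 ≤ m) (hred : redNorm V O T ≤ ENNReal.ofReal m) (i : I) (B : Finset (Xs i))
    {ζ : Xs i → HKTFun H} (hζ : ∀ y, ζ y ∈ hktIdeal V (O i)) (hsupp : ∀ y ∉ B, ζ y = 0)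
    (h1 : ‖∑ y ∈ B, star (ζ y) * ζ y‖ ≤ 1) :
    ‖∑ x ∈ B, star (∑ y ∈ B, (T i).entry x y * ζ y) * ∑ y ∈ B, (T i).entry x y * ζ y‖ ≤ m ^ 2 := by
  classical
  set v : (Σ i, Xs i) → HKTFun H := fun z => if h : z.1 = i then ζ (h ▸ z.2) else 0 with hv
  have hvi : ∀ y, v ⟨i, y⟩ = ζ y := fun y => dif_pos rfl
  have hvn : ∀ z : Σ i, Xs i, z.1 ≠ i → v z = 0 := fun z hz => dif_neg hz
  let e : Xs i ↪ Σ i, Xs i := Function.Embedding.sigmaMk (β := fun i => Xs i) i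
  have hout : ∀ z ∉ B.map e, star (v z) * v z = 0 := by
    rintro ⟨j, y⟩ hz
    have : v ⟨j, y⟩ = 0 := by
      by_cases hj : j = i
      · subst hj
        rw [hvi]
        exact hsupp y fun hy => hz (Finset.mem_map_of_mem e hy)
      · exact hvn _ hj
    rw [this, mul_zero]
  have hmod : IsModuleVector V O v := by
    refine ⟨?_, summable_of_ne_finset_zero (s := B.map e) hout⟩
    rintro ⟨j, y⟩
    by_cases hj : j = i
    · subst hj
      rw [hvi]
      exact subset_closure (hζ y)
    · rw [hvn _ hj]
      exact subset_closure zero_mem_hktIdeal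
  have hnorm : moduleNorm v ≤ 1 := by
    rw [moduleNorm_eq, tsum_eq_sum hout, Finset.sum_map]
    have : (∑ x ∈ B, star (v (e x)) * v (e x)) = ∑ y ∈ B, star (ζ y) * ζ y :=
      Finset.sum_congr rfl fun y _ => by
        change star (v ⟨i, y⟩) * v ⟨i, y⟩ = _
        rw [hvi]
    rw [this, ENNReal.ofReal_le_one]
    exact Real.sqrt_le_one.2 h1
  have hle : moduleNorm (matAct T v) ≤ ENNReal.ofReal m := by
    refine le_trans ?_ hred
    rw [redNorm]
    exact le_iSup_of_le (f := fun ξ => ⨆ (_ : IsModuleVector V O ξ) (_ : moduleNorm ξ ≤ 1),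
      moduleNorm (matAct T ξ)) v (le_iSup₂_of_le hmod hnorm le_rfl)
  have hact : ∀ x, matAct T v ⟨i, x⟩ = ∑ y ∈ B, (T i).entry x y * ζ y := by
    intro x
    change ∑ᶠ y : Xs i, (T i).entry x y * v ⟨i, y⟩ = _
    simp only [hvi]
    refine finsum_eq_sum_of_support_subset _ fun y hy => ?_
    by_contra hyB
    exact hy (by simp only [hsupp y hyB, mul_zero])
  have hactn : ∀ z : Σ i, Xs i, z.1 ≠ i → matAct T v z = 0 := by
    rintro ⟨j, x⟩ hj
    refine finsum_eq_zero_of_forall_eq_zero fun y => ?_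
    rw [hvn ⟨j, y⟩ hj, mul_zero]
  -- The support of the image lies in the rows that meet a column of `B`. The set `B` itself is
  -- added so that truncation to `B` is a passage to a subset.
  set F : Finset (Xs i) := B ∪ B.biUnion fun y => ((T i).finite_col y).toFinset with hF
  have hFout : ∀ z ∉ F.map e, star (matAct T v z) * matAct T v z = 0 := by
    rintro ⟨j, x⟩ hz
    have : matAct T v ⟨j, x⟩ = 0 := by
      by_cases hj : j = i
      · subst hj
        rw [hact]
        refine Finset.sum_eq_zero fun y hy => ?_
        have : (T j).entry x y = 0 := by
          by_contra h0
          refine hz (Finset.mem_map_of_mem e (Finset.mem_union_right _ ?_))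
          exact Finset.mem_biUnion.2 ⟨y, hy, by simpa using h0⟩
        rw [this, zero_mul]
      · exact hactn _ hj
    rw [this, mul_zero]
  rw [moduleNorm_eq, ENNReal.ofReal_le_ofReal_iff hm, tsum_eq_sum hFout, Finset.sum_map,
    Real.sqrt_le_left hm] at hle
  refine le_trans ?_ hle
  have : ∀ x, matAct T v (e x) = ∑ y ∈ B, (T i).entry x y * ζ y := hact
  simp only [this]
  exact norm_sum_star_mul_self_mono Finset.subset_union_left _

/-- Normalise `ζ` by `(κ + ε)^{-1/2}`, where `ε > 0` avoids a case distinction at `κ = 0`. -/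
theorem norm_sum_le_of_redNorm [CompleteSpace H] {T : ∀ i, RCMat (Xs i) (HKTFun H)} {m : ℝ}
    (hm : 0 ≤ m) (hred : redNorm V O T ≤ ENNReal.ofReal m) (i : I) (B : Finset (Xs i))
    {ζ : Xs i → HKTFun H} (hζ : ∀ y, ζ y ∈ hktIdeal V (O i)) (hsupp : ∀ y ∉ B, ζ y = 0) :
    ‖∑ x ∈ B, star (∑ y ∈ B, (T i).entry x y * ζ y) * ∑ y ∈ B, (T i).entry x y * ζ y‖ ≤
      m ^ 2 * ‖∑ y ∈ B, star (ζ y) * ζ y‖ := by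
  set κ := ‖∑ y ∈ B, star (ζ y) * ζ y‖ with hκ
  have hκ0 : 0 ≤ κ := norm_nonneg _
  have key : ∀ ε : ℝ, 0 < ε →
      ‖∑ x ∈ B, star (∑ y ∈ B, (T i).entry x y * ζ y) * ∑ y ∈ B, (T i).entry x y * ζ y‖ ≤
        m ^ 2 * (κ + ε) := by
    intro ε hε
    set c : ℝ := (√(κ + ε))⁻¹ with hc
    have hc2 : c * c = (κ + ε)⁻¹ := by
      rw [hc, ← mul_inv, Real.mul_self_sqrt (by positivity)]
    have hstar : ∀ a : HKTFun H, star ((c : ℂ) • a) * ((c : ℂ) • a) =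
        (((κ + ε)⁻¹ : ℝ) : ℂ) • (star a * a) := by
      intro a
      rw [star_smul, smul_mul_smul_comm, Complex.star_def, Complex.conj_ofReal, ← hc2,
        Complex.ofReal_mul]
    have hn : ∀ b : HKTFun H, ‖(((κ + ε)⁻¹ : ℝ) : ℂ) • b‖ = (κ + ε)⁻¹ * ‖b‖ := fun b => by
      rw [norm_smul, Complex.norm_real, Real.norm_of_nonneg (by positivity)]
    have h := norm_sum_le_of_redNorm_aux hm hred i B (ζ := fun y => (c : ℂ) • ζ y)
      (fun y => smul_mem_hktIdeal _ (hζ y)) (fun y hy => by rw [hsupp y hy, smul_zero]) (by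
        simp only [hstar]
        rw [← Finset.smul_sum, hn, ← hκ, inv_mul_le_one₀ (by positivity)]
        linarith)
    simp only [mul_smul_comm] at h
    simp only [← Finset.smul_sum, hstar] at h
    rw [hn, inv_mul_le_iff₀ (by positivity)] at h
    linarith
  refine le_of_forall_pos_le_add fun δ hδ => ?_
  refine (key (δ / (m ^ 2 + 1)) (by positivity)).trans ?_
  rw [mul_add]
  gcongr
  rw [mul_div_assoc', div_le_iff₀ (by positivity)]
  nlinarith

instance (V : Submodule ℝ H) : IsClosed (hktAlgebra V : Set (HKTFun H)) :=
  NonUnitalStarSubalgebra.isClosed_topologicalClosure _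

/-- The matrix is regarded over the C*-algebra `hktAlgebra V`, which does not change its norm. The
test vectors of `matNorm_le` have the form `M* ξ`, so their coordinates lie in `hktIdeal V (O i)`
and the module estimate applies to them. -/
theorem matNorm_compress_le_of_redNorm [CompleteSpace H] {T : ∀ i, RCMat (Xs i) (HKTFun H)}
    (hT : ∀ i x y, (T i).entry x y ∈ hktIdeal V (O i)) {m : ℝ} (hm : 0 ≤ m)
    (hred : redNorm V O T ≤ ENNReal.ofReal m) (i : I) (B : Finset (Xs i)) :
    matNorm (compress (T i) B) ≤ m := by
  classical
  let M₀ : B → B → hktAlgebra V := fun x y => ⟨(T i).entry x y, (hT i x y).1⟩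
  have h0 : matNorm (compress (T i) B) = matNorm M₀ :=
    matNorm_map (NonUnitalStarSubalgebraClass.subtype (hktAlgebra V)) Subtype.val_injective M₀
  rw [h0]
  refine matNorm_le hm fun ξ ζ hζ => ?_
  set ζ' : Xs i → HKTFun H := fun y => if h : y ∈ B then (ζ ⟨y, h⟩ : HKTFun H) else 0 with hζ'
  have hζ'B : ∀ y : B, ζ' y = (ζ y : HKTFun H) := fun y => dif_pos y.2
  have hmem : ∀ y, ζ' y ∈ hktIdeal V (O i) := by
    intro y
    by_cases hy : y ∈ B
    · rw [hζ'B ⟨y, hy⟩, hζ]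
      have : ((∑ x, star (M₀ x ⟨y, hy⟩) * ξ x : hktAlgebra V) : HKTFun H) =
          ∑ x : B, star ((T i).entry x y) * (ξ x : HKTFun H) := by
        rw [AddSubmonoidClass.coe_finsetSum]
        rfl
      rw [this]
      exact Finset.sum_induction _ (· ∈ hktIdeal V (O i)) (fun _ _ => add_mem_hktIdeal)
        zero_mem_hktIdeal fun x _ => mul_mem_hktIdeal (star_mem_hktIdeal (hT i x y)) (ξ x).2
    · rw [hζ']
      simp only [hy, dif_neg, not_false_eq_true]
      exact zero_mem_hktIdeal
  have h := norm_sum_le_of_redNorm hm hred i B hmem fun y hy => dif_neg hy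
  have e1 : ∀ x : Xs i, ∑ y ∈ B, (T i).entry x y * ζ' y =
      ∑ y : B, (T i).entry x y * (ζ y : HKTFun H) := by
    intro x
    rw [← Finset.sum_coe_sort]
    exact Finset.sum_congr rfl fun y _ => by rw [hζ'B]
  have e2 : ∑ y ∈ B, star (ζ' y) * ζ' y =
      ((∑ y, star (ζ y) * ζ y : hktAlgebra V) : HKTFun H) := by
    rw [AddSubmonoidClass.coe_finsetSum, ← Finset.sum_coe_sort]
    exact Finset.sum_congr rfl fun y _ => by
      rw [hζ'B]
      rfl
  have e3 : ∑ x ∈ B, star (∑ y ∈ B, (T i).entry x y * ζ' y) * ∑ y ∈ B, (T i).entry x y * ζ' y =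
      ((∑ x, star (∑ y, M₀ x y * ζ y) * ∑ y, M₀ x y * ζ y : hktAlgebra V) : HKTFun H) := by
    rw [AddSubmonoidClass.coe_finsetSum, ← Finset.sum_coe_sort]
    refine Finset.sum_congr rfl fun x _ => ?_
    rw [e1]
    have : ∑ y : B, (T i).entry x y * (ζ y : HKTFun H) =
        ((∑ y, M₀ x y * ζ y : hktAlgebra V) : HKTFun H) := by
      rw [AddSubmonoidClass.coe_finsetSum]
      rfl
    rw [this]
    rfl
  rw [e2, e3] at h
  exact h

end Reduced

/-! ### Square-summable families -/

section SquareSummable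

variable {Z : Type*} {K : Type*} [NormedAddCommGroup K]

theorem lp_sum_norm_sq_le (v : lp (fun _ : Z => K) 2) (s : Finset Z) :
    ∑ z ∈ s, ‖v z‖ ^ 2 ≤ ‖v‖ ^ 2 := by
  have := lp.sum_rpow_le_norm_rpow (p := 2) (by norm_num) v s
  simpa using this

theorem memℓp_two_of_sum_le {g : Z → K} {C : ℝ} (h : ∀ s : Finset Z, ∑ z ∈ s, ‖g z‖ ^ 2 ≤ C) :
    Memℓp g 2 :=
  memℓp_gen' (C := C) fun s => by simpa using h s

theorem lp_norm_le_of_sum_le {v : lp (fun _ : Z => K) 2} {C : ℝ} (hC : 0 ≤ C)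
    (h : ∀ s : Finset Z, ∑ z ∈ s, ‖v z‖ ^ 2 ≤ C ^ 2) : ‖v‖ ≤ C :=
  lp.norm_le_of_forall_sum_le (by norm_num) hC fun s => by simpa using h s

end SquareSummable

/-! ### The matrix representation on `⨁ᵢ ℓ²(X_i; K)` -/

section MatrixRepresentation

variable {I A : Type u} [NonUnitalCStarAlgebra A] {Xs : I → Type u} [∀ i, MetricSpace (Xs i)]
  [UniformGeometry Xs] {Γ : Gauge I A}
  {K : Type u} [NormedAddCommGroup K] [InnerProductSpace ℂ K] [CompleteSpace K]
  (φ : A →⋆ₙₐ[ℂ] (K →L[ℂ] K))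

/-- The action of matrices on `⨁ᵢ ℓ²(X_i; K)`. -/
def lpAct (T : ∀ i, RCMat (Xs i) A) (v : (Σ i, Xs i) → K) (z : Σ i, Xs i) : K :=
  ∑ᶠ y, φ ((T z.1).entry z.2 y) (v ⟨z.1, y⟩)

theorem lpAct_eq_sum (T : ∀ i, RCMat (Xs i) A) (v : (Σ i, Xs i) → K) (i : I) (x : Xs i)
    (s : Finset (Xs i)) (hs : ∀ y, (T i).entry x y ≠ 0 → y ∈ s) :
    lpAct φ T v ⟨i, x⟩ = ∑ y ∈ s, φ ((T i).entry x y) (v ⟨i, y⟩) :=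
  finsum_eq_sum_of_support_subset _ fun y hy => hs y fun h => hy (by simp [h])

theorem lpAct_eq_sum_row (T : ∀ i, RCMat (Xs i) A) (v : (Σ i, Xs i) → K) (i : I) (x : Xs i) :
    lpAct φ T v ⟨i, x⟩ =
      ∑ y ∈ ((T i).finite_row x).toFinset, φ ((T i).entry x y) (v ⟨i, y⟩) :=
  lpAct_eq_sum φ T v i x _ fun y hy => by simpa using hy

theorem norm_apply_le_of_hom (a : A) : ‖φ a‖ ≤ ‖a‖ := NonUnitalStarAlgHom.norm_apply_le φ a

/-- Each coordinate of the image involves at most `L` coordinates of `v`. Cauchy–Schwarz gives one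
factor `L`, and a second comes from counting how often a coordinate of `v` is used. -/
theorem exists_lpAct_bound {T : ∀ i, RCMat (Xs i) A} (hT : IsGood Γ T) : ∃ C : ℝ, 0 ≤ C ∧
    ∀ (v : lp (fun _ : Σ i, Xs i => K) 2) (s : Finset (Σ i, Xs i)),
      ∑ z ∈ s, ‖lpAct φ T v z‖ ^ 2 ≤ (C * ‖v‖) ^ 2 := by
  classical
  obtain ⟨S, hS⟩ := hT.prop
  obtain ⟨M, hM0, hM⟩ := hT.exists_bdd
  obtain ⟨L, hL⟩ := UniformGeometry.exists_ball (Xs := Xs) S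
  choose B' hB' hB'' using hL
  let B : ∀ i, Xs i → Finset (Xs i) := fun i x => (B' i x).filter fun y => dist x y ≤ S
  have hB : ∀ i x, (B i x).card ≤ L := fun i x => (Finset.card_filter_le _ _).trans (hB' i x)
  have hBm : ∀ i x y, y ∈ B i x ↔ dist x y ≤ S := fun i x y => by
    simp only [B, Finset.mem_filter]
    exact ⟨fun h => h.2, fun h => ⟨hB'' i x y h, h⟩⟩
  let b : (Σ i, Xs i) → Finset (Σ i, Xs i) := fun z =>
    (B z.1 z.2).map (Function.Embedding.sigmaMk (β := Xs) z.1)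
  have hbm : ∀ z w, w ∈ b z → z ∈ b w := by
    rintro ⟨i, x⟩ w hw
    obtain ⟨y, hy, rfl⟩ := Finset.mem_map.1 hw
    rw [hBm, dist_comm] at hy
    exact Finset.mem_map.2 ⟨x, (hBm i y x).2 hy, rfl⟩
  have hbc : ∀ z, (b z).card ≤ L := fun z => (Finset.card_map _).trans_le (hB _ _)
  refine ⟨L * M, by positivity, fun v s => ?_⟩
  have h1 : ∀ z, ‖lpAct φ T v z‖ ^ 2 ≤ L * M ^ 2 * ∑ w ∈ b z, ‖v w‖ ^ 2 := by
    rintro ⟨i, x⟩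
    rw [lpAct_eq_sum φ T v i x (B i x) fun y hy => (hBm i x y).2 (hS i x y hy).le]
    have h2 : ‖∑ y ∈ B i x, φ ((T i).entry x y) (v ⟨i, y⟩)‖ ≤ M * ∑ y ∈ B i x, ‖v ⟨i, y⟩‖ := by
      rw [Finset.mul_sum]
      refine (norm_sum_le _ _).trans (Finset.sum_le_sum fun y _ => ?_)
      exact ContinuousLinearMap.le_of_opNorm_le _
        ((norm_apply_le_of_hom φ _).trans (hM i x y)) _
    calc _ ≤ (M * ∑ y ∈ B i x, ‖v ⟨i, y⟩‖) ^ 2 := by gcongr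
      _ = M ^ 2 * (∑ y ∈ B i x, ‖v ⟨i, y⟩‖) ^ 2 := mul_pow _ _ _
      _ ≤ M ^ 2 * ((B i x).card * ∑ y ∈ B i x, ‖v ⟨i, y⟩‖ ^ 2) := by
          gcongr
          exact sq_sum_le_card_mul_sum_sq
      _ ≤ M ^ 2 * (L * ∑ y ∈ B i x, ‖v ⟨i, y⟩‖ ^ 2) := by
          gcongr
          exact hB i x
      _ = L * M ^ 2 * ∑ w ∈ b ⟨i, x⟩, ‖v w‖ ^ 2 := by
          rw [Finset.sum_map]
          simp only [Function.Embedding.sigmaMk_apply]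
          ring
  have h3 : ∑ z ∈ s, ∑ w ∈ b z, ‖v w‖ ^ 2 ≤ L * ‖v‖ ^ 2 := by
    rw [Finset.sum_comm' (s' := fun w => s.filter fun z => w ∈ b z) (t' := s.biUnion b)]
    · calc _ ≤ ∑ w ∈ s.biUnion b, L * ‖v w‖ ^ 2 := by
            refine Finset.sum_le_sum fun w _ => ?_
            rw [Finset.sum_const, nsmul_eq_mul]
            gcongr
            refine (Finset.card_le_card fun z hz => ?_).trans (hbc w)
            exact hbm z w (Finset.mem_filter.1 hz).2
        _ = L * ∑ w ∈ s.biUnion b, ‖v w‖ ^ 2 := by rw [Finset.mul_sum]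
        _ ≤ L * ‖v‖ ^ 2 := by
            gcongr
            exact lp_sum_norm_sq_le v _
    · intro z w
      simp only [Finset.mem_filter, Finset.mem_biUnion]
      exact ⟨fun h => ⟨h, z, h⟩, fun h => h.1⟩
  calc _ ≤ ∑ z ∈ s, L * M ^ 2 * ∑ w ∈ b z, ‖v w‖ ^ 2 := Finset.sum_le_sum fun z _ => h1 z
    _ = L * M ^ 2 * ∑ z ∈ s, ∑ w ∈ b z, ‖v w‖ ^ 2 := by rw [Finset.mul_sum]
    _ ≤ L * M ^ 2 * (L * ‖v‖ ^ 2) := by gcongr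
    _ = _ := by ring

/-- The operator on `⨁ᵢ ℓ²(X_i; K)` given by a good family of matrices. -/
def lpOp {T : ∀ i, RCMat (Xs i) A} (hT : IsGood Γ T) :
    lp (fun _ : Σ i, Xs i => K) 2 →L[ℂ] lp (fun _ : Σ i, Xs i => K) 2 :=
  LinearMap.mkContinuous
    { toFun := fun v => ⟨lpAct φ T v,
        memℓp_two_of_sum_le ((exists_lpAct_bound φ hT).choose_spec.2 v)⟩
      map_add' := fun v w => by
        ext ⟨i, x⟩
        simp only [lp.coeFn_add, Pi.add_apply, lpAct_eq_sum_row, map_add, Finset.sum_add_distrib]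
      map_smul' := fun c v => by
        ext ⟨i, x⟩
        simp only [lp.coeFn_smul, Pi.smul_apply, lpAct_eq_sum_row, map_smul, Finset.smul_sum,
          RingHom.id_apply] }
    (exists_lpAct_bound φ hT).choose fun v =>
      lp_norm_le_of_sum_le (mul_nonneg (exists_lpAct_bound φ hT).choose_spec.1 (norm_nonneg _))
        ((exists_lpAct_bound φ hT).choose_spec.2 v)

theorem lpOp_apply {T : ∀ i, RCMat (Xs i) A} (hT : IsGood Γ T)
    (v : lp (fun _ : Σ i, Xs i => K) 2) (z : Σ i, Xs i) : lpOp φ hT v z = lpAct φ T v z := rfl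

theorem lpOp_star {T : ∀ i, RCMat (Xs i) A} (hT : IsGood Γ T) :
    lpOp φ hT.star = star (lpOp φ hT) := by
  classical
  ext v ⟨i, y⟩
  refine ext_inner_right ℂ fun u => ?_
  rw [← lp.inner_single_right, ← lp.inner_single_right, ContinuousLinearMap.star_eq_adjoint,
    ContinuousLinearMap.adjoint_inner_left, lp.inner_single_right, lpOp_apply]
  have h1 : ∀ z, z ∉ ((T i).finite_col y).toFinset.map
      (Function.Embedding.sigmaMk (β := Xs) i) →
      lpOp φ hT (lp.single 2 ⟨i, y⟩ u) z = 0 := by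
    rintro ⟨j, x⟩ hz
    rw [lpOp_apply, lpAct_eq_sum_row]
    refine Finset.sum_eq_zero fun y' _ => ?_
    by_cases h : (⟨j, y'⟩ : Σ i, Xs i) = ⟨i, y⟩
    · obtain ⟨rfl, h'⟩ := Sigma.mk.inj_iff.1 h
      obtain rfl := eq_of_heq h'
      have : (T j).entry x y' = 0 := by
        by_contra h0
        exact hz (Finset.mem_map.2 ⟨x, by simpa using h0, rfl⟩)
      rw [this, map_zero]
      rfl
    · rw [lp.single_apply_ne _ _ _ h, map_zero]
  rw [lp.inner_eq_tsum, tsum_eq_sum fun z hz => by rw [h1 z hz, inner_zero_right], Finset.sum_map,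
    lpAct_eq_sum φ (star T) v i y ((T i).finite_col y).toFinset fun x hx => by
      rw [Set.Finite.mem_toFinset]
      exact fun h0 => hx (by
        change star ((T i).entry x y) = 0
        rw [h0, star_zero]), sum_inner]
  refine Finset.sum_congr rfl fun x _ => ?_
  have h2 : lpOp φ hT (lp.single 2 ⟨i, y⟩ u) ⟨i, x⟩ = φ ((T i).entry x y) u := by
    rw [lpOp_apply]
    change ∑ᶠ y', φ ((T i).entry x y') ((lp.single 2 (⟨i, y⟩ : Σ i, Xs i) u :
      lp (fun _ : Σ i, Xs i => K) 2) ⟨i, y'⟩) = _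
    rw [finsum_eq_single _ y, lp.single_apply_self]
    intro y' hy'
    rw [lp.single_apply_ne, map_zero]
    intro h
    exact hy' (eq_of_heq (Sigma.mk.inj_iff.1 h).2)
  rw [Function.Embedding.sigmaMk_apply, h2]
  change inner ℂ (φ (star ((T i).entry x y)) (v ⟨i, x⟩)) u = _
  rw [map_star, ContinuousLinearMap.star_eq_adjoint, ContinuousLinearMap.adjoint_inner_left]

/-- The representation of good families by matrices of operators. -/
def lpRep : goodAlgebra Γ Xs →⋆ₙₐ[ℂ]
    (lp (fun _ : Σ i, Xs i => K) 2 →L[ℂ] lp (fun _ : Σ i, Xs i => K) 2) where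
  toFun T := lpOp φ (Γ := Γ) T.2
  map_smul' c T := by
    ext v ⟨i, x⟩
    change lpAct φ (c • T.1) v ⟨i, x⟩ = c • lpAct φ T.1 v ⟨i, x⟩
    rw [lpAct_eq_sum_row φ T.1, lpAct_eq_sum φ (c • T.1) v i x ((T.1 i).finite_row x).toFinset,
      Finset.smul_sum]
    · refine Finset.sum_congr rfl fun y _ => ?_
      change φ (c • (T.1 i).entry x y) _ = _
      rw [map_smul]
      rfl
    · intro y hy
      rw [Set.Finite.mem_toFinset]
      exact fun h0 => hy (by
        change c • (T.1 i).entry x y = 0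
        rw [h0, smul_zero])
  map_zero' := by
    ext v ⟨i, x⟩
    change ∑ᶠ y, φ 0 (v ⟨i, y⟩) = 0
    simp
  map_add' S T := by
    classical
    ext v ⟨i, x⟩
    change lpAct φ (S.1 + T.1) v ⟨i, x⟩ = lpAct φ S.1 v ⟨i, x⟩ + lpAct φ T.1 v ⟨i, x⟩
    set s := ((S.1 i).finite_row x).toFinset ∪ ((T.1 i).finite_row x).toFinset
    have hS : ∀ y, (S.1 i).entry x y ≠ 0 → y ∈ s := fun y hy =>
      Finset.mem_union_left _ (by simpa using hy)
    have hT : ∀ y, (T.1 i).entry x y ≠ 0 → y ∈ s := fun y hy =>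
      Finset.mem_union_right _ (by simpa using hy)
    rw [lpAct_eq_sum φ S.1 v i x s hS, lpAct_eq_sum φ T.1 v i x s hT,
      lpAct_eq_sum φ (S.1 + T.1) v i x s, ← Finset.sum_add_distrib]
    · refine Finset.sum_congr rfl fun y _ => ?_
      change φ ((S.1 i).entry x y + (T.1 i).entry x y) _ = _
      rw [map_add]
      rfl
    · intro y hy
      by_contra h0
      refine hy ?_
      change (S.1 i).entry x y + (T.1 i).entry x y = 0
      rw [not_not.1 fun h => h0 (hS y h), not_not.1 fun h => h0 (hT y h), add_zero]
  map_mul' S T := by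
    classical
    ext v ⟨i, x⟩
    change lpAct φ (S.1 * T.1) v ⟨i, x⟩ = lpAct φ S.1 (lpAct φ T.1 v) ⟨i, x⟩
    set s := ((S.1 i).finite_row x).toFinset with hs
    have hS : ∀ y, (S.1 i).entry x y ≠ 0 → y ∈ s := fun y hy => by simpa [hs] using hy
    set t := s.biUnion fun w => ((T.1 i).finite_row w).toFinset with ht
    have hT : ∀ w ∈ s, ∀ y, (T.1 i).entry w y ≠ 0 → y ∈ t := fun w hw y hy =>
      Finset.mem_biUnion.2 ⟨w, hw, by simpa using hy⟩
    have hmul : ∀ y, ((S.1 * T.1) i).entry x y = ∑ w ∈ s, (S.1 i).entry x w * (T.1 i).entry w y :=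
      fun y => RCMat.mul_eq_sum (S.1 i) (T.1 i) x y s hS
    rw [lpAct_eq_sum φ S.1 _ i x s hS, lpAct_eq_sum φ (S.1 * T.1) v i x t]
    · have e1 : ∀ y, φ (((S.1 * T.1) i).entry x y) (v ⟨i, y⟩) =
          ∑ w ∈ s, φ ((S.1 i).entry x w) (φ ((T.1 i).entry w y) (v ⟨i, y⟩)) := by
        intro y
        rw [hmul, map_sum, _root_.sum_apply]
        refine Finset.sum_congr rfl fun w _ => ?_
        rw [map_mul]
        rfl
      simp only [e1]
      rw [Finset.sum_comm]
      refine Finset.sum_congr rfl fun w hw => ?_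
      rw [lpAct_eq_sum φ T.1 v i w t (hT w hw), map_sum]
    · intro y hy
      by_contra h0
      refine hy ?_
      rw [hmul]
      refine Finset.sum_eq_zero fun w hw => ?_
      rw [not_not.1 fun h => h0 (hT w hw y h), mul_zero]
  map_star' T := lpOp_star φ T.2

theorem lpRep_apply (T : goodAlgebra Γ Xs) (v : lp (fun _ : Σ i, Xs i => K) 2) (z : Σ i, Xs i) :
    lpRep φ T v z = lpAct φ T.1 v z := rfl

end MatrixRepresentation

/-! ### Point evaluations bound the reduced norm -/

section Evaluation

variable {X H I : Type u} [MetricSpace X] [BoundedGeometry X] [NormedAddCommGroup H]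
  [InnerProductSpace ℝ H]

/-- Evaluation at a point, followed by a representation of the Clifford algebra. -/
def evalHom (q : HKTSpace H) (c : CliffordRep H) :
    HKTFun H →⋆ₙₐ[ℂ] (RepSpace H →L[ℂ] RepSpace H) where
  toFun a := (a q) c
  map_smul' _ _ := rfl
  map_zero' := rfl
  map_add' _ _ := rfl
  map_mul' _ _ := rfl
  map_star' _ := rfl

theorem norm_le_of_evalHom {a : HKTFun H} {C : ℝ} (hC : 0 ≤ C)
    (h : ∀ q c, ‖evalHom q c a‖ ≤ C) : ‖a‖ ≤ C :=
  BddFun.norm_le hC fun q => BddFun.norm_le hC fun c => h q c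

theorem evalHom_star_mul (q : HKTSpace H) (c : CliffordRep H) (a b : HKTFun H)
    (w u : RepSpace H) : inner ℂ w (evalHom q c (star a * b) u) =
      inner ℂ (evalHom q c a w) (evalHom q c b u) := by
  rw [map_mul, map_star, ContinuousLinearMap.star_eq_adjoint, _root_.mul_apply_eq_comp,
    ContinuousLinearMap.adjoint_inner_right]

theorem hasSum_inner_evalHom {Z : Type*} {η : Z → HKTFun H} {b : HKTFun H}
    (h : HasSum (fun z => star (η z) * η z) b) (q : HKTSpace H) (c : CliffordRep H)
    (w u : RepSpace H) :
    HasSum (fun z => inner ℂ (evalHom q c (η z) w) (evalHom q c (η z) u))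
      (inner ℂ w (evalHom q c b u)) := by
  have hc : Continuous fun a : HKTFun H => inner ℂ w (evalHom q c a u) :=
    continuous_const.inner
      ((ContinuousLinearMap.apply ℂ (RepSpace H) u).continuous.comp
        (AddMonoidHomClass.continuous_of_bound (evalHom q c) 1 fun a =>
          (norm_apply_le_of_hom (evalHom q c) a).trans_eq (one_mul _).symm))
  let g : HKTFun H →+ ℂ :=
    { toFun := fun a => inner ℂ w (evalHom q c a u)
      map_zero' := by rw [map_zero]; exact inner_zero_right _
      map_add' := fun a b => by rw [map_add]; exact inner_add_right _ _ _ }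
  have e : (fun z => inner ℂ (evalHom q c (η z) w) (evalHom q c (η z) u)) =
      g ∘ fun z => star (η z) * η z := funext fun z => (evalHom_star_mul q c (η z) (η z) w u).symm
  rw [e]
  exact h.map g hc

variable {Xs : I → Set X} {Γ : Gauge I (HKTFun H)}

/-- Evaluating the convergent series `∑ ξ* ξ` in the vector state of `u` shows that the vectors `ξ_z
u` are square summable with total at most `‖u‖²`. -/
theorem exists_lp_evalHom {Z : Type u} {ξ : Z → HKTFun H}
    (hs : Summable fun z => star (ξ z) * ξ z) (h1 : ‖∑' z, star (ξ z) * ξ z‖ ≤ 1)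
    (q : HKTSpace H) (c : CliffordRep H) (u : RepSpace H) :
    ∃ Ξ : lp (fun _ : Z => RepSpace H) 2, (∀ z, Ξ z = evalHom q c (ξ z) u) ∧ ‖Ξ‖ ≤ ‖u‖ := by
  have hsum := hasSum_inner_evalHom hs.hasSum q c u u
  have hre : HasSum (fun z => ‖evalHom q c (ξ z) u‖ ^ 2)
      (inner ℂ u (evalHom q c (∑' z, star (ξ z) * ξ z) u)).re := by
    have e : (fun z => ‖evalHom q c (ξ z) u‖ ^ 2) = fun z =>
        (inner ℂ (evalHom q c (ξ z) u) (evalHom q c (ξ z) u)).re := funext fun z => by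
      rw [inner_self_eq_norm_sq_to_K]
      norm_cast
    rw [e]
    exact Complex.hasSum_re hsum
  have hle : ∀ s : Finset Z, ∑ z ∈ s, ‖evalHom q c (ξ z) u‖ ^ 2 ≤ ‖u‖ ^ 2 := by
    intro s
    refine (sum_le_hasSum s (fun z _ => by positivity) hre).trans ((Complex.re_le_norm _).trans ?_)
    refine (norm_inner_le_norm _ _).trans ?_
    rw [sq]
    refine mul_le_mul_of_nonneg_left ?_ (norm_nonneg _)
    exact (ContinuousLinearMap.le_of_opNorm_le _
      ((norm_apply_le_of_hom (evalHom q c) _).trans h1) _).trans_eq (one_mul _)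
  exact ⟨⟨_, memℓp_two_of_sum_le hle⟩, fun z => rfl, lp_norm_le_of_sum_le (norm_nonneg _) hle⟩

/-- The norm of `A` is the supremum over point evaluations and Clifford representations. After such
an evaluation, the module action becomes `lpRep` applied to the square-summable vectors of
`exists_lp_evalHom`. -/
theorem redNorm_le {V : Submodule ℝ H} {O : I → Set (HKTSpace H)}
    (T : goodAlgebra Γ (fun i => Xs i)) {m : ℝ} (hm : 0 ≤ m)
    (hT : ∀ (q : HKTSpace H) (c : CliffordRep H), ‖lpRep (evalHom q c) T‖ ≤ m) :
    redNorm V O T.1 ≤ ENNReal.ofReal m := by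
  rw [redNorm]
  refine iSup_le fun ξ => iSup₂_le fun hξ h1 => ?_
  rw [moduleNorm_eq] at h1 ⊢
  refine ENNReal.ofReal_le_ofReal ((Real.sqrt_le_left hm).2 ?_)
  rw [ENNReal.ofReal_le_one, Real.sqrt_le_one] at h1
  -- If the series of the image did not converge, `tsum` would be `0` and there would be nothing to
  -- bound.
  by_cases hs : Summable fun z => star (matAct T.1 ξ z) * matAct T.1 ξ z
  swap
  · rw [tsum_eq_zero_of_not_summable hs, norm_zero]
    positivity
  refine norm_le_of_evalHom (by positivity) fun q c => ?_
  have hact : ∀ (u : RepSpace H) (Ξ : lp (fun _ : Σ i, Xs i => RepSpace H) 2),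
      (∀ z, Ξ z = evalHom q c (ξ z) u) →
      ∀ z, lpRep (evalHom q c) T Ξ z = evalHom q c (matAct T.1 ξ z) u := by
    rintro u Ξ hΞ ⟨i, x⟩
    have h2 : matAct T.1 ξ ⟨i, x⟩ =
        ∑ y ∈ ((T.1 i).finite_row x).toFinset, (T.1 i).entry x y * ξ ⟨i, y⟩ :=
      finsum_eq_sum_of_support_subset _ fun y hy => by
        rw [Finset.mem_coe, Set.Finite.mem_toFinset]
        exact fun h0 => hy (by simp only [h0, zero_mul])
    rw [lpRep_apply, lpAct_eq_sum_row, h2, map_sum, _root_.sum_apply]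
    refine Finset.sum_congr rfl fun y _ => ?_
    rw [hΞ, map_mul]
    rfl
  refine ContinuousLinearMap.opNorm_le_bound _ (by positivity) fun u => ?_
  set b := ∑' z, star (matAct T.1 ξ z) * matAct T.1 ξ z with hb
  set w := evalHom q c b u with hw
  obtain ⟨Ξu, hu, hun⟩ := exists_lp_evalHom hξ.summable h1 q c u
  obtain ⟨Ξw, hw', hwn⟩ := exists_lp_evalHom hξ.summable h1 q c w
  have e1 := hasSum_inner_evalHom hs.hasSum q c w u
  have e2 := lp.hasSum_inner (𝕜 := ℂ) (lpRep (evalHom q c) T Ξw) (lpRep (evalHom q c) T Ξu)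
  simp only [hact w Ξw hw', hact u Ξu hu] at e2
  have e3 := e1.unique e2
  -- With `w = b u`, the number `⟨w, b u⟩` is both `‖w‖²` and the inner product of the images of the
  -- vectors attached to `w` and `u`.
  have e4 : ‖w‖ ^ 2 ≤ (m * ‖w‖) * (m * ‖u‖) := by
    have : ‖inner ℂ w w‖ = ‖w‖ ^ 2 := by
      rw [inner_self_eq_norm_sq_to_K, norm_pow, RCLike.norm_ofReal, abs_norm]
    rw [← this]
    have e5 : inner ℂ w w = inner ℂ (lpRep (evalHom q c) T Ξw) (lpRep (evalHom q c) T Ξu) := e3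
    rw [e5]
    refine (norm_inner_le_norm _ _).trans ?_
    have e6 : ∀ v, ‖lpRep (evalHom q c) T v‖ ≤ m * ‖v‖ := fun v =>
      ContinuousLinearMap.le_of_opNorm_le _ (hT q c) v
    exact mul_le_mul ((e6 _).trans (mul_le_mul_of_nonneg_left hwn hm))
      ((e6 _).trans (mul_le_mul_of_nonneg_left hun hm)) (norm_nonneg _) (by positivity)
  rcases (norm_nonneg w).eq_or_lt with h0 | h0
  · rw [← h0]
    positivity
  · nlinarith

end Evaluation

/-! ### Completions with equal norms are isomorphic -/

section Extension

variable {A B C : Type*} [NonUnitalRing A] [StarRing A] [Module ℂ A] [IsScalarTower ℂ A A]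
  [SMulCommClass ℂ A A] [NonUnitalCStarAlgebra B] [NonUnitalCStarAlgebra C]

/-- The closure of the image of `a ↦ (ι a, κ a)`. -/
def closedGraph (ι : A →⋆ₙₐ[ℂ] B) (κ : A →⋆ₙₐ[ℂ] C) : NonUnitalStarSubalgebra ℂ (B × C) :=
  (NonUnitalStarAlgHom.range (ι.prod κ)).topologicalClosure

instance (ι : A →⋆ₙₐ[ℂ] B) (κ : A →⋆ₙₐ[ℂ] C) : IsClosed (closedGraph ι κ : Set (B × C)) :=
  NonUnitalStarSubalgebra.isClosed_topologicalClosure _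

theorem mem_closedGraph (ι : A →⋆ₙₐ[ℂ] B) (κ : A →⋆ₙₐ[ℂ] C) (a : A) :
    (ι a, κ a) ∈ closedGraph ι κ :=
  NonUnitalStarSubalgebra.le_topologicalClosure _ ⟨a, rfl⟩

theorem norm_fst_eq_norm_snd {ι : A →⋆ₙₐ[ℂ] B} {κ : A →⋆ₙₐ[ℂ] C} (h : ∀ a, ‖ι a‖ = ‖κ a‖)
    {z : B × C} (hz : z ∈ closedGraph ι κ) : ‖z.1‖ = ‖z.2‖ := by
  have hc : IsClosed {z : B × C | ‖z.1‖ = ‖z.2‖} :=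
    isClosed_eq continuous_fst.norm continuous_snd.norm
  refine closure_minimal ?_ hc hz
  rintro _ ⟨a, rfl⟩
  exact h a

theorem bijective_of_isometric_dense {D E : Type*} [NonUnitalCStarAlgebra D]
    [NonUnitalCStarAlgebra E] (φ : D →⋆ₙₐ[ℂ] E) (h : ∀ d, ‖φ d‖ = ‖d‖) (hd : DenseRange φ) :
    Function.Bijective φ := by
  have hi : Isometry φ := AddMonoidHomClass.isometry_of_norm φ h
  refine ⟨hi.injective, Set.range_eq_univ.1 ?_⟩
  rw [← hi.isClosedEmbedding.isClosed_range.closure_eq]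
  exact hd.closure_range

/-- Two dense images of a `*`-algebra with the same norms are canonically isomorphic. -/
theorem exists_starAlgEquiv {ι : A →⋆ₙₐ[ℂ] B} {κ : A →⋆ₙₐ[ℂ] C} (h : ∀ a, ‖ι a‖ = ‖κ a‖)
    (hι : DenseRange ι) (hκ : DenseRange κ) : ∃ Λ : B ≃⋆ₐ[ℂ] C, ∀ a, Λ (ι a) = κ a := by
  let s := NonUnitalStarSubalgebraClass.subtype (closedGraph ι κ)
  let φ : closedGraph ι κ →⋆ₙₐ[ℂ] B := (NonUnitalStarAlgHom.fst ℂ B C).comp s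
  let ψ : closedGraph ι κ →⋆ₙₐ[ℂ] C := (NonUnitalStarAlgHom.snd ℂ B C).comp s
  have hn (z : closedGraph ι κ) : ‖z‖ = max ‖z.1.1‖ ‖z.1.2‖ := rfl
  have hφ : Function.Bijective φ := by
    refine bijective_of_isometric_dense φ (fun z => ?_) (hι.mono ?_)
    · rw [hn, ← norm_fst_eq_norm_snd h z.2, max_self]
      rfl
    · rintro _ ⟨a, rfl⟩
      exact ⟨⟨_, mem_closedGraph ι κ a⟩, rfl⟩
  have hψ : Function.Bijective ψ := by
    refine bijective_of_isometric_dense ψ (fun z => ?_) (hκ.mono ?_)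
    · rw [hn, norm_fst_eq_norm_snd h z.2, max_self]
      rfl
    · rintro _ ⟨a, rfl⟩
      exact ⟨⟨_, mem_closedGraph ι κ a⟩, rfl⟩
  refine ⟨(StarAlgEquiv.ofBijective φ hφ).symm.trans (StarAlgEquiv.ofBijective ψ hψ), fun a => ?_⟩
  have h1 : (StarAlgEquiv.ofBijective φ hφ).symm (ι a) = ⟨_, mem_closedGraph ι κ a⟩ := by
    rw [StarAlgEquiv.symm_apply_eq]
    rfl
  rw [StarAlgEquiv.trans_apply, h1]
  rfl

end Extension

/-! ### Existence of the maximal completion -/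

section Maximal

variable {A : Type u} [NonUnitalRing A] [StarRing A] [Module ℂ A]

/-- A `*`-representation on a Hilbert space. -/
structure HilbertRep (A : Type u) [NonUnitalRing A] [StarRing A] [Module ℂ A] where
  /-- The Hilbert space. -/
  space : Type u
  [normed : NormedAddCommGroup space]
  [inner : InnerProductSpace ℂ space]
  [complete : CompleteSpace space]
  /-- The homomorphism. -/
  hom : A →⋆ₙₐ[ℂ] (space →L[ℂ] space)

attribute [instance] HilbertRep.normed HilbertRep.inner HilbertRep.complete

theorem HilbertRep.enorm_le (π : HilbertRep A) (a : A) : ‖π.hom a‖ₑ ≤ maxNorm a :=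
  le_iSup_of_le π.space <| le_iSup_of_le π.normed <| le_iSup_of_le π.inner <|
    le_iSup_of_le π.complete <| le_iSup_of_le π.hom le_rfl

theorem exists_lt_of_lt_maxNorm {a : A} {c : ℝ≥0∞} (h : c < maxNorm a) :
    ∃ π : HilbertRep A, c < ‖π.hom a‖ₑ := by
  simp only [maxNorm, lt_iSup_iff] at h
  obtain ⟨K, _, _, _, π, h⟩ := h
  exact ⟨⟨K, π⟩, h⟩

/-- A family of representations that attains the maximal norm. -/
def normingRep (j : {j : A × ℝ≥0∞ // j.2 < maxNorm j.1}) : HilbertRep A :=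
  (exists_lt_of_lt_maxNorm j.2).choose

theorem lt_normingRep (j : {j : A × ℝ≥0∞ // j.2 < maxNorm j.1}) :
    j.1.2 < ‖(normingRep j).hom j.1.1‖ₑ := (exists_lt_of_lt_maxNorm j.2).choose_spec

theorem norm_normingRep_le (h : ∀ a : A, maxNorm a ≠ ⊤) (a : A)
    (j : {j : A × ℝ≥0∞ // j.2 < maxNorm j.1}) :
    ‖(normingRep j).hom a‖ ≤ (maxNorm a).toReal := by
  rw [← toReal_enorm]
  exact ENNReal.toReal_mono (h a) ((normingRep j).enorm_le a)

/-- The sum of the norming representations. -/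
def universalHom (h : ∀ a : A, maxNorm a ≠ ⊤) : A →⋆ₙₐ[ℂ]
    lp (fun j : {j : A × ℝ≥0∞ // j.2 < maxNorm j.1} =>
      (normingRep j).space →L[ℂ] (normingRep j).space) ∞ where
  toFun a := ⟨fun j => (normingRep j).hom a, memℓp_infty
    ⟨(maxNorm a).toReal, by rintro _ ⟨j, rfl⟩; exact norm_normingRep_le h a j⟩⟩
  map_smul' c a := by ext1; funext j; exact map_smul (normingRep j).hom c a
  map_zero' := by ext1; funext j; exact map_zero (normingRep j).hom
  map_add' a b := by ext1; funext j; exact map_add (normingRep j).hom a b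
  map_mul' a b := by ext1; funext j; exact map_mul (normingRep j).hom a b
  map_star' a := by ext1; funext j; exact map_star (normingRep j).hom a

/-- For every `c < maxNorm a` the coordinate with index `(a, c)` exceeds `c`. Indexing by such pairs
keeps the family of representations in the universe of `A`. -/
theorem enorm_universalHom (h : ∀ a : A, maxNorm a ≠ ⊤) (a : A) :
    ‖universalHom h a‖ₑ = maxNorm a := by
  refine le_antisymm ?_ (le_of_forall_lt fun c hc => ?_)
  · rw [← ofReal_norm, ← ENNReal.ofReal_toReal (h a)]
    exact ENNReal.ofReal_le_ofReal
      (lp.norm_le_of_forall_le ENNReal.toReal_nonneg fun j => norm_normingRep_le h a j)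
  · refine (lt_normingRep ⟨(a, c), hc⟩).trans_le ?_
    rw [← ofReal_norm, ← ofReal_norm]
    exact ENNReal.ofReal_le_ofReal
      (lp.norm_apply_le_norm ENNReal.top_ne_zero (universalHom h a) ⟨(a, c), hc⟩)

/-- A `*`-algebra with finite maximal norm has a maximal completion. -/
theorem exists_maximal_completion [IsScalarTower ℂ A A] [SMulCommClass ℂ A A]
    (h : ∀ a : A, maxNorm a ≠ ⊤) :
    ∃ (B : Type u) (_ : NonUnitalCStarAlgebra B) (ι : A →⋆ₙₐ[ℂ] B),
      IsCStarCompletion maxNorm ι := by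
  let S := (NonUnitalStarAlgHom.range (universalHom h)).topologicalClosure
  have : IsClosed (S : Set (lp (fun j : {j : A × ℝ≥0∞ // j.2 < maxNorm j.1} =>
      (normingRep j).space →L[ℂ] (normingRep j).space) ∞)) :=
    NonUnitalStarSubalgebra.isClosed_topologicalClosure _
  have hS : ∀ a, universalHom h a ∈ S := fun a =>
    NonUnitalStarSubalgebra.le_topologicalClosure _ ⟨a, rfl⟩
  refine ⟨S, inferInstance, NonUnitalStarAlgHom.codRestrict (universalHom h) S hS,
    fun a => enorm_universalHom h a, fun z => ?_⟩
  rw [closure_subtype]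
  have hz : z.1 ∈ closure (Set.range (universalHom h)) := z.2
  refine closure_mono ?_ hz
  rintro _ ⟨a, rfl⟩
  exact ⟨⟨_, hS a⟩, ⟨a, rfl⟩, rfl⟩

end Maximal

/-! ### Comparison of the two norms on the twisted algebra -/

section Twisted

variable {X Y H I : Type u} [MetricSpace X] [BoundedGeometry X] [MetricSpace Y] [BoundedGeometry Y]
  [NormedAddCommGroup H] [InnerProductSpace ℝ H] [CompleteSpace H]
  {f : Y → H} {p : X → Y} {O : I → Set (HKTSpace H)} {x₀ : I → X} {Xs : I → Set X}

theorem mem_twistedSubalgebra {T : ∀ i, RCMat (Xs i) (HKTFun H)} :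
    T ∈ twistedSubalgebra f p O x₀ Xs ↔ IsTwisted f p O x₀ Xs T := by
  rw [twistedSubalgebra_eq, mem_goodAlgebra, isTwisted_iff]

namespace TwistedAlgebra

/-- Twisted families are good for the gauge `hktGauge`. -/
def toGood : TwistedAlgebra f p O x₀ Xs →⋆ₙₐ[ℂ]
    goodAlgebra (hktGauge f p O x₀) (fun i => Xs i) :=
  NonUnitalStarSubalgebra.inclusion twistedSubalgebra_eq.le

/-- Families that are good for the gauge `hktGauge` are twisted. -/
def ofGood : goodAlgebra (hktGauge f p O x₀) (fun i => Xs i) →⋆ₙₐ[ℂ]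
    TwistedAlgebra f p O x₀ Xs :=
  NonUnitalStarSubalgebra.inclusion twistedSubalgebra_eq.ge

theorem isTwisted (T : TwistedAlgebra f p O x₀ Xs) : IsTwisted f p O x₀ Xs T.val :=
  mem_twistedSubalgebra.1 T.2

theorem isGood (T : TwistedAlgebra f p O x₀ Xs) : IsGood (hktGauge f p O x₀) T.val :=
  T.isTwisted.isGood

theorem rep_comp_ofGood {K : Type u} [NormedAddCommGroup K] [InnerProductSpace ℂ K]
    [CompleteSpace K] (π : TwistedAlgebra f p O x₀ Xs →⋆ₙₐ[ℂ] (K →L[ℂ] K))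
    (T : TwistedAlgebra f p O x₀ Xs) : rep (π.comp ofGood) T.val = π T :=
  rep_of _ T.isGood

theorem maxNorm_le {T : TwistedAlgebra f p O x₀ Xs} {m : ℝ}
    (h : ∀ (K : Type u) [NormedAddCommGroup K] [InnerProductSpace ℂ K] [CompleteSpace K]
      (π : goodAlgebra (hktGauge f p O x₀) (fun i => Xs i) →⋆ₙₐ[ℂ] (K →L[ℂ] K)),
      ‖rep π T.val‖ ≤ m) : maxNorm T ≤ ENNReal.ofReal m := by
  refine iSup_le fun K => iSup_le fun _ => iSup_le fun _ => iSup_le fun _ => iSup_le fun π => ?_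
  rw [← rep_comp_ofGood π T, ← ofReal_norm]
  exact ENNReal.ofReal_le_ofReal (h K _)

/-- The bound by propagation and entry size in `exists_norm_rep_le` is independent of the
representation. -/
theorem maxNorm_ne_top (T : TwistedAlgebra f p O x₀ Xs) : maxNorm T ≠ ⊤ := by
  obtain ⟨S, -, hS⟩ := T.isGood.exists_prop
  obtain ⟨M, hM0, hM⟩ := T.isGood.exists_bdd
  obtain ⟨C, -, hC⟩ := exists_norm_rep_le.{u, u} (fun i => Xs i) (hktGauge f p O x₀) S
  exact ((maxNorm_le fun K _ _ _ π => hC K π T.val M hM0.le T.isGood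
    (fun i x y h => (hS i x y h).le) hM).trans_lt ENNReal.ofReal_lt_top).ne

/-- The representations `lpRep (evalHom q c)` take part in the supremum that defines the maximal
norm. -/
theorem redNorm_le_maxNorm (T : TwistedAlgebra f p O x₀ Xs) :
    redNorm (totalSpan f) O T.val ≤ maxNorm T := by
  rw [← ENNReal.ofReal_toReal T.maxNorm_ne_top]
  refine redNorm_le (toGood T) ENNReal.toReal_nonneg fun q c => ?_
  rw [← toReal_enorm]
  exact ENNReal.toReal_mono T.maxNorm_ne_top
    (HilbertRep.enorm_le ⟨_, (lpRep (evalHom q c)).comp toGood⟩ T)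

/-- Under equi-property A, the maximal and the reduced norm agree. -/
theorem maxNorm_eq_redNorm (hXs : EquiPropertyA Xs) (T : TwistedAlgebra f p O x₀ Xs) :
    maxNorm T = redNorm (totalSpan f) O T.val := by
  refine le_antisymm ?_ T.redNorm_le_maxNorm
  have ht : redNorm (totalSpan f) O T.val ≠ ⊤ :=
    (T.redNorm_le_maxNorm.trans_lt T.maxNorm_ne_top.lt_top).ne
  rw [← ENNReal.ofReal_toReal ht]
  obtain ⟨N, c, -, hmem⟩ := T.isGood.mem
  exact maxNorm_le fun K _ _ _ π => norm_rep_le_of_matNorm π (hasKernels_of_equiPropertyA hXs)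
    T.isGood ENNReal.toReal_nonneg fun i B => matNorm_compress_le_of_redNorm
      (fun i x y => (hmem i x y).1) ENNReal.toReal_nonneg (ENNReal.ofReal_toReal ht).ge i B

end TwistedAlgebra

end Twisted

end

end TwistedRoe

theorem proposition3
    {X Y H I : Type u} [MetricSpace X] [TwistedRoe.BoundedGeometry X]
    [MetricSpace Y] [TwistedRoe.BoundedGeometry Y]
    [NormedAddCommGroup H] [InnerProductSpace ℝ H] [CompleteSpace H]
    (p : X → Y) (f : Y → H) (hpf : TwistedRoe.IsAbyCEFibration p f)
    (hdense : Dense (TwistedRoe.totalSpan f : Set H))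
    (r : ℝ) (hr : 0 < r) (O : I → Set (TwistedRoe.HKTSpace H)) (x₀ : I → X)
    (hO : TwistedRoe.IsSeparate r (fun i => f (p (x₀ i))) O)
    (Xs : I → Set X) (hXs : TwistedRoe.EquiPropertyA Xs) (hx₀ : ∀ i, x₀ i ∈ Xs i) :
    -- the families satisfying the defining conditions form a `*`-algebra
    (∀ T, T ∈ TwistedRoe.twistedSubalgebra f p O x₀ Xs ↔ TwistedRoe.IsTwisted f p O x₀ Xs T) ∧
    -- the maximal and the reduced completion exist
    (∃ (B : Type u) (_ : NonUnitalCStarAlgebra B)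
      (ι : TwistedRoe.TwistedAlgebra f p O x₀ Xs →⋆ₙₐ[ℂ] B),
      TwistedRoe.IsCStarCompletion TwistedRoe.maxNorm ι) ∧
    (∃ (C : Type u) (_ : NonUnitalCStarAlgebra C)
      (κ : TwistedRoe.TwistedAlgebra f p O x₀ Xs →⋆ₙₐ[ℂ] C),
      TwistedRoe.IsCStarCompletion
        (fun T => TwistedRoe.redNorm (TwistedRoe.totalSpan f) O T.val) κ) ∧
    -- the canonical map from the former to the latter is an isomorphism
    ∀ (B : Type v) (C : Type w) [NonUnitalCStarAlgebra B] [NonUnitalCStarAlgebra C]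
      (ι : TwistedRoe.TwistedAlgebra f p O x₀ Xs →⋆ₙₐ[ℂ] B)
      (κ : TwistedRoe.TwistedAlgebra f p O x₀ Xs →⋆ₙₐ[ℂ] C),
      TwistedRoe.IsCStarCompletion TwistedRoe.maxNorm ι →
      TwistedRoe.IsCStarCompletion
        (fun T => TwistedRoe.redNorm (TwistedRoe.totalSpan f) O T.val) κ →
      ∃ Λ : B ≃⋆ₐ[ℂ] C, ∀ T, Λ (ι T) = κ T := by
  have key := TwistedRoe.TwistedAlgebra.maxNorm_eq_redNorm (f := f) (p := p) (O := O) (x₀ := x₀) hXs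
  obtain ⟨B, _, ι, hι⟩ := TwistedRoe.exists_maximal_completion
    (TwistedRoe.TwistedAlgebra.maxNorm_ne_top (f := f) (p := p) (O := O) (x₀ := x₀) (Xs := Xs))
  refine ⟨fun T => TwistedRoe.mem_twistedSubalgebra, ⟨B, inferInstance, ι, hι⟩,
    -- Since the two norms agree, the maximal completion also serves as the reduced one.
    ⟨B, inferInstance, ι, fun T => (hι.norm_eq T).trans (key T), hι.dense⟩, ?_⟩
  intro B C _ _ ι κ hι hκ
  refine TwistedRoe.exists_starAlgEquiv (fun T => ?_) hι.dense hκ.dense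
  have h : ‖ι T‖ₑ = ‖κ T‖ₑ := (hι.norm_eq T).trans ((key T).trans (hκ.norm_eq T).symm)
  rw [← toReal_enorm, h, toReal_enorm]
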